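/- **Setting.** Let $f:\mathbb{R}^{m\times n}\to\mathbb{R}$ be convex and differentiable, $t>0$, and consider $$\min\{f(Z): Z\in\mathbb{R}^{m\times n},\ \|Z\|_{nuc}\le t/2\},\qquad(\ast)$$ where $\|Z\|_{nuc}$ is the sum of the singular values of $Z$. Call $Z$ an *$\varepsilon$-close solution* if $\|Z\|_{nuc}\le t/2$ and $f(Z)\le f(Z')+\varepsilon$ for every feasible $Z'$. Let $N=m+n$, $\mathcal S=\{X\in\mathbb{S}^{N\times N}: X\succeq0,\ \mathrm{tr}X=1\}$, and define $\tilde f(X):=f(tX_{12})$, where $X_{12}\in\mathbb{R}^{m\times n}$ is the upper right block of $X$. The gradient of $\tilde f$ is taken in the space of symmetric matrices with the Frobenius inner product $\bullet$, so that $\nabla\tilde f(X)=\frac t2\begin{pmatrix}0&G\\G^T&0\end{pmatrix}$ with $G=\nabla f(tX_{12})$. Let $C$ be an upper bound on the curvature constant $$C_{\tilde f}=\sup_{X,V\in\mathcal S,\ \alpha\in(0,1]}\frac1{\alpha^2}\Big(\tilde f(Y)-\tilde f(X)-(Y-X)\bullet\nabla\tilde f(X)\Big),\qquad Y=X+\alpha(V-X).$$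 **The algorithm (nuclear norm solver).** Start at $X^{(0)}=v_0v_0^T$ with an arbitrary unit vector $v_0\in\mathbb{R}^N$. For $k=0,1,2,\dots$ let $\alpha_k=\frac2{k+2}$, compute $v^{(k)}=\mathrm{ApproxEV}(\nabla\tilde f(X^{(k)}),\alpha_kC)$, and set $X^{(k+1)}=X^{(k)}+\alpha_k(v^{(k)}v^{(k)T}-X^{(k)})$. Here $\mathrm{ApproxEV}(A,\varepsilon')$ returns any unit vector $v$ with $v^TAv\le\lambda_{\min}(A)+\varepsilon'$. The solution after $k$ iterations is $Z^{(k)}=tX^{(k)}_{12}$. **(1) Iterations.** For all $\varepsilon>0$ and all $k\ge1$ with $k\ge 8C/\varepsilon$, $Z^{(k)}$ is an $\varepsilon$-close solution of $(\ast)$. Thus $O(1/\varepsilon)$ iterations, each with one approximate eigenvector computation, suffice. **(2) Running time with Lanczos' method.** Let $N_f$ be the number of positions $(i,j)$ at which $\nabla f$ is not identically zero (the number of matrix entries on which $f$ depends). Assume $C>0$, and let $L>0$ bound the spectral norm of $\nabla\tilde f(X)$ for all $X\in\mathcal S$. Implement each $\mathrm{ApproxEV}$ by Lanczos' method, as follows.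 * Work on the rows and columns that meet these $N_f$ positions, from a fresh, normalized standard Gaussian start vector, with at most $q_k$ Lanczos steps (three-term recurrence), stopping when the Krylov space is exhausted or when there are as many steps as coordinates. * Compute the smallest Ritz vector from the tridiagonal matrix $T$ by $q_k$ bisection steps on $[-2L,L]$, each testing positivity of the pivots of $T-\mu I$, followed by one tridiagonal solve $(T-\mu I)y=(1,-1,1,\dots)^T$ at the lower end $\mu$ of the final interval, and normalize the corresponding combination of Lanczos vectors. The iterate is stored through its $N_f$ relevant entries and the vectors $v^{(k)}$. Every real addition, subtraction, multiplication, division, square root and comparison, every gradient entry read from the gradient oracle and every random number costs one operation; the evaluation of $\nabla f$ by the oracle (once per iteration) is not charged otherwise. There are absolute constants $a,b>0$ such that for all such data, all $\varepsilon>0$ and all $\delta\in(0,1)$, with $$\ell=1+\log\frac N\delta,\qquad K=\lceil aC/\varepsilon\rceil+1,\qquad q_k=\Big\lceil a\,\ell\,\Big(1+\sqrt{L/(\alpha_kC)}\Big)\Big\rceil,$$ the solver run for $K$ iterations always uses at most $$b\,\max\{1,N_f\}\;\ell\;\big(1+\sqrt{L/C}\big)\,\big(1+C/\varepsilon\big)^{3/2}$$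 arithmetic operations, and with probability at least $1-\delta$ its result $Z^{(K)}$ is an $\varepsilon$-close solution of $(\ast)$. In particular, for fixed $C$ and $L$ and as $\varepsilon\to0$, this is $\tilde O(N_f/\varepsilon^{1.5})$ operations with high probability, where $\tilde O$ suppresses only the factor $\log(N/\delta)$. -/

import Mathlib

open scoped Matrix
open MeasureTheory ProbabilityTheory

noncomputable section

namespace NucFW

/-! ### Matrices, spectahedron, nuclear norm, gradients -/

/-- The nuclear norm: the sum of the singular values (those with index `≥ n` vanish). -/
def nucNorm {m n : ℕ} (Z : Matrix (Fin m) (Fin n) ℝ) : ℝ :=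
  ∑ k ∈ Finset.range n, (Matrix.toEuclideanLin Z).singularValues k

/-- `Z` is feasible for the problem `min {f(Z') : ‖Z'‖_nuc ≤ t/2}`
and its value is within `ε` of the optimal one. -/
def IsEpsSolution {m n : ℕ} (f : Matrix (Fin m) (Fin n) ℝ → ℝ) (t ε : ℝ)
    (Z : Matrix (Fin m) (Fin n) ℝ) : Prop :=
  nucNorm Z ≤ t / 2 ∧ ∀ Z', nucNorm Z' ≤ t / 2 → f Z ≤ f Z' + ε

section General

variable {ι κ : Type} [Fintype ι] [DecidableEq ι] [Fintype κ] [DecidableEq κ]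

/-- The spectahedron: positive semidefinite matrices of unit trace. -/
def spectahedron (ι : Type) [Fintype ι] : Set (Matrix ι ι ℝ) :=
  {X | X.PosSemidef ∧ X.trace = 1}

/-- The Frobenius inner product `X • Y`. -/
def frob (X Y : Matrix ι κ ℝ) : ℝ := ∑ i, ∑ j, X i j * Y i j

/-- The matrix of partial derivatives of `F` at `X`. -/
def matGrad (F : Matrix ι κ ℝ → ℝ) (X : Matrix ι κ ℝ) : Matrix ι κ ℝ :=
  Matrix.of fun i j => fderiv ℝ F X (Matrix.single i j 1)

/-- The gradient of `F`, as a function on the space of symmetric matrices with the Frobenius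
inner product: the symmetric part of the matrix of partial derivatives. -/
def symGrad (F : Matrix ι ι ℝ → ℝ) (X : Matrix ι ι ℝ) : Matrix ι ι ℝ :=
  (1 / 2 : ℝ) • (matGrad F X + (matGrad F X)ᵀ)

/-- The curvature constant of `F` over the spectahedron, as an extended real. -/
def curvature (F : Matrix ι ι ℝ → ℝ) : EReal :=
  ⨆ (X ∈ spectahedron ι) (V ∈ spectahedron ι) (α ∈ Set.Ioc (0 : ℝ) 1),
    ((1 / α ^ 2 * (F (X + α • (V - X)) - F X - frob (α • (V - X)) (symGrad F X)) : ℝ) : EReal)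

/-! ### Hazan's algorithm -/

/-- The step size `2 / (k + 2)`. -/
def stepSize (k : ℕ) : ℝ := 2 / ((k : ℝ) + 2)

/-- An admissible answer of `ApproxEV(A, ε')`: a unit vector `v` with
`vᵀ A v ≤ λ_min(A) + ε'`. -/
def IsApproxEV (A : Matrix ι ι ℝ) (ε' : ℝ) (v : ι → ℝ) : Prop :=
  v ⬝ᵥ v = 1 ∧ ∀ μ ∈ spectrum ℝ A, v ⬝ᵥ (A *ᵥ v) ≤ μ + ε'

/-- The iterates `X⁽⁰⁾ = v₀ v₀ᵀ`, `X⁽ᵏ⁺¹⁾ = X⁽ᵏ⁾ + α (v⁽ᵏ⁾ v⁽ᵏ⁾ᵀ - X⁽ᵏ⁾)`, `α = 2/(k+2)`,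
determined by the vectors `v⁽ᵏ⁾`. -/
def iterate (v₀ : ι → ℝ) (v : ℕ → ι → ℝ) : ℕ → Matrix ι ι ℝ
  | 0 => Matrix.vecMulVec v₀ v₀
  | k + 1 => iterate v₀ v k + stepSize k • (Matrix.vecMulVec (v k) (v k) - iterate v₀ v k)

/-- The vectors `v⁽ᵏ⁾` are produced by a run of Hazan's algorithm on `F` with curvature
parameter `C`, started at `v₀ v₀ᵀ`. -/
def IsHazanRun (F : Matrix ι ι ℝ → ℝ) (C : ℝ) (v₀ : ι → ℝ) (v : ℕ → ι → ℝ) : Prop :=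
  v₀ ⬝ᵥ v₀ = 1 ∧ ∀ k, IsApproxEV (symGrad F (iterate v₀ v k)) (stepSize k * C) (v k)

end General

/-! ### The nuclear norm solver: Hazan's algorithm on the transformed problem -/

section Transform

variable {m n : ℕ}

/-- The transformed objective `X = (V Z; Zᵀ W) ↦ f(t Z)` on `(m+n) × (m+n)` matrices. -/
def lifted (f : Matrix (Fin m) (Fin n) ℝ → ℝ) (t : ℝ)
    (X : Matrix (Fin m ⊕ Fin n) (Fin m ⊕ Fin n) ℝ) : ℝ :=
  f (t • X.toBlocks₁₂)

/-- The solution of the nuclear norm problem after `k` iterations: the rescaled upper right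
block of the iterate `X⁽ᵏ⁾`. -/
def solution (t : ℝ) (v₀ : Fin m ⊕ Fin n → ℝ) (v : ℕ → Fin m ⊕ Fin n → ℝ) (k : ℕ) :
    Matrix (Fin m) (Fin n) ℝ :=
  t • (iterate v₀ v k).toBlocks₁₂

open Classical in
/-- The positions at which the gradient of `f` is not identically zero, i.e. the matrix entries
on which `f` depends. Its cardinality is `N_f`. -/
def support (f : Matrix (Fin m) (Fin n) ℝ → ℝ) : Finset (Fin m × Fin n) :=
  Finset.univ.filter fun p => ∃ Z, matGrad f Z p.1 p.2 ≠ 0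

end Transform

/-! ### Counting arithmetic operations

A computation returns its value together with the number of real arithmetic operations it has
used. An addition, subtraction, multiplication, division, square root or comparison of two real
numbers, and the reading of one real input (an entry delivered by the gradient oracle, or one
random number) each cost one. Loop control and memory moves are not arithmetic operations. -/

/-- A value with the number of operations spent on it. -/
structure Counted (α : Type) where
  val : α
  ops : ℕ

namespace Counted

instance : Monad Counted where
  pure a := ⟨a, 0⟩
  bind x g := ⟨(g x.val).val, x.ops + (g x.val).ops⟩

def rAdd (x y : ℝ) : Counted ℝ := ⟨x + y, 1⟩
def rSub (x y : ℝ) : Counted ℝ := ⟨x - y, 1⟩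
def rMul (x y : ℝ) : Counted ℝ := ⟨x * y, 1⟩
def rDiv (x y : ℝ) : Counted ℝ := ⟨x / y, 1⟩
def rSqrt (x : ℝ) : Counted ℝ := ⟨Real.sqrt x, 1⟩
def rRead (x : ℝ) : Counted ℝ := ⟨x, 1⟩

open Classical in
def rPos (x : ℝ) : Counted Bool := ⟨decide (0 < x), 1⟩

/-- Fill the cells with index in `s`; all other cells hold `0` and are not touched. -/
def forEach {κ : Type} [DecidableEq κ] (s : Finset κ) (g : κ → Counted ℝ) : Counted (κ → ℝ) :=
  ⟨fun i => if i ∈ s then (g i).val else 0, ∑ i ∈ s, (g i).ops⟩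

/-- Sum of computed terms, with one addition per term. -/
def sumOver {κ : Type} (s : Finset κ) (g : κ → Counted ℝ) : Counted ℝ :=
  ⟨∑ i ∈ s, (g i).val, ∑ i ∈ s, ((g i).ops + 1)⟩

end Counted

open Counted

section Vectors

variable {ι : Type} [DecidableEq ι]

def dot (S : Finset ι) (u v : ι → ℝ) : Counted ℝ :=
  sumOver S fun i => rMul (u i) (v i)

/-- `u + c v` on the coordinates in `S`. -/
def axpy (S : Finset ι) (u : ι → ℝ) (c : ℝ) (v : ι → ℝ) : Counted (ι → ℝ) :=
  forEach S fun i => do rAdd (u i) (← rMul c (v i))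

/-- `u - c v` on the coordinates in `S`. -/
def axmy (S : Finset ι) (u : ι → ℝ) (c : ℝ) (v : ι → ℝ) : Counted (ι → ℝ) :=
  forEach S fun i => do rSub (u i) (← rMul c (v i))

def divBy (S : Finset ι) (u : ι → ℝ) (c : ℝ) : Counted (ι → ℝ) :=
  forEach S fun i => rDiv (u i) c

/-- Scale to unit length (the zero vector is left unchanged). -/
def normalize (S : Finset ι) (u : ι → ℝ) : Counted (ι → ℝ) := do
  let s ← dot S u u
  let r ← rSqrt s
  divBy S u r

/-! ### Lanczos' method for the smallest eigenvector -/

/-- One Lanczos step: the Lanczos vector `v_j`, the diagonal entry `a_j` and the next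
off-diagonal entry `b_j` of the tridiagonal matrix. -/
structure LanczosRow (ι : Type) where
  vec : ι → ℝ
  diag : ℝ
  off : ℝ

/-- The three-term recurrence `b_j v_{j+1} = A v_j - a_j v_j - b_{j-1} v_{j-1}`, for at most
`q` steps, ended early if `b_j = 0`. `mv` is the multiplication by `A`. -/
def lanczosRows (S : Finset ι) (mv : (ι → ℝ) → Counted (ι → ℝ)) :
    ℕ → (ι → ℝ) → ℝ → (ι → ℝ) → Counted (List (LanczosRow ι))
  | 0, _, _, _ => pure []
  | q + 1, vPrev, bPrev, v => do
    let w₀ ← mv v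
    let w₁ ← axmy S w₀ bPrev vPrev
    let a ← dot S w₁ v
    let w₂ ← axmy S w₁ a v
    let s ← dot S w₂ w₂
    let b ← rSqrt s
    let go ← rPos b
    if go then
      let vNext ← divBy S w₂ b
      let rest ← lanczosRows S mv q v b vNext
      pure (⟨v, a, b⟩ :: rest)
    else
      pure [⟨v, a, 0⟩]

/-- Whether `T - μ I` is positive definite for the tridiagonal matrix `T` of the rows: all pivots
of the symmetric elimination are positive. `c` is the correction from the rows above. -/
def pivotsPos (μ : ℝ) : List (LanczosRow ι) → ℝ → Counted Bool
  | [], _ => pure true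
  | r :: rs, c => do
    let d₀ ← rSub r.diag μ
    let d ← rSub d₀ c
    let ok ← rPos d
    if ok then
      let e ← rDiv r.off d
      let c' ← rMul e r.off
      pivotsPos μ rs c'
    else
      pure false

/-- Bisection for the smallest eigenvalue of `T` in `[lo, hi]`; returns the lower end. -/
def bisect (rows : List (LanczosRow ι)) : ℕ → ℝ → ℝ → Counted ℝ
  | 0, lo, _ => pure lo
  | B + 1, lo, hi => do
    let s ← rAdd lo hi
    let mid ← rDiv s 2
    let pd ← pivotsPos mid rows 0
    if pd then bisect rows B mid hi else bisect rows B lo mid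

/-- Solves `(T - μ I) y = (1, -1, 1, -1, …)` by elimination and back substitution. `c` and `s`
are the corrections from the rows above to the pivot and to the right-hand side, `g` is the
current entry of the right-hand side. -/
def solveAlt (μ : ℝ) : List (LanczosRow ι) → ℝ → ℝ → ℝ → Counted (List ℝ)
  | [], _, _, _ => pure []
  | r :: rs, c, s, g => do
    let d₀ ← rSub r.diag μ
    let d ← rSub d₀ c
    let h ← rSub g s
    let e ← rDiv r.off d
    let c' ← rMul e r.off
    let s' ← rMul e h
    let g' ← rSub 0 g
    let ys ← solveAlt μ rs c' s' g'
    let p ← rMul r.off (ys.headD 0)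
    let z ← rSub h p
    let y ← rDiv z d
    pure (y :: ys)

/-- The linear combination `∑ y_j v_j` of the Lanczos vectors. -/
def combine (S : Finset ι) : List (LanczosRow ι) → List ℝ → Counted (ι → ℝ)
  | r :: rs, y :: ys => do
    let acc ← combine S rs ys
    axpy S acc y r.vec
  | _, _ => pure 0

/-- Lanczos' method with `q` steps and start vector `g`, for the smallest eigenvector of a symmetric
matrix whose nonzero entries lie in `S × S` and whose spectral norm is at most `L`.
The smallest Ritz pair is obtained from the tridiagonal matrix by `q` bisection steps,
followed by one inverse iteration. In exact arithmetic more than `|S|` Lanczos steps are useless. -/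
def lanczosEV (S : Finset ι) (mv : (ι → ℝ) → Counted (ι → ℝ)) (L : ℝ) (q : ℕ)
    (g : ι → ℝ) : Counted (ι → ℝ) := do
  let b ← forEach S fun i => rRead (g i)
  let v ← normalize S b
  let rows ← lanczosRows S mv (min q S.card) 0 0 v
  let lo ← rMul (-2) L
  let μ ← bisect rows q lo L
  let y ← solveAlt μ rows 0 0 1
  let x ← combine S rows y
  normalize S x

end Vectors

/-! ### The nuclear norm solver as a randomized program -/

section Solver

variable {m n : ℕ}

/-- The rows and columns that meet `Ω`. -/
def active (Ω : Finset (Fin m × Fin n)) : Finset (Fin m ⊕ Fin n) :=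
  (Ω.image fun p => Sum.inl p.1) ∪ (Ω.image fun p => Sum.inr p.2)

/-- Multiplication by the sparse symmetric matrix `(0 G; Gᵀ 0)`, with `G` equal to `w` on `Ω` and
to zero elsewhere. -/
def bipMulVec (Ω : Finset (Fin m × Fin n)) (w : Fin m × Fin n → ℝ)
    (v : Fin m ⊕ Fin n → ℝ) : Counted (Fin m ⊕ Fin n → ℝ) :=
  forEach (active Ω) fun s =>
    match s with
    | Sum.inl i => sumOver (Ω.filter fun p => p.1 = i) fun p => rMul (w p) (v (Sum.inr p.2))
    | Sum.inr j => sumOver (Ω.filter fun p => p.2 = j) fun p => rMul (w p) (v (Sum.inl p.1))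

/-- Memory of the solver: the entries of the upper right block of `X⁽ᵏ⁾` at the positions on which
`f` depends, and the vectors `v⁽⁰⁾, …, v⁽ᵏ⁻¹⁾` found so far. -/
structure SolverState (m n : ℕ) where
  entries : Fin m × Fin n → ℝ
  factors : ℕ → Fin m ⊕ Fin n → ℝ

/-- Iteration `k`: one gradient oracle call, one approximate eigenvector computation by
Lanczos' method with `q` steps and start vector `g`, one rank-one update.
The gradient of the transformed objective is `(t/2) (0 G; Gᵀ 0)` with `G = ∇f(Z)`. -/
def solverStep (f : Matrix (Fin m) (Fin n) ℝ → ℝ) (t L : ℝ) (k q : ℕ) (g : Fin m ⊕ Fin n → ℝ)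
    (σ : SolverState m n) : Counted (SolverState m n) := do
  let Ω := support f
  let Z ← forEach Ω fun p => rMul t (σ.entries p)
  let G ← forEach Ω fun p => rRead (matGrad f (Matrix.of fun i j => Z (i, j)) p.1 p.2)
  let t' ← rDiv t 2
  let w ← forEach Ω fun p => rMul t' (G p)
  let v ← lanczosEV (active Ω) (bipMulVec Ω w) L q g
  let d ← rAdd k 2
  let α ← rDiv 2 d
  let entries ← forEach Ω fun p => do
    let x ← rMul (v (Sum.inl p.1)) (v (Sum.inr p.2))
    let y ← rSub x (σ.entries p)
    let z ← rMul α y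
    rAdd (σ.entries p) z
  pure ⟨entries, Function.update σ.factors k v⟩

/-- The solver after `k` iterations, started at `v₀ v₀ᵀ`, with `q j` Lanczos steps in iteration `j`
and the random numbers `ω`. -/
def solver (f : Matrix (Fin m) (Fin n) ℝ → ℝ) (t L : ℝ) (v₀ : Fin m ⊕ Fin n → ℝ) (q : ℕ → ℕ)
    (ω : ℕ × (Fin m ⊕ Fin n) → ℝ) : ℕ → Counted (SolverState m n)
  | 0 => do
    let entries ← forEach (support f) fun p => rMul (v₀ (Sum.inl p.1)) (v₀ (Sum.inr p.2))
    pure ⟨entries, fun _ _ => 0⟩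
  | k + 1 => do
    let σ ← solver f t L v₀ q ω k
    solverStep f t L k (q k) (fun i => ω (k, i)) σ

/-- The law of independent standard normal random numbers; a vector of them, scaled to
unit length, is uniformly distributed on the sphere. -/
def randomNumbers (m n : ℕ) : Measure (ℕ × (Fin m ⊕ Fin n) → ℝ) :=
  Measure.infinitePi fun _ => gaussianReal 0 1

end Solver

end NucFW

end

/-!
The problem is lifted to the spectahedron: the upper right blocks, scaled by `t`, of the positive
semidefinite matrices of trace one form the nuclear norm ball of radius `t / 2`
(`nucNorm_toBlocks_le`, `exists_spectahedron_of_nucNorm_le`). On the spectahedron the solver is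
the conditional gradient method, since the linear subproblem is solved by a bottom eigenvector of
the gradient. If the eigenvector of step `k` is found up to the error `αₖ C ηₖ`, then
`K (K + 1) (f(X_K) - f(Y)) ≤ 4 C ∑ (1 + ηₖ)` (`lifted_iterate_le`). With `ηₖ = 1` this is the
statement on iterations. For the randomized solver it is enough that the *average* of the `ηₖ` is
at most `1`; a union bound over the iterations, which would cost a factor `log K`, is not needed.

Lanczos' method: the recurrence yields an orthonormal basis of the Krylov space in which the matrix
is tridiagonal (`lanczosRows_orthonormal`, `lanczosRows_krylov`). The pivot test decides positive
definiteness (`pivotsPos_iff`), and one inverse iteration from `(1, -1, 1, …)` reaches the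
smallest Ritz value, because the off-diagonal entries are nonnegative (`solveAlt_rayleigh`). The
Rayleigh quotient returned is therefore, up to an exponentially small term, at most that of any
polynomial in the matrix applied to the start vector `g` (`lanczosEV_spec`). A suitable polynomial
is a power, with exponent `d = 8 p` and `p = ⌈ℓ⌉`, of a Chebyshev-type polynomial of degree about
`q / d`. It gives `ηₖ ≤ θ (|g|² / (z ⬝ g)²)^{1/d}`, where `z` is a bottom eigenvector and
`θ = 1036 / a²` (`lanczosEV_error`, `stepVec_error`). This bound involves no spectral gap.

The start vector of iteration `k` is independent of the iterate, which depends measurably on the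
earlier random numbers (`measurable_entriesAt`, `indepFun_entriesAt`). As `z ⬝ g` is standard
normal, the expectation of `ηₖ^p` is at most `θ^p (1 + N + c)` with the constant `c = E |x|^{-1/2}`
(`lintegral_ratio_le`, `lintegral_errPow_le`), and this is at most `δ` for a large constant `a`,
because `p ≥ 1 + log (N / δ)`. Markov's inequality for `∑ ηₖ^p` and Bernoulli's inequality bound the
average of the `ηₖ` by `1` with probability at least `1 - δ` (`measure_not_isEpsSolution_le`).

An iteration costs `O(max 1 N_f · q_k)` operations (`solverStep_ops_le`), and `q_k` grows like
`√k`, so that `K = O(1 + C / ε)` iterations cost a multiple of `K^{3/2}` (`solver_ops_le_rpow`).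
-/

noncomputable section
set_option linter.unusedSectionVars false
namespace NucFW
open Counted

/-! ### Gradients of the objective and of the lifted objective -/

section Gradient

variable {ι κ : Type} [Fintype ι] [DecidableEq ι] [Fintype κ] [DecidableEq κ]

theorem frob_comm (X Y : Matrix ι κ ℝ) : frob X Y = frob Y X := by
  simp [frob, mul_comm]

theorem frob_sub_left (X Y Z : Matrix ι κ ℝ) : frob (X - Y) Z = frob X Z - frob Y Z := by
  simp [frob, sub_mul, Finset.sum_sub_distrib]

theorem frob_smul_left (c : ℝ) (X Y : Matrix ι κ ℝ) : frob (c • X) Y = c * frob X Y := by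
  simp [frob, Finset.mul_sum, mul_assoc]

theorem frob_smul_right (c : ℝ) (X Y : Matrix ι κ ℝ) : frob X (c • Y) = c * frob X Y := by
  rw [frob_comm, frob_smul_left, frob_comm]

theorem frob_vecMulVec (u w : ι → ℝ) (A : Matrix ι ι ℝ) :
    frob (Matrix.vecMulVec u w) A = u ⬝ᵥ (A *ᵥ w) := by
  simp only [frob, Matrix.vecMulVec_apply, dotProduct, Matrix.mulVec, Finset.mul_sum]
  exact Finset.sum_congr rfl fun i _ => Finset.sum_congr rfl fun j _ => by ring

theorem fderiv_eq_frob (F : Matrix ι κ ℝ → ℝ) (X H : Matrix ι κ ℝ) :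
    fderiv ℝ F X H = frob H (matGrad F X) := by
  conv_lhs => rw [Matrix.matrix_eq_sum_single H]
  simp only [map_sum, frob]
  refine Finset.sum_congr rfl fun i _ => Finset.sum_congr rfl fun j _ => ?_
  have : Matrix.single i j (H i j) = H i j • Matrix.single i j (1 : ℝ) := by
    simp
  rw [this, map_smul, smul_eq_mul]
  rfl

theorem convexOn_line {F : Matrix ι κ ℝ → ℝ} (hc : ConvexOn ℝ Set.univ F) (X H : Matrix ι κ ℝ) :
    ConvexOn ℝ Set.univ (fun s : ℝ => F (X + s • H)) := by
  refine ⟨convex_univ, fun a _ b _ p q hp hq hpq => ?_⟩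
  have := hc.2 (Set.mem_univ (X + a • H)) (Set.mem_univ (X + b • H)) hp hq hpq
  refine le_trans (le_of_eq ?_) this
  obtain rfl : q = 1 - p := by linarith
  simp only [smul_eq_mul]
  congr 1
  module

attribute [local instance] Matrix.normedAddCommGroup Matrix.normedSpace

theorem hasDerivAt_line {F : Matrix ι κ ℝ → ℝ} (hF : Differentiable ℝ F) (X H : Matrix ι κ ℝ)
    (s : ℝ) : HasDerivAt (fun s : ℝ => F (X + s • H)) (frob H (matGrad F (X + s • H))) s := by
  have h1 : HasFDerivAt F (fderiv ℝ F (X + s • H)) (X + s • H) := (hF _).hasFDerivAt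
  have h2 : HasDerivAt (fun s : ℝ => X + s • H) H s := by
    have h3 : HasDerivAt (fun s : ℝ => s • H) ((1 : ℝ) • H) s := (hasDerivAt_id s).smul_const H
    rw [one_smul] at h3
    exact h3.const_add X
  exact (h1.comp_hasDerivAt s h2).congr_deriv (fderiv_eq_frob _ _ _)

theorem convex_gradient_ineq {F : Matrix ι κ ℝ → ℝ} (hF : Differentiable ℝ F)
    (hc : ConvexOn ℝ Set.univ F) (X Y : Matrix ι κ ℝ) :
    F X + frob (Y - X) (matGrad F X) ≤ F Y := by
  have hd := hasDerivAt_line hF X (Y - X) 0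
  have hconv := convexOn_line hc X (Y - X)
  have := hconv.le_slope_of_hasDerivAt (Set.mem_univ 0) (Set.mem_univ 1) one_pos hd
  simp [slope_def_field] at this
  linarith

theorem differentiable_continuous {F : Matrix ι κ ℝ → ℝ} (hF : Differentiable ℝ F) :
    Continuous F := hF.continuous

end Gradient

section Lift

variable {m n : ℕ}

/-- The symmetric block matrix `(0 G; Gᵀ 0)`. -/
def bip (G : Matrix (Fin m) (Fin n) ℝ) : Matrix (Fin m ⊕ Fin n) (Fin m ⊕ Fin n) ℝ :=
  Matrix.fromBlocks 0 G Gᵀ 0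

theorem bip_transpose (G : Matrix (Fin m) (Fin n) ℝ) : (bip G)ᵀ = bip G := by
  simp [bip, Matrix.fromBlocks_transpose]

theorem dotProduct_bip (G : Matrix (Fin m) (Fin n) ℝ) (x : Fin m ⊕ Fin n → ℝ) :
    x ⬝ᵥ (bip G *ᵥ x) = 2 * ((x ∘ Sum.inl) ⬝ᵥ (G *ᵥ (x ∘ Sum.inr))) := by
  rw [bip, Matrix.fromBlocks_mulVec]
  simp only [Matrix.zero_mulVec, zero_add, add_zero, dotProduct, Fintype.sum_sum_type,
    Sum.elim_inl, Sum.elim_inr, Function.comp]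
  have : ∑ j, x (Sum.inr j) * (Gᵀ *ᵥ fun i => x (Sum.inl i)) j =
      ∑ i, x (Sum.inl i) * (G *ᵥ fun j => x (Sum.inr j)) i := by
    simp only [Matrix.mulVec, dotProduct, Finset.mul_sum, Matrix.transpose_apply]
    rw [Finset.sum_comm]
    exact Finset.sum_congr rfl fun i _ => Finset.sum_congr rfl fun j _ => by ring
  simp only [Function.comp_def] at *
  rw [this]; ring

attribute [local instance] Matrix.normedAddCommGroup Matrix.normedSpace

theorem fderiv_lifted {f : Matrix (Fin m) (Fin n) ℝ → ℝ} (hf : Differentiable ℝ f) (t : ℝ)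
    (X H : Matrix (Fin m ⊕ Fin n) (Fin m ⊕ Fin n) ℝ) :
    fderiv ℝ (lifted f t) X H = t * frob H.toBlocks₁₂ (matGrad f (t • X.toBlocks₁₂)) := by
  let T : Matrix (Fin m ⊕ Fin n) (Fin m ⊕ Fin n) ℝ →ₗ[ℝ] Matrix (Fin m) (Fin n) ℝ :=
    { toFun := fun X => t • X.toBlocks₁₂
      map_add' := fun X Y => by ext; simp [Matrix.toBlocks₁₂]; ring
      map_smul' := fun c X => by ext; simp [Matrix.toBlocks₁₂]; ring }
  have h1 : HasFDerivAt (lifted f t) ((fderiv ℝ f (t • X.toBlocks₁₂)).comp T.toContinuousLinearMap)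
      X := by
    have h2 : HasFDerivAt (T.toContinuousLinearMap) T.toContinuousLinearMap X :=
      T.toContinuousLinearMap.hasFDerivAt
    exact HasFDerivAt.comp (g := f) X (hf (t • X.toBlocks₁₂)).hasFDerivAt h2
  rw [h1.fderiv]
  change fderiv ℝ f (t • X.toBlocks₁₂) (t • H.toBlocks₁₂) = _
  rw [map_smul, fderiv_eq_frob, smul_eq_mul]

/-- The gradient of the lifted objective: each of the two off-diagonal blocks carries half of the
gradient of `f`. -/
theorem symGrad_lifted {f : Matrix (Fin m) (Fin n) ℝ → ℝ} (hf : Differentiable ℝ f) (t : ℝ)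
    (X : Matrix (Fin m ⊕ Fin n) (Fin m ⊕ Fin n) ℝ) :
    symGrad (lifted f t) X = bip ((t / 2) • matGrad f (t • X.toBlocks₁₂)) := by
  have key : ∀ i j, matGrad (lifted f t) X i j =
      t * frob (Matrix.single i j (1:ℝ)).toBlocks₁₂ (matGrad f (t • X.toBlocks₁₂)) := fun i j => by
    rw [matGrad, Matrix.of_apply, fderiv_lifted hf]
  ext i j
  simp only [symGrad, Matrix.smul_apply, Matrix.add_apply, Matrix.transpose_apply, key, smul_eq_mul]
  rcases i with i | i <;> rcases j with j | j <;>
    simp [bip, frob, Matrix.toBlocks₁₂, Matrix.single_apply, ite_and] <;> ring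

theorem toBlocks₁₂_sub (X Y : Matrix (Fin m ⊕ Fin n) (Fin m ⊕ Fin n) ℝ) :
    (X - Y).toBlocks₁₂ = X.toBlocks₁₂ - Y.toBlocks₁₂ := rfl

theorem frob_bip {H : Matrix (Fin m ⊕ Fin n) (Fin m ⊕ Fin n) ℝ} (hH : Hᵀ = H)
    (G : Matrix (Fin m) (Fin n) ℝ) : frob H (bip G) = 2 * frob H.toBlocks₁₂ G := by
  have h : ∀ i j, H (Sum.inr j) (Sum.inl i) = H (Sum.inl i) (Sum.inr j) := fun i j => by
    conv_lhs => rw [← hH, Matrix.transpose_apply]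
  simp only [frob, bip, Fintype.sum_sum_type, Matrix.toBlocks₁₂, Matrix.fromBlocks_apply₁₁,
    Matrix.fromBlocks_apply₁₂, Matrix.fromBlocks_apply₂₁, Matrix.fromBlocks_apply₂₂, h,
    Matrix.zero_apply, mul_zero, Finset.sum_const_zero, zero_add, add_zero, Matrix.transpose_apply,
    Matrix.of_apply]
  rw [Finset.sum_comm (s := (Finset.univ : Finset (Fin n)))]
  ring

/-- Convexity of the lifted objective, in terms of its gradient in the space of symmetric
matrices. -/
theorem lifted_gradient_ineq {f : Matrix (Fin m) (Fin n) ℝ → ℝ} (hf : Differentiable ℝ f)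
    (hc : ConvexOn ℝ Set.univ f) (t : ℝ) {X Y : Matrix (Fin m ⊕ Fin n) (Fin m ⊕ Fin n) ℝ}
    (hX : Xᵀ = X) (hY : Yᵀ = Y) :
    lifted f t X + frob (Y - X) (symGrad (lifted f t) X) ≤ lifted f t Y := by
  have := convex_gradient_ineq hf hc (t • X.toBlocks₁₂) (t • Y.toBlocks₁₂)
  rw [symGrad_lifted hf, frob_bip (by rw [Matrix.transpose_sub, hX, hY]), frob_smul_right,
    toBlocks₁₂_sub]
  rw [← smul_sub, frob_smul_left] at this
  simp only [lifted]
  linarith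

end Lift

/-! ### The nuclear norm ball as a projection of the spectahedron -/

section Nuclear

variable {m n : ℕ}

open scoped MatrixOrder Matrix.Norms.L2Operator in
theorem exists_gram {ι : Type} [Fintype ι] [DecidableEq ι] {X : Matrix ι ι ℝ}
    (hX : X.PosSemidef) : ∃ B : Matrix ι ι ℝ, X = Bᴴ * B := by
  obtain ⟨B, hB⟩ := CStarAlgebra.nonneg_iff_eq_star_mul_self.mp hX.nonneg
  exact ⟨B, hB⟩

/-- Bessel's inequality for an orthogonal family of vectors of length at most `1`. -/
theorem sum_sq_dotProduct_le {κ ι : Type} [Fintype κ] [DecidableEq κ] [Fintype ι]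
    (u : κ → ι → ℝ) (c : κ → ℝ) (hc : ∀ k, c k ≤ 1)
    (hu : ∀ i j, u i ⬝ᵥ u j = if i = j then c i else 0) (x : ι → ℝ) :
    ∑ k, (x ⬝ᵥ u k) ^ 2 ≤ x ⬝ᵥ x := by
  have h0 : 0 ≤ (x - ∑ k, (x ⬝ᵥ u k) • u k) ⬝ᵥ (x - ∑ k, (x ⬝ᵥ u k) • u k) := by
    simpa using dotProduct_star_self_nonneg (x - ∑ k, (x ⬝ᵥ u k) • u k)
  have h1 : (∑ k, (x ⬝ᵥ u k) • u k) ⬝ᵥ (∑ k, (x ⬝ᵥ u k) • u k) = ∑ k, c k * (x ⬝ᵥ u k) ^ 2 := by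
    simp only [sum_dotProduct, dotProduct_sum, smul_dotProduct, dotProduct_smul, hu, smul_eq_mul,
      mul_ite, mul_zero, Finset.sum_ite_eq', Finset.mem_univ, if_true]
    exact Finset.sum_congr rfl fun k _ => by ring
  have h2 : x ⬝ᵥ (∑ k, (x ⬝ᵥ u k) • u k) = ∑ k, (x ⬝ᵥ u k) ^ 2 := by
    simp only [dotProduct_sum, dotProduct_smul, smul_eq_mul]
    exact Finset.sum_congr rfl fun k _ => by ring
  rw [sub_dotProduct, dotProduct_sub, dotProduct_sub, h1, dotProduct_comm (∑ k, _) x, h2] at h0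
  have h3 : ∑ k, c k * (x ⬝ᵥ u k) ^ 2 ≤ ∑ k, (x ⬝ᵥ u k) ^ 2 :=
    Finset.sum_le_sum fun k _ => by nlinarith [hc k, sq_nonneg (x ⬝ᵥ u k)]
  linarith

/-- Singular value decomposition. Left singular vectors for the singular value `0` are `0`. -/
theorem exists_svd (Z : Matrix (Fin m) (Fin n) ℝ) :
    ∃ (σ : Fin n → ℝ) (u : Fin n → Fin m → ℝ) (v : Fin n → Fin n → ℝ),
      (∀ k, 0 ≤ σ k) ∧ nucNorm Z = ∑ k, σ k ∧
      (∀ i j, v i ⬝ᵥ v j = if i = j then 1 else 0) ∧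
      (∀ i j, u i ⬝ᵥ u j = if i = j then (if σ i = 0 then 0 else 1) else 0) ∧
      (∀ k, Z *ᵥ v k = σ k • u k) ∧
      Z = ∑ k, σ k • Matrix.vecMulVec (u k) (v k) := by
  set T := Matrix.toEuclideanLin Z with hT
  have hn : Module.finrank ℝ (EuclideanSpace ℝ (Fin n)) = n := by simp
  set w := T.isSymmetric_adjoint_comp_self.eigenvectorBasis hn with hw
  set σ : Fin n → ℝ := fun k => T.singularValues k with hσ
  have hTv : ∀ k, Z *ᵥ (w k).ofLp = (T (w k)).ofLp := fun k => by
    rw [hT, Matrix.toLpLin_apply]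
  have hinn : ∀ i j, inner ℝ (T (w i)) (T (w j)) = if i = j then σ i ^ 2 else 0 := by
    intro i j
    have h1 : inner ℝ (T (w i)) (T (w j)) =
        inner ℝ ((LinearMap.adjoint T ∘ₗ T) (w i)) (w j) := by
      rw [LinearMap.comp_apply, LinearMap.adjoint_inner_left]
    rw [h1, LinearMap.IsSymmetric.apply_eigenvectorBasis, inner_smul_left,
      orthonormal_iff_ite.mp w.orthonormal i j, hσ]
    simp only [T.sq_singularValues_fin hn]
    simp
  have hdot : ∀ {k : ℕ} (x y : EuclideanSpace ℝ (Fin k)), x.ofLp ⬝ᵥ y.ofLp = inner ℝ x y := by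
    intro k x y
    rw [EuclideanSpace.inner_eq_star_dotProduct, dotProduct_comm]
    simp
  have hzero : ∀ k, σ k = 0 → T (w k) = 0 := fun k hk => by
    have := hinn k k
    rw [if_pos rfl, hk] at this
    simpa using this
  have hZv : ∀ k, Z *ᵥ (w k).ofLp = σ k • ((σ k)⁻¹ • T (w k)).ofLp := fun k => by
    rw [hTv]
    by_cases hk : σ k = 0
    · simp [hzero k hk]
    · simp [smul_smul, hk]
  refine ⟨σ, fun k => ((σ k)⁻¹ • T (w k)).ofLp, fun k => (w k).ofLp,
    fun k => T.singularValues_nonneg k, ?_, ?_, ?_, hZv, ?_⟩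
  · rw [nucNorm, Finset.sum_range]
  · intro i j
    rw [hdot, orthonormal_iff_ite.mp w.orthonormal i j]
  · intro i j
    rw [hdot, inner_smul_left, inner_smul_right, hinn]
    by_cases hij : i = j
    · subst hij
      by_cases hi : σ i = 0
      · simp [hi]
      · simp only [if_true, hi, if_false]
        simp
        field_simp
    · simp [hij]
  · have hx : ∀ x : EuclideanSpace ℝ (Fin n), Z *ᵥ x.ofLp =
        (∑ k, σ k • Matrix.vecMulVec ((σ k)⁻¹ • T (w k)).ofLp (w k).ofLp) *ᵥ x.ofLp := by
      intro x
      have h1 : x.ofLp = ∑ k, inner ℝ (w k) x • (w k).ofLp := by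
        conv_lhs => rw [← w.sum_repr' x]
        simp
      rw [Matrix.sum_mulVec]
      conv_lhs => rw [h1, Matrix.mulVec_sum]
      refine Finset.sum_congr rfl fun k _ => ?_
      rw [Matrix.mulVec_smul, hZv, Matrix.smul_mulVec, Matrix.vecMulVec_mulVec, hdot]
      ext i
      simp
      ring
    apply Matrix.toLin'.injective
    ext1 j
    ext1
    have := hx (WithLp.toLp 2 (Pi.single j 1))
    simpa only [Matrix.toLin'_apply, LinearMap.comp_apply, LinearMap.single_apply] using this

/-- The upper right block of a positive semidefinite matrix `X = BᵀB` is a Gram matrix between two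
families of vectors, and its singular values are bounded by the inequality `2 x y ≤ x² + y²`. -/
theorem nucNorm_toBlocks_le {X : Matrix (Fin m ⊕ Fin n) (Fin m ⊕ Fin n) ℝ} (hX : X.PosSemidef)
    (htr : X.trace ≤ 1) {t : ℝ} (ht : 0 < t) : nucNorm (t • X.toBlocks₁₂) ≤ t / 2 := by
  obtain ⟨σ, u, v, hσ, hnuc, hv, hu, hZ, -⟩ := exists_svd (t • X.toBlocks₁₂)
  obtain ⟨B, hB⟩ := exists_gram hX
  rw [hnuc]
  have key : ∀ k, σ k ≤ t / 2 * (∑ r, ((fun i => B r (Sum.inl i)) ⬝ᵥ u k) ^ 2 +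
      ∑ r, ((fun j => B r (Sum.inr j)) ⬝ᵥ v k) ^ 2) := by
    intro k
    by_cases hk : σ k = 0
    · rw [hk]; positivity
    have h1 : σ k = u k ⬝ᵥ ((t • X.toBlocks₁₂) *ᵥ v k) := by
      rw [hZ, dotProduct_smul, hu]; simp [hk]
    have h2 : u k ⬝ᵥ ((t • X.toBlocks₁₂) *ᵥ v k) =
        t * ∑ r, ((fun i => B r (Sum.inl i)) ⬝ᵥ u k) * ((fun j => B r (Sum.inr j)) ⬝ᵥ v k) := by
      rw [Matrix.smul_mulVec, dotProduct_smul, smul_eq_mul]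
      congr 1
      simp only [hB, dotProduct, Matrix.mulVec, Matrix.toBlocks₁₂, Matrix.of_apply,
        Matrix.mul_apply, Matrix.conjTranspose_apply, star_trivial, Finset.sum_mul, Finset.mul_sum]
      rw [Finset.sum_congr rfl fun i _ => Finset.sum_comm, Finset.sum_comm]
      refine Finset.sum_congr rfl fun r _ => ?_
      rw [Finset.sum_comm]
      exact Finset.sum_congr rfl fun r _ => Finset.sum_congr rfl fun r _ => by ring
    rw [h1, h2, ← Finset.sum_add_distrib, div_eq_mul_inv, mul_assoc]
    refine mul_le_mul_of_nonneg_left ?_ ht.le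
    rw [Finset.mul_sum]
    refine Finset.sum_le_sum fun r _ => ?_
    nlinarith [sq_nonneg (((fun i => B r (Sum.inl i)) ⬝ᵥ u k) -
      ((fun j => B r (Sum.inr j)) ⬝ᵥ v k))]
  refine (Finset.sum_le_sum fun k _ => key k).trans ?_
  rw [← Finset.mul_sum, Finset.sum_add_distrib, Finset.sum_comm, add_comm, Finset.sum_comm]
  have h1 : ∑ r, ∑ k, ((fun j => B r (Sum.inr j)) ⬝ᵥ v k) ^ 2 ≤
      ∑ r, ∑ j, B r (Sum.inr j) * B r (Sum.inr j) := Finset.sum_le_sum fun r _ =>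
    sum_sq_dotProduct_le v (fun _ => 1) (fun _ => le_rfl) hv _
  have h2 : ∑ r, ∑ k, ((fun i => B r (Sum.inl i)) ⬝ᵥ u k) ^ 2 ≤
      ∑ r, ∑ i, B r (Sum.inl i) * B r (Sum.inl i) := Finset.sum_le_sum fun r _ =>
    sum_sq_dotProduct_le u (fun i => if σ i = 0 then 0 else 1)
      (fun i => by split_ifs <;> norm_num) hu _
  have h3 : X.trace = ∑ r, ∑ i, B r (Sum.inl i) * B r (Sum.inl i) +
      ∑ r, ∑ j, B r (Sum.inr j) * B r (Sum.inr j) := by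
    rw [Matrix.trace, ← Finset.sum_add_distrib, hB]
    simp only [Matrix.diag_apply, Matrix.mul_apply, Matrix.conjTranspose_apply, star_trivial]
    rw [Finset.sum_comm]
    simp only [Fintype.sum_sum_type]
  nlinarith

theorem posSemidef_vecMulVec {ι : Type} [Fintype ι] (v : ι → ℝ) :
    (Matrix.vecMulVec v v).PosSemidef := by
  simpa using Matrix.posSemidef_vecMulVec_self_star v

theorem trace_vecMulVec_self {ι : Type} [Fintype ι] (v : ι → ℝ) :
    (Matrix.vecMulVec v v).trace = v ⬝ᵥ v := by
  simp [Matrix.trace, Matrix.vecMulVec_apply, dotProduct]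

theorem vecMulVec_mem_spectahedron {ι : Type} [Fintype ι] {v : ι → ℝ} (hv : v ⬝ᵥ v = 1) :
    Matrix.vecMulVec v v ∈ spectahedron ι :=
  ⟨posSemidef_vecMulVec v, by rw [trace_vecMulVec_self, hv]⟩

/-- Every point of the nuclear norm ball lifts to the spectahedron: the singular vectors `uₖ`, `vₖ`
combine to the vectors `(uₖ, vₖ)`, and the missing trace is filled up on the diagonal. -/
theorem exists_spectahedron_of_nucNorm_le [Nonempty (Fin m ⊕ Fin n)] {t : ℝ} (ht : 0 < t)
    {Z : Matrix (Fin m) (Fin n) ℝ} (hZ : nucNorm Z ≤ t / 2) :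
    ∃ X ∈ spectahedron (Fin m ⊕ Fin n), t • X.toBlocks₁₂ = Z := by
  obtain ⟨σ, u, v, hσ, hnuc, hv, hu, -, hsum⟩ := exists_svd Z
  obtain ⟨s⟩ := ‹Nonempty (Fin m ⊕ Fin n)›
  set w : Fin n → Fin m ⊕ Fin n → ℝ := fun k => Sum.elim (u k) (v k) with hw
  set X₀ : Matrix (Fin m ⊕ Fin n) (Fin m ⊕ Fin n) ℝ :=
    ∑ k, (σ k / t) • Matrix.vecMulVec (w k) (w k) with hX₀
  have hpsd : X₀.PosSemidef := Matrix.posSemidef_sum _ fun k _ =>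
    (posSemidef_vecMulVec _).smul (div_nonneg (hσ k) ht.le)
  have htr : X₀.trace ≤ 1 := by
    rw [hX₀, Matrix.trace_sum]
    have : ∀ k, ((σ k / t) • Matrix.vecMulVec (w k) (w k)).trace = 2 / t * σ k := fun k => by
      rw [Matrix.trace_smul, trace_vecMulVec_self, hw]
      have h1 : (Sum.elim (u k) (v k)) ⬝ᵥ (Sum.elim (u k) (v k)) = u k ⬝ᵥ u k + v k ⬝ᵥ v k := by
        simp [dotProduct]
      dsimp only
      rw [h1, hu, hv]
      by_cases hk : σ k = 0
      · simp [hk]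
      · simp [hk]; ring
    rw [Finset.sum_congr rfl fun k _ => this k, ← Finset.mul_sum, ← hnuc]
    calc 2 / t * nucNorm Z ≤ 2 / t * (t / 2) := by gcongr
      _ = 1 := by field_simp
  -- The missing trace is put on one diagonal entry, outside the upper right block.
  refine ⟨X₀ + (1 - X₀.trace) • Matrix.vecMulVec (Pi.single s 1) (Pi.single s 1),
    ⟨hpsd.add ((posSemidef_vecMulVec _).smul (by linarith)), ?_⟩, ?_⟩
  · rw [Matrix.trace_add, Matrix.trace_smul, trace_vecMulVec_self]
    simp
  · have hslack : ∀ i j, (Matrix.vecMulVec (Pi.single s (1:ℝ)) (Pi.single s 1) :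
        Matrix (Fin m ⊕ Fin n) (Fin m ⊕ Fin n) ℝ) (Sum.inl i) (Sum.inr j) = 0 := fun i j => by
      rcases s with s | s <;> simp [Matrix.vecMulVec_apply]
    ext i j
    conv_rhs => rw [hsum]
    simp only [Matrix.smul_apply, Matrix.toBlocks₁₂, Matrix.of_apply, Matrix.add_apply, hslack,
      hX₀, Matrix.sum_apply, Matrix.vecMulVec_apply, hw, Sum.elim_inl, Sum.elim_inr, smul_eq_mul]
    rw [mul_zero, add_zero, Finset.mul_sum]
    refine Finset.sum_congr rfl fun k _ => ?_
    field_simp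

end Nuclear

/-! ### Spectral facts about symmetric matrices -/

section Spectral

variable {ι : Type} [Fintype ι] [DecidableEq ι]

/-- Spectral theorem: an orthonormal eigenbasis `u` with eigenvalues `lam`, and Parseval's
identity for it. -/
theorem exists_eigenbasis {A : Matrix ι ι ℝ} (hA : Aᵀ = A) :
    ∃ (lam : ι → ℝ) (u : ι → ι → ℝ), (∀ i, lam i ∈ spectrum ℝ A) ∧
      (∀ i, A *ᵥ u i = lam i • u i) ∧ (∀ i, u i ⬝ᵥ u i = 1) ∧
      ∀ x y, x ⬝ᵥ y = ∑ i, (u i ⬝ᵥ x) * (u i ⬝ᵥ y) := by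
  have hH : A.IsHermitian := by
    rwa [Matrix.IsHermitian, Matrix.conjTranspose_eq_transpose_of_trivial]
  have hdot : ∀ (x y : EuclideanSpace ℝ ι), x.ofLp ⬝ᵥ y.ofLp = inner ℝ x y := by
    intro x y
    rw [EuclideanSpace.inner_eq_star_dotProduct, dotProduct_comm]
    simp
  refine ⟨hH.eigenvalues, fun i => (hH.eigenvectorBasis i).ofLp,
    fun i => hH.eigenvalues_mem_spectrum_real i, fun i => hH.mulVec_eigenvectorBasis i,
    fun i => ?_, fun x y => ?_⟩
  · rw [hdot, orthonormal_iff_ite.mp hH.eigenvectorBasis.orthonormal i i, if_pos rfl]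
  · have := hH.eigenvectorBasis.sum_inner_mul_inner (WithLp.toLp 2 x) (WithLp.toLp 2 y)
    rw [← hdot] at this
    rw [← this]
    refine Finset.sum_congr rfl fun i _ => ?_
    rw [real_inner_comm, ← hdot, ← hdot]

theorem dotProduct_mulVec_symm {A : Matrix ι ι ℝ} (hA : Aᵀ = A) (x y : ι → ℝ) :
    x ⬝ᵥ (A *ᵥ y) = (A *ᵥ x) ⬝ᵥ y := by
  rw [Matrix.dotProduct_mulVec, ← Matrix.mulVec_transpose, hA]

theorem exists_bottom_eigenvector [Nonempty ι] {A : Matrix ι ι ℝ} (hA : Aᵀ = A) :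
    ∃ μ ∈ spectrum ℝ A, ∃ z : ι → ℝ, z ⬝ᵥ z = 1 ∧ A *ᵥ z = μ • z ∧
      ∀ x, μ * (x ⬝ᵥ x) ≤ x ⬝ᵥ (A *ᵥ x) := by
  obtain ⟨lam, u, hs, hu, h1, hp⟩ := exists_eigenbasis hA
  obtain ⟨i, hi⟩ := Finite.exists_min lam
  refine ⟨lam i, hs i, u i, h1 i, hu i, fun x => ?_⟩
  rw [hp x x, hp x (A *ᵥ x), Finset.mul_sum]
  refine Finset.sum_le_sum fun j _ => ?_
  rw [dotProduct_mulVec_symm hA, hu, smul_dotProduct, smul_eq_mul]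
  nlinarith [mul_le_mul_of_nonneg_right (hi j) (mul_self_nonneg (u j ⬝ᵥ x))]

theorem abs_quadForm_le {A : Matrix ι ι ℝ} (hA : Aᵀ = A) {L : ℝ}
    (hL : ∀ μ ∈ spectrum ℝ A, |μ| ≤ L) (x : ι → ℝ) : |x ⬝ᵥ (A *ᵥ x)| ≤ L * (x ⬝ᵥ x) := by
  obtain ⟨lam, u, hs, hu, h1, hp⟩ := exists_eigenbasis hA
  rw [hp x x, hp x (A *ᵥ x), Finset.mul_sum]
  refine (Finset.abs_sum_le_sum_abs _ _).trans (Finset.sum_le_sum fun j _ => ?_)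
  rw [dotProduct_mulVec_symm hA, hu, smul_dotProduct, smul_eq_mul, mul_left_comm, abs_mul,
    abs_of_nonneg (mul_self_nonneg (u j ⬝ᵥ x))]
  exact mul_le_mul_of_nonneg_right (hL _ (hs j)) (mul_self_nonneg _)

/-- The minimum of a linear functional on the spectahedron is the smallest eigenvalue of its
matrix. -/
theorem le_frob_of_quadForm {A : Matrix ι ι ℝ} {μ : ℝ}
    (h : ∀ x, μ * (x ⬝ᵥ x) ≤ x ⬝ᵥ (A *ᵥ x)) {Y : Matrix ι ι ℝ} (hY : Y ∈ spectahedron ι) :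
    μ ≤ frob Y A := by
  obtain ⟨B, hB⟩ := exists_gram hY.1
  have h1 : frob Y A = ∑ r, (B r) ⬝ᵥ (A *ᵥ (B r)) := by
    rw [hB]
    simp only [frob, dotProduct, Matrix.mulVec, Matrix.mul_apply, Matrix.conjTranspose_apply,
      star_trivial, Finset.sum_mul, Finset.mul_sum]
    rw [Finset.sum_congr rfl fun i _ => Finset.sum_comm, Finset.sum_comm]
    exact Finset.sum_congr rfl fun r _ => Finset.sum_congr rfl fun i _ =>
      Finset.sum_congr rfl fun j _ => by ring
  have h2 : ∑ r, (B r) ⬝ᵥ (B r) = 1 := by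
    rw [← hY.2, hB, Matrix.trace]
    simp only [Matrix.diag_apply, Matrix.mul_apply, Matrix.conjTranspose_apply, star_trivial,
      dotProduct]
    exact Finset.sum_comm
  rw [h1, ← mul_one μ, ← h2, Finset.mul_sum]
  exact Finset.sum_le_sum fun r _ => h _

end Spectral

/-! ### Convergence of the conditional gradient iteration -/

section Recursion

variable {m n : ℕ}

theorem nonempty_of_dotProduct_self_eq_one {ι : Type} [Fintype ι] {v : ι → ℝ} (hv : v ⬝ᵥ v = 1) :
    Nonempty ι := by
  by_contra hne
  rw [not_nonempty_iff] at hne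
  simp [dotProduct] at hv

theorem stepSize_mem (k : ℕ) : stepSize k ∈ Set.Ioc (0 : ℝ) 1 := by
  have : (0 : ℝ) ≤ k := k.cast_nonneg
  refine ⟨by unfold stepSize; positivity, ?_⟩
  rw [stepSize, div_le_one (by positivity)]
  linarith

theorem posSemidef_iterate {ι : Type} [Fintype ι] (v₀ : ι → ℝ) (v : ℕ → ι → ℝ) (k : ℕ) :
    (iterate v₀ v k).PosSemidef := by
  induction k with
  | zero => exact posSemidef_vecMulVec v₀
  | succ k ih =>
    have h := stepSize_mem k
    have : iterate v₀ v (k + 1) = (1 - stepSize k) • iterate v₀ v k +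
        stepSize k • Matrix.vecMulVec (v k) (v k) := by
      rw [iterate]; module
    rw [this]
    exact (ih.smul (sub_nonneg.mpr h.2)).add ((posSemidef_vecMulVec _).smul h.1.le)

theorem trace_iterate_succ {ι : Type} [Fintype ι] (v₀ : ι → ℝ) (v : ℕ → ι → ℝ) (k : ℕ) :
    (iterate v₀ v (k + 1)).trace =
      (1 - stepSize k) * (iterate v₀ v k).trace + stepSize k * (v k ⬝ᵥ v k) := by
  rw [iterate, Matrix.trace_add, Matrix.trace_smul, Matrix.trace_sub, trace_vecMulVec_self,
    smul_eq_mul]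
  ring

theorem trace_iterate_le_one {ι : Type} [Fintype ι] {v₀ : ι → ℝ} {v : ℕ → ι → ℝ}
    (h₀ : v₀ ⬝ᵥ v₀ = 1) {K : ℕ} (hv : ∀ k < K, v k ⬝ᵥ v k ≤ 1) :
    ∀ k ≤ K, (iterate v₀ v k).trace ≤ 1 := by
  intro k
  induction k with
  | zero => intro _; rw [iterate, trace_vecMulVec_self, h₀]
  | succ k ih =>
    intro hk
    have h := stepSize_mem k
    have h1 := ih (by omega)
    have h2 := hv k hk
    rw [trace_iterate_succ]
    nlinarith [h.1, h.2]

theorem iterate_mem_spectahedron {ι : Type} [Fintype ι] {v₀ : ι → ℝ} {v : ℕ → ι → ℝ}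
    (h₀ : v₀ ⬝ᵥ v₀ = 1) {K : ℕ} (hv : ∀ k < K, v k ⬝ᵥ v k = 1) :
    ∀ k ≤ K, iterate v₀ v k ∈ spectahedron ι := by
  intro k hk
  refine ⟨posSemidef_iterate _ _ _, ?_⟩
  induction k with
  | zero => rw [iterate, trace_vecMulVec_self, h₀]
  | succ k ih => rw [trace_iterate_succ, ih (by omega), hv k hk]; ring

theorem transpose_eq_of_posSemidef {ι : Type} [Fintype ι] {X : Matrix ι ι ℝ} (h : X.PosSemidef) :
    Xᵀ = X := by
  have := h.isHermitian
  rwa [Matrix.IsHermitian, Matrix.conjTranspose_eq_transpose_of_trivial] at this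

theorem curvature_step {ι : Type} [Fintype ι] [DecidableEq ι] {F : Matrix ι ι ℝ → ℝ} {C : ℝ}
    (hC : curvature F ≤ (C : EReal)) {X V : Matrix ι ι ℝ} (hX : X ∈ spectahedron ι)
    (hV : V ∈ spectahedron ι) {α : ℝ} (hα : α ∈ Set.Ioc (0 : ℝ) 1) :
    F (X + α • (V - X)) ≤ F X + α * frob (V - X) (symGrad F X) + α ^ 2 * C := by
  have h := hC
  simp only [curvature, iSup_le_iff] at h
  have h1 := EReal.coe_le_coe_iff.mp (h X hX V hV α hα)
  rw [frob_smul_left] at h1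
  have h2 := mul_le_mul_of_nonneg_left h1 (sq_nonneg α)
  rw [← mul_assoc, mul_one_div_cancel (pow_ne_zero 2 hα.1.ne'), one_mul] at h2
  linarith

theorem curvature_nonneg {ι : Type} [Fintype ι] [DecidableEq ι] {F : Matrix ι ι ℝ → ℝ} {C : ℝ}
    (hC : curvature F ≤ (C : EReal)) {X : Matrix ι ι ℝ} (hX : X ∈ spectahedron ι) : 0 ≤ C := by
  have := curvature_step hC hX hX (α := 1) ⟨one_pos, le_rfl⟩
  simp [frob] at this
  exact this

/-- The rate of convergence, when the eigenvector problem of step `k` is solved up to the error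
`αₖ C ηₖ`: the number `k (k + 1) (f(Xₖ) - f(Y))` grows by at most `4 C (1 + ηₖ)` per step. -/
theorem lifted_iterate_le {f : Matrix (Fin m) (Fin n) ℝ → ℝ} {t C : ℝ}
    (hc : ConvexOn ℝ Set.univ f) (hf : Differentiable ℝ f)
    (hC : curvature (lifted f t) ≤ (C : EReal)) {v₀ : Fin m ⊕ Fin n → ℝ}
    {v : ℕ → Fin m ⊕ Fin n → ℝ} (h₀ : v₀ ⬝ᵥ v₀ = 1) {K : ℕ} (hv : ∀ k < K, v k ⬝ᵥ v k = 1)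
    {η : ℕ → ℝ} (hη0 : ∀ k, 0 ≤ η k)
    (hη : ∀ k < K, ∀ Y ∈ spectahedron (Fin m ⊕ Fin n),
      v k ⬝ᵥ (symGrad (lifted f t) (iterate v₀ v k) *ᵥ v k) ≤
        frob Y (symGrad (lifted f t) (iterate v₀ v k)) + stepSize k * C * η k)
    {Y : Matrix (Fin m ⊕ Fin n) (Fin m ⊕ Fin n) ℝ} (hY : Y ∈ spectahedron (Fin m ⊕ Fin n)) :
    (K : ℝ) * (K + 1) * (lifted f t (iterate v₀ v K) - lifted f t Y) ≤
      4 * C * ∑ k ∈ Finset.range K, (1 + η k) := by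
  have hC0 := curvature_nonneg hC hY
  suffices H : ∀ k ≤ K, (k : ℝ) * (k + 1) * (lifted f t (iterate v₀ v k) - lifted f t Y) ≤
      4 * C * ∑ j ∈ Finset.range k, (1 + η j) from H K le_rfl
  intro k
  induction k with
  | zero => simp
  | succ k ih =>
    intro hk
    have ih := ih (by omega)
    set X := iterate v₀ v k with hX
    set α := stepSize k with hα
    have hXs : X ∈ spectahedron _ := iterate_mem_spectahedron h₀ hv k (by omega)
    have h1 := curvature_step hC hXs (vecMulVec_mem_spectahedron (hv k hk)) (stepSize_mem k)
    have h2 := hη k hk Y hY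
    have h3 := lifted_gradient_ineq hf hc t (transpose_eq_of_posSemidef hXs.1)
      (transpose_eq_of_posSemidef hY.1)
    rw [frob_sub_left] at h1 h3
    rw [frob_vecMulVec] at h1
    rw [← hX, ← hα] at h2
    rw [← hα] at h1
    have hα0 : 0 < α := (stepSize_mem k).1
    have h4 : lifted f t (iterate v₀ v (k + 1)) - lifted f t Y ≤
        (1 - α) * (lifted f t X - lifted f t Y) + α ^ 2 * C * (1 + η k) := by
      rw [iterate, ← hX, ← hα]
      nlinarith [mul_le_mul_of_nonneg_left h2 hα0.le, mul_le_mul_of_nonneg_left h3 hα0.le]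
    have hk2 : (0 : ℝ) < (k : ℝ) + 2 := by positivity
    have hαk : α * (k + 2) = 2 := by rw [hα, stepSize]; field_simp
    rw [Finset.sum_range_succ, mul_add]
    push_cast
    have h5 := mul_le_mul_of_nonneg_left h4 (show (0:ℝ) ≤ ((k:ℝ) + 1) * (k + 1 + 1) by positivity)
    have e1 : ((k:ℝ) + 1) * (k + 1 + 1) * ((1 - α) * (lifted f t X - lifted f t Y) +
        α ^ 2 * C * (1 + η k)) = (k : ℝ) * (k + 1) * (lifted f t X - lifted f t Y) +
          2 * α * (k + 1) * C * (1 + η k) := by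
      have : ((k:ℝ) + 1 + 1) = k + 2 := by ring
      rw [this]
      linear_combination (-(k + 1) * (lifted f t X - lifted f t Y) +
        (k + 1) * α * C * (1 + η k)) * hαk
    have e2 : 2 * α * (k + 1) * C * (1 + η k) ≤ 4 * C * (1 + η k) := by
      have : α * (k + 1) ≤ 2 := by nlinarith
      have h6 : 0 ≤ C * (1 + η k) := mul_nonneg hC0 (by linarith [hη0 k])
      nlinarith
    linarith

/-- Near-optimality on the spectahedron carries over to the nuclear norm ball. The vectors are only
required to have length at most `1`, so that zero vectors are admitted. -/
theorem isEpsSolution_of_lifted_le {f : Matrix (Fin m) (Fin n) ℝ → ℝ} {t ε : ℝ} (ht : 0 < t)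
    {v₀ : Fin m ⊕ Fin n → ℝ} {v : ℕ → Fin m ⊕ Fin n → ℝ} {K : ℕ} (h₀ : v₀ ⬝ᵥ v₀ = 1)
    (hv : ∀ k < K, v k ⬝ᵥ v k ≤ 1)
    (h : ∀ Y ∈ spectahedron (Fin m ⊕ Fin n), lifted f t (iterate v₀ v K) ≤ lifted f t Y + ε) :
    IsEpsSolution f t ε (solution t v₀ v K) := by
  have := nonempty_of_dotProduct_self_eq_one h₀
  refine ⟨nucNorm_toBlocks_le (posSemidef_iterate v₀ v K)
    (trace_iterate_le_one h₀ hv K le_rfl) ht, fun Z' hZ' => ?_⟩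
  obtain ⟨Y, hY, rfl⟩ := exists_spectahedron_of_nucNorm_le ht hZ'
  exact h Y hY

/-- With approximate eigenvectors of the prescribed accuracy (`ηₖ = 1`), `8 C / ε` iterations
suffice. -/
theorem isEpsSolution_of_isHazanRun {f : Matrix (Fin m) (Fin n) ℝ → ℝ} {t C : ℝ}
    (hc : ConvexOn ℝ Set.univ f) (hf : Differentiable ℝ f) (ht : 0 < t)
    (hC : curvature (lifted f t) ≤ (C : EReal)) {v₀ : Fin m ⊕ Fin n → ℝ}
    {v : ℕ → Fin m ⊕ Fin n → ℝ} (hrun : IsHazanRun (lifted f t) C v₀ v) {ε : ℝ} (hε : 0 < ε)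
    {k : ℕ} (hk : 1 ≤ k) (hkε : 8 * C / ε ≤ k) : IsEpsSolution f t ε (solution t v₀ v k) := by
  obtain ⟨h₀, hrun⟩ := hrun
  have := nonempty_of_dotProduct_self_eq_one h₀
  refine isEpsSolution_of_lifted_le ht h₀ (fun k _ => (hrun k).1.le) fun Y hY => ?_
  have hsym : ∀ X, (symGrad (lifted f t) X)ᵀ = symGrad (lifted f t) X := fun X => by
    rw [symGrad_lifted hf, bip_transpose]
  have h := lifted_iterate_le hc hf hC h₀ (K := k) (fun k _ => (hrun k).1) (η := fun _ => 1)
    (fun _ => zero_le_one) (fun j _ Y hY => by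
      obtain ⟨μ, hμ, z, -, -, hq⟩ := exists_bottom_eigenvector
        (hsym (iterate v₀ v j))
      have h1 := (hrun j).2 μ hμ
      have h2 := le_frob_of_quadForm hq hY
      linarith) hY
  have hC0 := curvature_nonneg hC hY
  have hk0 : (1 : ℝ) ≤ k := by exact_mod_cast hk
  rw [div_le_iff₀ hε] at hkε
  simp only [Finset.sum_const, Finset.card_range, nsmul_eq_mul] at h
  have h2 : ((k : ℝ) + 1) * (lifted f t (iterate v₀ v k) - lifted f t Y) ≤ 8 * C :=
    le_of_mul_le_mul_left (by linarith) (show (0 : ℝ) < k by linarith)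
  by_contra hlt
  push Not at hlt
  nlinarith

end Recursion

/-! ### The three-term recurrence: Lanczos vectors and the tridiagonal matrix -/

section Rows

variable {ι : Type} [Fintype ι] [DecidableEq ι]

/-- The vector `u` vanishes outside `S`. -/
def SuppOn (S : Finset ι) (u : ι → ℝ) : Prop := ∀ i ∉ S, u i = 0

theorem Counted.bind_val {α β : Type} (x : Counted α) (g : α → Counted β) :
    (x >>= g).val = (g x.val).val := rfl

theorem Counted.pure_val {α : Type} (a : α) : (pure a : Counted α).val = a := rfl

theorem Counted.bind_ops {α β : Type} (x : Counted α) (g : α → Counted β) :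
    (x >>= g).ops = x.ops + (g x.val).ops := rfl

theorem Counted.pure_ops {α : Type} (a : α) : (pure a : Counted α).ops = 0 := rfl

theorem dot_val {S : Finset ι} {v : ι → ℝ} (u : ι → ℝ) (hv : SuppOn S v) :
    (dot S u v).val = u ⬝ᵥ v := by
  simp only [dot, sumOver, rMul, dotProduct]
  exact Finset.sum_subset (Finset.subset_univ _) fun i _ hi => by rw [hv i hi, mul_zero]

theorem axmy_val {S : Finset ι} {u v : ι → ℝ} (hu : SuppOn S u) (c : ℝ) (hv : SuppOn S v) :
    (axmy S u c v).val = u - c • v := by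
  ext i
  simp only [axmy, forEach, Counted.bind_val, rMul, rSub]
  by_cases hi : i ∈ S
  · simp [hi]
  · simp [hi, hu i hi, hv i hi]

theorem axpy_val {S : Finset ι} {u v : ι → ℝ} (hu : SuppOn S u) (c : ℝ) (hv : SuppOn S v) :
    (axpy S u c v).val = u + c • v := by
  ext i
  simp only [axpy, forEach, Counted.bind_val, rMul, rAdd]
  by_cases hi : i ∈ S
  · simp [hi]
  · simp [hi, hu i hi, hv i hi]

theorem divBy_val {S : Finset ι} {u : ι → ℝ} (hu : SuppOn S u) (c : ℝ) :
    (divBy S u c).val = c⁻¹ • u := by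
  ext i
  simp only [divBy, forEach, rDiv]
  by_cases hi : i ∈ S
  · simp [hi, div_eq_inv_mul]
  · simp [hi, hu i hi]

theorem normalize_val {S : Finset ι} {u : ι → ℝ} (hu : SuppOn S u) :
    (normalize S u).val = (√(u ⬝ᵥ u))⁻¹ • u := by
  simp only [normalize, Counted.bind_val, rSqrt]
  rw [divBy_val hu, dot_val u hu]

theorem SuppOn.sub {S : Finset ι} {u v : ι → ℝ} (hu : SuppOn S u) (hv : SuppOn S v) :
    SuppOn S (u - v) := fun i hi => by simp [hu i hi, hv i hi]

theorem SuppOn.add {S : Finset ι} {u v : ι → ℝ} (hu : SuppOn S u) (hv : SuppOn S v) :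
    SuppOn S (u + v) := fun i hi => by simp [hu i hi, hv i hi]

theorem SuppOn.smul {S : Finset ι} {u : ι → ℝ} (c : ℝ) (hu : SuppOn S u) :
    SuppOn S (c • u) := fun i hi => by simp [hu i hi]

theorem dotProduct_self_nonneg' (u : ι → ℝ) : 0 ≤ u ⬝ᵥ u :=
  Finset.sum_nonneg fun _ _ => mul_self_nonneg _

theorem normalize_unit {S : Finset ι} {u : ι → ℝ} (hu : SuppOn S u) (h0 : u ≠ 0) :
    (normalize S u).val ⬝ᵥ (normalize S u).val = 1 := by
  have h1 : 0 < u ⬝ᵥ u :=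
    lt_of_le_of_ne (dotProduct_self_nonneg' u) fun h => h0 (dotProduct_self_eq_zero.mp h.symm)
  rw [normalize_val hu, smul_dotProduct, dotProduct_smul, smul_eq_mul, smul_eq_mul, ← mul_assoc,
    ← mul_inv, Real.mul_self_sqrt h1.le, inv_mul_cancel₀ h1.ne']

theorem lanczosRows_succ_val (S : Finset ι) (mv : (ι → ℝ) → Counted (ι → ℝ)) (q : ℕ)
    (vPrev : ι → ℝ) (bPrev : ℝ) (v : ι → ℝ) :
    (lanczosRows S mv (q + 1) vPrev bPrev v).val =
      let w₁ := (axmy S (mv v).val bPrev vPrev).val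
      let a := (dot S w₁ v).val
      let w₂ := (axmy S w₁ a v).val
      let b := √((dot S w₂ w₂).val)
      if 0 < b then ⟨v, a, b⟩ :: (lanczosRows S mv q v b (divBy S w₂ b).val).val
      else [⟨v, a, 0⟩] := by
  simp only [lanczosRows, Counted.bind_val, rSqrt, rPos]
  split_ifs with h h' h' <;> simp_all [Counted.bind_val, Counted.pure_val]

theorem lanczosRows_length_le (S : Finset ι) (mv : (ι → ℝ) → Counted (ι → ℝ)) (q : ℕ)
    (vPrev : ι → ℝ) (bPrev : ℝ) (v : ι → ℝ) :
    (lanczosRows S mv q vPrev bPrev v).val.length ≤ q := by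
  induction q generalizing vPrev bPrev v with
  | zero => simp [lanczosRows, Counted.pure_val]
  | succ q ih =>
    rw [lanczosRows_succ_val]
    dsimp only
    split_ifs
    · rw [List.length_cons]
      exact Nat.succ_le_succ (ih _ _ _)
    · simp

/-- The combination `∑ yᵢ vᵢ` of the Lanczos vectors. -/
def rowsComb : List (LanczosRow ι) → (ℕ → ℝ) → ι → ℝ
  | [], _ => 0
  | r :: rs, y => y 0 • r.vec + rowsComb rs (fun i => y (i + 1))

/-- The bilinear form `yᵀ T z` of the tridiagonal matrix `T`, on coefficient sequences that vanish
from the number of rows on. -/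
def rowsForm : List (LanczosRow ι) → (ℕ → ℝ) → (ℕ → ℝ) → ℝ
  | [], _, _ => 0
  | r :: rs, y, z => r.diag * y 0 * z 0 + r.off * (y 0 * z 1 + y 1 * z 0) +
      rowsForm rs (fun i => y (i + 1)) (fun i => z (i + 1))

/-- The span of the Lanczos vectors. -/
def rowsSpan : List (LanczosRow ι) → Submodule ℝ (ι → ℝ)
  | [] => ⊥
  | r :: rs => Submodule.span ℝ {r.vec} ⊔ rowsSpan rs

/-- The sequence vanishes from `n` on. -/
def Vanishes (n : ℕ) (y : ℕ → ℝ) : Prop := ∀ i, n ≤ i → y i = 0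

theorem Vanishes.tail {n : ℕ} {y : ℕ → ℝ} (h : Vanishes (n + 1) y) :
    Vanishes n (fun i => y (i + 1)) := fun i hi => h (i + 1) (by omega)

theorem exists_rowsComb {rows : List (LanczosRow ι)} {x : ι → ℝ} (hx : x ∈ rowsSpan rows) :
    ∃ y, Vanishes rows.length y ∧ x = rowsComb rows y := by
  induction rows generalizing x with
  | nil => exact ⟨0, fun _ _ => rfl, by simpa [rowsSpan, rowsComb] using hx⟩
  | cons r rs ih =>
    rw [rowsSpan, Submodule.mem_sup] at hx
    obtain ⟨a, ha, b, hb, rfl⟩ := hx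
    obtain ⟨c, rfl⟩ := Submodule.mem_span_singleton.mp ha
    obtain ⟨y, hy, rfl⟩ := ih hb
    refine ⟨fun i => if i = 0 then c else y (i - 1), fun i hi => ?_, ?_⟩
    · simp only [List.length_cons] at hi
      have h0 : i ≠ 0 := by omega
      simp only [h0, if_false]
      exact hy _ (by omega)
    · simp [rowsComb]

theorem exists_of_mem_sup_span {W : Submodule ℝ (ι → ℝ)} {v x : ι → ℝ}
    (hx : x ∈ W ⊔ Submodule.span ℝ {v}) : ∃ w ∈ W, ∃ c : ℝ, x = w + c • v := by
  obtain ⟨w, hw, y, hy, rfl⟩ := Submodule.mem_sup.mp hx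
  obtain ⟨c, rfl⟩ := Submodule.mem_span_singleton.mp hy
  exact ⟨w, hw, c, rfl⟩

/-- The invariant of the recurrence. `W` is the span of the earlier Lanczos vectors, and the
current vector `v` is orthogonal to it; `A v` has no component along `W` except the one
along `vPrev`. -/
structure LanczosInv (A : Matrix ι ι ℝ) (S : Finset ι) (W : Submodule ℝ (ι → ℝ))
    (vPrev : ι → ℝ) (bPrev : ℝ) (v : ι → ℝ) : Prop where
  unit : v ⬝ᵥ v = 1
  supp : SuppOn S v
  suppW : ∀ w ∈ W, SuppOn S w
  orth : ∀ w ∈ W, w ⬝ᵥ v = 0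
  prev : vPrev ∈ W
  threeTerm : ∀ w ∈ W, w ⬝ᵥ (A *ᵥ v) = bPrev * (w ⬝ᵥ vPrev)
  step : ∀ w ∈ W, A *ᵥ w ∈ W ⊔ Submodule.span ℝ {v}

section Invariant

variable {A : Matrix ι ι ℝ} {S : Finset ι} {W : Submodule ℝ (ι → ℝ)} {vPrev : ι → ℝ} {bPrev : ℝ}
  {v : ι → ℝ}

/-- The residual `A v - a v - b vPrev` of a Lanczos step. -/
def residual (A : Matrix ι ι ℝ) (vPrev : ι → ℝ) (bPrev : ℝ) (v : ι → ℝ) : ι → ℝ :=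
  A *ᵥ v - bPrev • vPrev - (v ⬝ᵥ (A *ᵥ v)) • v

theorem LanczosInv.rows_succ (h : LanczosInv A S W vPrev bPrev v)
    (hAS : ∀ x, SuppOn S (A *ᵥ x)) {mv : (ι → ℝ) → Counted (ι → ℝ)}
    (hmv : ∀ x, (mv x).val = A *ᵥ x) (q : ℕ) :
    (lanczosRows S mv (q + 1) vPrev bPrev v).val =
      let w₂ := residual A vPrev bPrev v
      let b := √(w₂ ⬝ᵥ w₂)
      if 0 < b then ⟨v, v ⬝ᵥ (A *ᵥ v), b⟩ :: (lanczosRows S mv q v b (b⁻¹ • w₂)).val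
      else [⟨v, v ⬝ᵥ (A *ᵥ v), 0⟩] := by
  have h1 := h.suppW _ h.prev
  have hw₁ : SuppOn S (A *ᵥ v - bPrev • vPrev) := (hAS v).sub (h1.smul _)
  have ha : (A *ᵥ v - bPrev • vPrev) ⬝ᵥ v = v ⬝ᵥ (A *ᵥ v) := by
    rw [sub_dotProduct, smul_dotProduct, h.orth _ h.prev, dotProduct_comm]; simp
  have hw₂ : SuppOn S (residual A vPrev bPrev v) := hw₁.sub (h.supp.smul _)
  rw [lanczosRows_succ_val]
  have hr : A *ᵥ v - bPrev • vPrev - (v ⬝ᵥ (A *ᵥ v)) • v = residual A vPrev bPrev v := rfl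
  simp only [hmv, axmy_val (hAS v) bPrev h1, dot_val _ h.supp, ha, axmy_val hw₁ _ h.supp, hr,
    dot_val _ hw₂, divBy_val hw₂]

theorem LanczosInv.suppOn_residual (h : LanczosInv A S W vPrev bPrev v)
    (hAS : ∀ x, SuppOn S (A *ᵥ x)) : SuppOn S (residual A vPrev bPrev v) :=
  ((hAS v).sub ((h.suppW _ h.prev).smul _)).sub (h.supp.smul _)

theorem LanczosInv.residual_orth (h : LanczosInv A S W vPrev bPrev v) :
    ∀ w ∈ W ⊔ Submodule.span ℝ {v}, w ⬝ᵥ residual A vPrev bPrev v = 0 := by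
  intro u hu
  obtain ⟨w, hw, c, rfl⟩ := exists_of_mem_sup_span hu
  have h1 : w ⬝ᵥ residual A vPrev bPrev v = 0 := by
    simp only [residual, dotProduct_sub, dotProduct_smul, h.threeTerm w hw, h.orth w hw,
      smul_eq_mul]
    ring
  have h2 : v ⬝ᵥ residual A vPrev bPrev v = 0 := by
    have : v ⬝ᵥ vPrev = 0 := by rw [dotProduct_comm]; exact h.orth _ h.prev
    simp only [residual, dotProduct_sub, dotProduct_smul, h.unit, this, smul_eq_mul]
    ring
  rw [add_dotProduct, smul_dotProduct, h1, h2]; simp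

theorem LanczosInv.next (h : LanczosInv A S W vPrev bPrev v) (hA : Aᵀ = A)
    (hAS : ∀ x, SuppOn S (A *ᵥ x))
    (hb : 0 < √(residual A vPrev bPrev v ⬝ᵥ residual A vPrev bPrev v)) :
    LanczosInv A S (W ⊔ Submodule.span ℝ {v}) v
      (√(residual A vPrev bPrev v ⬝ᵥ residual A vPrev bPrev v))
      ((√(residual A vPrev bPrev v ⬝ᵥ residual A vPrev bPrev v))⁻¹ • residual A vPrev bPrev v) := by
  have horth := h.residual_orth
  set r := residual A vPrev bPrev v with hr
  set b := √(r ⬝ᵥ r) with hbdef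
  have hAv : A *ᵥ v = r + bPrev • vPrev + (v ⬝ᵥ (A *ᵥ v)) • v := by rw [hr, residual]; abel
  have hbb : r ⬝ᵥ r = b * b := (Real.mul_self_sqrt (dotProduct_self_nonneg' r)).symm
  have hWle : W ≤ W ⊔ Submodule.span ℝ {v} := le_sup_left
  have hv : v ∈ W ⊔ Submodule.span ℝ {v} :=
    Submodule.mem_sup_right (Submodule.mem_span_singleton_self v)
  have hAvr : (A *ᵥ v) ⬝ᵥ r = b * b := by
    rw [hAv, add_dotProduct, add_dotProduct, smul_dotProduct, smul_dotProduct, hbb,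
      horth v hv, horth _ (hWle h.prev)]
    simp
  constructor
  · rw [smul_dotProduct, dotProduct_smul, hbb]; simp; field_simp
  · exact (h.suppOn_residual hAS).smul _
  · intro u hu
    obtain ⟨w, hw, c, rfl⟩ := exists_of_mem_sup_span hu
    exact (h.suppW w hw).add (h.supp.smul c)
  · intro w hw
    rw [dotProduct_smul, horth w hw, smul_zero]
  · exact hv
  · intro u hu
    obtain ⟨w, hw, c, rfl⟩ := exists_of_mem_sup_span hu
    rw [Matrix.mulVec_smul, dotProduct_smul, add_dotProduct, add_dotProduct, smul_dotProduct,
      smul_dotProduct, dotProduct_mulVec_symm hA, dotProduct_mulVec_symm hA, hAvr,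
      horth _ (h.step w hw), h.orth w hw, h.unit]
    simp
    field_simp
  · intro u hu
    obtain ⟨w, hw, c, rfl⟩ := exists_of_mem_sup_span hu
    rw [Matrix.mulVec_add, Matrix.mulVec_smul]
    refine add_mem (Submodule.mem_sup_left (h.step w hw)) (Submodule.smul_mem _ _ ?_)
    rw [hAv]
    refine add_mem (add_mem (Submodule.mem_sup_right ?_) (Submodule.mem_sup_left
      (Submodule.smul_mem _ _ (hWle h.prev)))) (Submodule.mem_sup_left (Submodule.smul_mem _ _ hv))
    rw [Submodule.mem_span_singleton]
    exact ⟨b, by rw [smul_smul, mul_inv_cancel₀ hb.ne', one_smul]⟩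

theorem residual_eq_zero (hb : ¬ 0 < √(residual A vPrev bPrev v ⬝ᵥ residual A vPrev bPrev v)) :
    residual A vPrev bPrev v = 0 := by
  rw [Real.sqrt_pos, not_lt] at hb
  exact dotProduct_self_eq_zero.mp (le_antisymm hb (dotProduct_self_nonneg' _))

end Invariant

/-- What the recurrence produces: orthonormal vectors, orthogonal to `W`, on which `A` acts through
the tridiagonal matrix. -/
theorem lanczosRows_orthonormal {A : Matrix ι ι ℝ} (hA : Aᵀ = A) {S : Finset ι}
    (hAS : ∀ x, SuppOn S (A *ᵥ x)) {mv : (ι → ℝ) → Counted (ι → ℝ)}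
    (hmv : ∀ x, (mv x).val = A *ᵥ x) (q : ℕ) :
    ∀ (W : Submodule ℝ (ι → ℝ)) (vPrev : ι → ℝ) (bPrev : ℝ) (v : ι → ℝ),
      LanczosInv A S W vPrev bPrev v →
      (∀ r ∈ (lanczosRows S mv q vPrev bPrev v).val, 0 ≤ r.off ∧ SuppOn S r.vec) ∧
      ∀ y, Vanishes (lanczosRows S mv q vPrev bPrev v).val.length y →
        let rows := (lanczosRows S mv q vPrev bPrev v).val
        (∀ w ∈ W, w ⬝ᵥ rowsComb rows y = 0) ∧
        (∀ w ∈ W, w ⬝ᵥ (A *ᵥ rowsComb rows y) = bPrev * (w ⬝ᵥ vPrev) * y 0) ∧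
        rowsComb rows y ⬝ᵥ rowsComb rows y = ∑ i ∈ Finset.range rows.length, y i * y i ∧
        rowsComb rows y ⬝ᵥ (A *ᵥ rowsComb rows y) = rowsForm rows y y := by
  induction q with
  | zero =>
    intro W vPrev bPrev v h
    refine ⟨by simp [lanczosRows, Counted.pure_val], fun y hy => ?_⟩
    have : y 0 = 0 := hy 0 (by simp [lanczosRows, Counted.pure_val])
    simp [lanczosRows, Counted.pure_val, rowsComb, rowsForm, this]
  | succ q ih =>
    intro W vPrev bPrev v h
    rw [h.rows_succ hAS hmv]
    dsimp only
    split_ifs with hb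
    · obtain ⟨ih1, ih2⟩ := ih _ _ _ _ (h.next hA hAS hb)
      set b := √(residual A vPrev bPrev v ⬝ᵥ residual A vPrev bPrev v) with hbdef
      set rows := (lanczosRows S mv q v b (b⁻¹ • residual A vPrev bPrev v)).val with hrows
      refine ⟨?_, fun y hy => ?_⟩
      · intro r hr
        rcases List.mem_cons.mp hr with rfl | hr
        · exact ⟨hb.le, h.supp⟩
        · exact ih1 r hr
      obtain ⟨j1, j2, j3, j4⟩ := ih2 (fun i => y (i + 1)) hy.tail
      set X := rowsComb rows (fun i => y (i + 1)) with hX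
      have hv : v ∈ W ⊔ Submodule.span ℝ {v} :=
        Submodule.mem_sup_right (Submodule.mem_span_singleton_self v)
      have hvX := j1 v hv
      have hvAX := j2 v hv
      rw [h.unit] at hvAX
      simp only [rowsComb, rowsForm, ← hX, List.length_cons]
      refine ⟨fun w hw => ?_, fun w hw => ?_, ?_, ?_⟩
      · rw [dotProduct_add, dotProduct_smul, h.orth w hw, j1 w (Submodule.mem_sup_left hw)]
        simp
      · rw [Matrix.mulVec_add, dotProduct_add, Matrix.mulVec_smul, dotProduct_smul,
          h.threeTerm w hw, j2 w (Submodule.mem_sup_left hw), h.orth w hw, smul_eq_mul]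
        ring
      · rw [Finset.sum_range_succ', ← j3]
        simp only [add_dotProduct, dotProduct_add, smul_dotProduct, dotProduct_smul, h.unit, hvX,
          dotProduct_comm X v, smul_eq_mul]
        ring
      · have hXAv : X ⬝ᵥ (A *ᵥ v) = v ⬝ᵥ (A *ᵥ X) := by
          rw [dotProduct_mulVec_symm hA, dotProduct_comm]
        rw [← j4]
        simp only [Matrix.mulVec_add, Matrix.mulVec_smul, add_dotProduct, dotProduct_add,
          smul_dotProduct, dotProduct_smul, hXAv, hvAX, smul_eq_mul]
        ring
    · refine ⟨?_, fun y hy => ?_⟩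
      · intro r hr
        rw [List.mem_singleton] at hr
        subst hr
        exact ⟨le_rfl, h.supp⟩
      · simp only [rowsComb, rowsForm, List.length_singleton, add_zero, Finset.range_one,
          Finset.sum_singleton, zero_mul]
        refine ⟨fun w hw => ?_, fun w hw => ?_, ?_, ?_⟩
        · rw [dotProduct_smul, h.orth w hw, smul_zero]
        · rw [Matrix.mulVec_smul, dotProduct_smul, h.threeTerm w hw, smul_eq_mul]; ring
        · rw [smul_dotProduct, dotProduct_smul, h.unit]; simp
        · rw [Matrix.mulVec_smul, smul_dotProduct, dotProduct_smul]; simp; ring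

theorem finrank_sup_span_singleton {W : Submodule ℝ (ι → ℝ)} {v : ι → ℝ} (hv : v ⬝ᵥ v = 1)
    (h : ∀ w ∈ W, w ⬝ᵥ v = 0) :
    Module.finrank ℝ ↥(W ⊔ Submodule.span ℝ {v}) = Module.finrank ℝ W + 1 := by
  have hv0 : v ≠ 0 := by rintro rfl; simp at hv
  have h1 := Submodule.finrank_sup_add_finrank_inf_eq W (Submodule.span ℝ {v})
  have h2 : W ⊓ Submodule.span ℝ {v} = ⊥ := by
    rw [Submodule.eq_bot_iff]
    rintro x ⟨hx, hx'⟩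
    obtain ⟨c, rfl⟩ := Submodule.mem_span_singleton.mp hx'
    have := h _ hx
    rw [smul_dotProduct, hv] at this
    simp at this
    simp [this]
  rw [h2, finrank_bot, finrank_span_singleton hv0, add_zero] at h1
  exact h1

/-- The Lanczos vectors span the Krylov space; if there are fewer than `q` of them, their span is
invariant under `A`. -/
theorem lanczosRows_krylov {A : Matrix ι ι ℝ} (hA : Aᵀ = A) {S : Finset ι}
    (hAS : ∀ x, SuppOn S (A *ᵥ x)) {mv : (ι → ℝ) → Counted (ι → ℝ)}
    (hmv : ∀ x, (mv x).val = A *ᵥ x) (q : ℕ) :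
    ∀ (W : Submodule ℝ (ι → ℝ)) (vPrev : ι → ℝ) (bPrev : ℝ) (v : ι → ℝ)
      (rows : List (LanczosRow ι)), LanczosInv A S W vPrev bPrev v →
      (lanczosRows S mv q vPrev bPrev v).val = rows →
      (∀ x ∈ W ⊔ Submodule.span ℝ {v}, ∀ i < q, (A ^ i) *ᵥ x ∈ W ⊔ rowsSpan rows) ∧
      (∀ x ∈ W ⊔ rowsSpan rows, SuppOn S x) ∧
      Module.finrank ℝ ↥(W ⊔ rowsSpan rows) = Module.finrank ℝ W + rows.length ∧
      (0 < q → v ∈ W ⊔ rowsSpan rows) ∧ (0 < q → 0 < rows.length) ∧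
      (rows.length = q ∨ ∀ x ∈ W ⊔ rowsSpan rows, A *ᵥ x ∈ W ⊔ rowsSpan rows) := by
  induction q with
  | zero =>
    intro W vPrev bPrev v rows h hrows
    rw [lanczosRows, Counted.pure_val] at hrows
    subst hrows
    have e : W ⊔ rowsSpan ([] : List (LanczosRow ι)) = W := by rw [rowsSpan, sup_bot_eq]
    rw [e]
    exact ⟨fun _ _ i hi => absurd hi (Nat.not_lt_zero i), h.suppW, by simp, by simp, by simp,
      Or.inl rfl⟩
  | succ q ih =>
    intro W vPrev bPrev v rows' h hrows'
    have hnext := h.next hA hAS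
    have hstep : ∀ x ∈ W ⊔ Submodule.span ℝ {v}, A *ᵥ x ∈
        (W ⊔ Submodule.span ℝ {v}) ⊔ Submodule.span ℝ {residual A vPrev bPrev v} := by
      intro u hu
      obtain ⟨w, hw, c, rfl⟩ := exists_of_mem_sup_span hu
      rw [Matrix.mulVec_add, Matrix.mulVec_smul]
      refine add_mem (Submodule.mem_sup_left (h.step w hw)) (Submodule.smul_mem _ _ ?_)
      have hAv : A *ᵥ v = residual A vPrev bPrev v + bPrev • vPrev + (v ⬝ᵥ (A *ᵥ v)) • v := by
        rw [residual]; abel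
      rw [hAv]
      exact add_mem (add_mem (Submodule.mem_sup_right (Submodule.mem_span_singleton_self _))
        (Submodule.mem_sup_left (Submodule.mem_sup_left (Submodule.smul_mem _ _ h.prev))))
        (Submodule.mem_sup_left (Submodule.mem_sup_right
          (Submodule.smul_mem _ _ (Submodule.mem_span_singleton_self v))))
    rw [h.rows_succ hAS hmv] at hrows'
    dsimp only at hrows'
    split_ifs at hrows' with hb
    all_goals subst hrows'
    · obtain ⟨i1, i2, i3, -, -, i5⟩ := ih _ _ _ _ _ (hnext hb) rfl
      have hinv := hnext hb
      set b := √(residual A vPrev bPrev v ⬝ᵥ residual A vPrev bPrev v) with hbdef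
      set rows := (lanczosRows S mv q v b (b⁻¹ • residual A vPrev bPrev v)).val with hrows
      have hassoc : W ⊔ rowsSpan (⟨v, v ⬝ᵥ (A *ᵥ v), b⟩ :: rows) =
          (W ⊔ Submodule.span ℝ {v}) ⊔ rowsSpan rows := by rw [rowsSpan, sup_assoc]
      rw [hassoc]
      refine ⟨fun x hx i hi => ?_, i2, ?_, fun _ => Submodule.mem_sup_left
        (Submodule.mem_sup_right (Submodule.mem_span_singleton_self v)), by simp, ?_⟩
      · rcases i with _ | i
        · simpa using Submodule.mem_sup_left hx
        · rw [pow_succ, ← Matrix.mulVec_mulVec]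
          refine i1 _ ?_ i (by omega)
          have : Submodule.span ℝ {b⁻¹ • residual A vPrev bPrev v} =
              Submodule.span ℝ {residual A vPrev bPrev v} :=
            Submodule.span_singleton_smul_eq (IsUnit.mk0 _ (inv_ne_zero hb.ne')) _
          rw [this]
          exact hstep x hx
      · rw [i3, finrank_sup_span_singleton h.unit h.orth, List.length_cons]; ring
      · rcases i5 with i5 | i5
        · left; rw [List.length_cons, i5]
        · exact Or.inr i5
    · have hr := residual_eq_zero hb
      have e : W ⊔ rowsSpan [⟨v, v ⬝ᵥ (A *ᵥ v), 0⟩] = W ⊔ Submodule.span ℝ {v} := by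
        rw [rowsSpan, rowsSpan, sup_bot_eq]
      rw [e]
      have hinv : ∀ x ∈ W ⊔ Submodule.span ℝ {v}, A *ᵥ x ∈ W ⊔ Submodule.span ℝ {v} := by
        intro x hx
        have := hstep x hx
        rwa [hr, Submodule.span_zero_singleton, sup_bot_eq] at this
      refine ⟨fun x hx i _ => ?_, ?_, ?_, fun _ =>
        Submodule.mem_sup_right (Submodule.mem_span_singleton_self v), by simp, Or.inr hinv⟩
      · induction i with
        | zero => simpa using hx
        | succ i ihi =>
          rw [pow_succ', ← Matrix.mulVec_mulVec]
          exact hinv _ (ihi (by omega))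
      · intro u hu
        obtain ⟨w, hw, c, rfl⟩ := exists_of_mem_sup_span hu
        exact (h.suppW w hw).add (h.supp.smul c)
      · rw [finrank_sup_span_singleton h.unit h.orth, List.length_singleton]

/-- The subspace of vectors that vanish outside `S`. -/
def suppSubmodule (S : Finset ι) : Submodule ℝ (ι → ℝ) where
  carrier := {x | SuppOn S x}
  add_mem' := SuppOn.add
  zero_mem' := fun _ _ => rfl
  smul_mem' := fun c _ h => h.smul c

theorem finrank_suppSubmodule_le (S : Finset ι) :
    Module.finrank ℝ (suppSubmodule S) ≤ S.card := by
  let T : suppSubmodule S →ₗ[ℝ] (S → ℝ) :=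
    { toFun := fun x i => x.1 i
      map_add' := fun _ _ => rfl
      map_smul' := fun _ _ => rfl }
  have hT : Function.Injective T := by
    intro x y hxy
    ext i
    by_cases hi : i ∈ S
    · exact congrFun hxy ⟨i, hi⟩
    · rw [x.2 i hi, y.2 i hi]
  have := LinearMap.finrank_le_finrank_of_injective hT
  simpa using this

theorem lanczosInv_start {A : Matrix ι ι ℝ} {S : Finset ι} {v : ι → ℝ} (hv : v ⬝ᵥ v = 1)
    (hs : SuppOn S v) : LanczosInv A S ⊥ 0 0 v where
  unit := hv
  supp := hs
  suppW := by rintro w hw; rw [Submodule.mem_bot] at hw; subst hw; exact fun _ _ => rfl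
  orth := by rintro w hw; rw [Submodule.mem_bot] at hw; simp [hw]
  prev := Submodule.zero_mem _
  threeTerm := by rintro w hw; rw [Submodule.mem_bot] at hw; simp [hw]
  step := by rintro w hw; rw [Submodule.mem_bot] at hw; simp [hw]

/-- Stopping after `|S|` steps loses nothing: every polynomial in `A` of degree less than `q`,
applied to the start vector, is a combination of the Lanczos vectors. -/
theorem aeval_mulVec_mem_rowsSpan {A : Matrix ι ι ℝ} (hA : Aᵀ = A) {S : Finset ι}
    (hAS : ∀ x, SuppOn S (A *ᵥ x)) {mv : (ι → ℝ) → Counted (ι → ℝ)}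
    (hmv : ∀ x, (mv x).val = A *ᵥ x) {q : ℕ} {v : ι → ℝ} (hv : v ⬝ᵥ v = 1) (hs : SuppOn S v)
    {p : Polynomial ℝ} (hp : p.natDegree < q) :
    (Polynomial.aeval A p) *ᵥ v ∈ rowsSpan (lanczosRows S mv (min q S.card) 0 0 v).val := by
  obtain ⟨h1, h2, h3, h4, -, h5⟩ :=
    lanczosRows_krylov hA hAS hmv (min q S.card) ⊥ 0 0 v _
      (lanczosInv_start hv hs) rfl
  set rows := (lanczosRows S mv (min q S.card) 0 0 v).val with hrows
  rw [bot_sup_eq] at h2 h3 h4 h5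
  simp only [bot_sup_eq] at h1
  have hvS : v ∈ Submodule.span ℝ {v} := Submodule.mem_span_singleton_self v
  have hScard : 0 < S.card := by
    rw [Finset.card_pos, Finset.nonempty_iff_ne_empty]
    rintro rfl
    have : v = 0 := funext fun i => hs i (by simp)
    simp [this] at hv
  have key : ∀ i < q, (A ^ i) *ᵥ v ∈ rowsSpan rows := by
    have hinvcase : (∀ x ∈ rowsSpan rows, A *ᵥ x ∈ rowsSpan rows) →
        ∀ i < q, (A ^ i) *ᵥ v ∈ rowsSpan rows := by
      intro hinv i hi
      have hv' := h4 (by omega)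
      induction i with
      | zero => simpa using hv'
      | succ i ih =>
        rw [pow_succ', ← Matrix.mulVec_mulVec]
        exact hinv _ (ih (by omega))
    rcases h5 with h5 | h5
    · by_cases hq : q ≤ S.card
      · intro i hi
        exact h1 v hvS i (by omega)
      · have heq : rowsSpan rows = suppSubmodule S := by
          refine Submodule.eq_of_le_of_finrank_le (fun x hx => h2 x hx) ?_
          rw [h3, h5, finrank_bot, zero_add, min_eq_right (by omega)]
          exact finrank_suppSubmodule_le S
        exact hinvcase fun x _ => by rw [heq]; exact hAS x
    · exact hinvcase h5
  rw [Polynomial.aeval_eq_sum_range, Matrix.sum_mulVec]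
  refine Submodule.sum_mem _ fun i hi => ?_
  rw [Matrix.smul_mulVec]
  exact Submodule.smul_mem _ _ (key i (by rw [Finset.mem_range] at hi; omega))

end Rows

/-! ### The tridiagonal eigenvalue problem: bisection and one inverse iteration -/

section Tridiagonal

variable {ι : Type}

/-- The bilinear form `yᵀ (T - μ I) z` of the shifted tridiagonal matrix. -/
def shiftForm (μ : ℝ) (rows : List (LanczosRow ι)) (y z : ℕ → ℝ) : ℝ :=
  rowsForm rows y z - μ * ∑ i ∈ Finset.range rows.length, y i * z i

theorem shiftForm_cons (μ : ℝ) (r : LanczosRow ι) (rs : List (LanczosRow ι)) (y z : ℕ → ℝ) :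
    shiftForm μ (r :: rs) y z = (r.diag - μ) * y 0 * z 0 + r.off * (y 0 * z 1 + y 1 * z 0) +
      shiftForm μ rs (fun i => y (i + 1)) (fun i => z (i + 1)) := by
  simp only [shiftForm, rowsForm, List.length_cons, Finset.sum_range_succ']
  ring

theorem shiftForm_nil (μ : ℝ) (y z : ℕ → ℝ) : shiftForm μ ([] : List (LanczosRow ι)) y z = 0 := by
  simp [shiftForm, rowsForm]

theorem shiftForm_add_mul (μ t : ℝ) (rows : List (LanczosRow ι)) (y z : ℕ → ℝ) :
    shiftForm μ rows (fun i => z i + t * y i) (fun i => z i + t * y i) =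
      shiftForm μ rows z z + 2 * t * shiftForm μ rows y z + t ^ 2 * shiftForm μ rows y y := by
  induction rows generalizing y z with
  | nil => simp [shiftForm_nil]
  | cons r rs ih => simp only [shiftForm_cons, ih]; ring

theorem shiftForm_zero (μ : ℝ) (rows : List (LanczosRow ι)) :
    shiftForm μ rows (fun _ => 0) (fun _ => 0) = 0 := by
  have := shiftForm_add_mul μ (-1) rows (fun _ => 0) (fun _ => 0)
  simp only [mul_zero, add_zero] at this
  linarith

/-- Positive definiteness of `T - μ I`, with the top left entry diminished by `c`. -/
def ShiftPos (μ : ℝ) (rows : List (LanczosRow ι)) (c : ℝ) : Prop :=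
  ∀ y, Vanishes rows.length y → (∃ i, y i ≠ 0) → 0 < shiftForm μ rows y y - c * y 0 * y 0

theorem pivotsPos_cons (μ c : ℝ) (r : LanczosRow ι) (rs : List (LanczosRow ι)) :
    (pivotsPos μ (r :: rs) c).val = true ↔ 0 < r.diag - μ - c ∧
      (pivotsPos μ rs (r.off / (r.diag - μ - c) * r.off)).val = true := by
  simp only [pivotsPos, Counted.bind_val, rSub, rPos, rDiv, rMul]
  by_cases h : 0 < r.diag - μ - c <;> simp [h, Counted.bind_val, Counted.pure_val]

theorem exists_tail_ne_zero_or {y : ℕ → ℝ} (h : ∃ i, y i ≠ 0) :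
    (∃ i, y (i + 1) ≠ 0) ∨ (y 0 ≠ 0 ∧ (fun i => y (i + 1)) = fun _ => 0) := by
  by_cases h1 : ∃ i, y (i + 1) ≠ 0
  · exact Or.inl h1
  · push Not at h1
    obtain ⟨i, hi⟩ := h
    refine Or.inr ⟨?_, funext h1⟩
    rcases i with _ | i
    · exact hi
    · exact absurd (h1 i) hi

/-- The pivot test decides positive definiteness. -/
theorem pivotsPos_iff (μ : ℝ) (rows : List (LanczosRow ι)) (c : ℝ) :
    (pivotsPos μ rows c).val = true ↔ ShiftPos μ rows c := by
  induction rows generalizing c with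
  | nil =>
    refine iff_of_true rfl fun y hy ⟨i, hi⟩ => absurd (hy i (Nat.zero_le i)) hi
  | cons r rs ih =>
    rw [pivotsPos_cons, ih]
    set d := r.diag - μ - c with hd
    have key : d ≠ 0 → ∀ y : ℕ → ℝ, shiftForm μ (r :: rs) y y - c * y 0 * y 0 =
        d * (y 0 + r.off / d * y 1) ^ 2 + (shiftForm μ rs (fun i => y (i + 1))
          (fun i => y (i + 1)) - r.off / d * r.off * y 1 * y 1) := by
      intro hd0 y
      rw [shiftForm_cons]
      have : r.diag - μ = d + c := by rw [hd]; ring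
      rw [this]
      field_simp
      ring
    constructor
    · rintro ⟨hd0, hpos⟩ y hy hne
      rw [key hd0.ne']
      rcases exists_tail_ne_zero_or hne with h1 | ⟨h1, h2⟩
      · have := hpos _ hy.tail h1
        have h3 : 0 ≤ d * (y 0 + r.off / d * y 1) ^ 2 := by positivity
        simp only [zero_add] at this
        linarith
      · have h3 : y 1 = 0 := congrFun h2 0
        rw [h2, shiftForm_zero, h3]
        have : 0 < d * (y 0) ^ 2 := by positivity
        simpa using this
    · intro h
      have hd0 : 0 < d := by
        have := h (fun i => if i = 0 then 1 else 0)
          (fun i hi => by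
            have : i ≠ 0 := by simp only [List.length_cons] at hi; omega
            simp [this]) ⟨0, by simp⟩
        rw [shiftForm_cons] at this
        simp [shiftForm_zero] at this
        rw [hd]; linarith
      refine ⟨hd0, fun y hy hne => ?_⟩
      obtain ⟨i, hi⟩ := hne
      have := h (fun i => if i = 0 then -(r.off / d * y 0) else y (i - 1))
          (fun i hi => by
            simp only [List.length_cons] at hi
            have : i ≠ 0 := by omega
            simp only [this, if_false]
            exact hy _ (by omega)) ⟨i + 1, by simpa using hi⟩
      rw [key hd0.ne'] at this
      simpa using this

theorem bisect_succ_val (rows : List (LanczosRow ι)) (B : ℕ) (lo hi : ℝ) :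
    (bisect rows (B + 1) lo hi).val =
      if (pivotsPos ((lo + hi) / 2) rows 0).val = true then (bisect rows B ((lo + hi) / 2) hi).val
      else (bisect rows B lo ((lo + hi) / 2)).val := by
  simp only [bisect, Counted.bind_val, rAdd, rDiv]
  split_ifs <;> rfl

/-- The bisection keeps an interval whose lower end is below the spectrum of `T` and whose upper end
is not. -/
theorem bisect_spec (rows : List (LanczosRow ι)) (B : ℕ) : ∀ lo hi : ℝ,
    ShiftPos lo rows 0 → ¬ ShiftPos hi rows 0 →
    ShiftPos (bisect rows B lo hi).val rows 0 ∧
      ∃ hi', ¬ ShiftPos hi' rows 0 ∧ hi' - (bisect rows B lo hi).val = (hi - lo) / 2 ^ B := by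
  induction B with
  | zero => intro lo hi h1 h2; exact ⟨h1, hi, h2, by simp [bisect, Counted.pure_val]⟩
  | succ B ih =>
    intro lo hi h1 h2
    rw [bisect_succ_val, pow_succ]
    split_ifs with h
    · obtain ⟨h3, hi', h4, h5⟩ := ih _ _ ((pivotsPos_iff _ _ _).mp h) h2
      exact ⟨h3, hi', h4, by rw [h5]; field_simp; ring⟩
    · obtain ⟨h3, hi', h4, h5⟩ := ih _ _ h1 (fun hp => h ((pivotsPos_iff _ _ _).mpr hp))
      exact ⟨h3, hi', h4, by rw [h5]; field_simp; ring⟩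

/-- A list as a sequence, extended by zeros. -/
def listSeq (l : List ℝ) : ℕ → ℝ := fun i => l.getD i 0

theorem vanishes_listSeq (l : List ℝ) : Vanishes l.length (listSeq l) := fun i hi => by
  simp [listSeq, List.getElem?_eq_none hi]

theorem solveAlt_cons_val (μ c s g : ℝ) (r : LanczosRow ι) (rs : List (LanczosRow ι)) :
    (solveAlt μ (r :: rs) c s g).val =
      let d := r.diag - μ - c
      let ys := (solveAlt μ rs (r.off / d * r.off) (r.off / d * (g - s)) (0 - g)).val
      ((g - s - r.off * ys.headD 0) / d) :: ys := rfl

theorem solveAlt_length (μ : ℝ) (rows : List (LanczosRow ι)) (c s g : ℝ) :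
    (solveAlt μ rows c s g).val.length = rows.length := by
  induction rows generalizing c s g with
  | nil => rfl
  | cons r rs ih => rw [solveAlt_cons_val]; simp [ih]

/-- Elimination and back substitution solve `(T - μ I) y = (g, -g, g, …)`, in weak form. -/
theorem solveAlt_spec (μ : ℝ) (rows : List (LanczosRow ι)) (c s g : ℝ)
    (hp : (pivotsPos μ rows c).val = true) (z : ℕ → ℝ) (hz : Vanishes rows.length z) :
    shiftForm μ rows (listSeq (solveAlt μ rows c s g).val) z -
        c * listSeq (solveAlt μ rows c s g).val 0 * z 0 =
      ∑ i ∈ Finset.range rows.length, g * (-1) ^ i * z i - s * z 0 := by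
  induction rows generalizing c s g z with
  | nil =>
    have : z 0 = 0 := hz 0 le_rfl
    simp [this, shiftForm_nil]
  | cons r rs ih =>
    rw [pivotsPos_cons] at hp
    have hd0 := hp.1.ne'
    have ih := ih _ (r.off / (r.diag - μ - c) * (g - s)) (0 - g) hp.2 _ hz.tail
    rw [solveAlt_cons_val]
    set d := r.diag - μ - c with hd
    set ys := (solveAlt μ rs (r.off / d * r.off) (r.off / d * (g - s)) (0 - g)).val with hys
    have hhead : ys.headD 0 = listSeq ys 0 := by cases ys <;> rfl
    have h0 : listSeq (((g - s - r.off * ys.headD 0) / d) :: ys) 0 =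
        (g - s - r.off * listSeq ys 0) / d := by rw [← hhead]; rfl
    have h1 : listSeq (((g - s - r.off * ys.headD 0) / d) :: ys) 1 = listSeq ys 0 := rfl
    have h2 : (fun i => listSeq (((g - s - r.off * ys.headD 0) / d) :: ys) (i + 1)) =
        listSeq ys := rfl
    rw [shiftForm_cons]
    dsimp only
    rw [h0, h1, h2, List.length_cons, Finset.sum_range_succ']
    have hsum : ∑ i ∈ Finset.range rs.length, g * (-1) ^ (i + 1) * z (i + 1) =
        ∑ i ∈ Finset.range rs.length, (0 - g) * (-1) ^ i * z (i + 1) :=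
      Finset.sum_congr rfl fun i _ => by ring
    rw [hsum]
    simp only [zero_add] at ih
    have hdiag : r.diag - μ = d + c := by rw [hd]; ring
    rw [hdiag]
    generalize listSeq ys 0 = y1 at *
    generalize shiftForm μ rs (listSeq ys) (fun i => z (i + 1)) = Φ at *
    generalize ∑ i ∈ Finset.range rs.length, (0 - g) * (-1) ^ i * z (i + 1) = R at *
    have : Φ = R - r.off / d * (g - s) * z 1 + r.off / d * r.off * y1 * z 1 := by linarith
    rw [this]
    field_simp
    ring

/-- Alternating signs do not increase the form, because the off-diagonal entries of `T` are
nonnegative. -/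
theorem shiftForm_alternate_le (μ : ℝ) (rows : List (LanczosRow ι)) (hoff : ∀ r ∈ rows, 0 ≤ r.off)
    (z : ℕ → ℝ) (e : ℝ) (he : e = 1 ∨ e = -1) :
    shiftForm μ rows (fun i => e * (-1) ^ i * |z i|) (fun i => e * (-1) ^ i * |z i|) ≤
      shiftForm μ rows z z := by
  induction rows generalizing z e with
  | nil => simp [shiftForm_nil]
  | cons r rs ih =>
    rw [shiftForm_cons, shiftForm_cons]
    have h := ih (fun r' hr => hoff r' (List.mem_cons_of_mem _ hr)) (fun i => z (i + 1)) (-e)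
      (by rcases he with rfl | rfl <;> simp)
    have h1 : (fun i => e * (-1) ^ (i + 1) * |z (i + 1)|) =
        fun i => -e * (-1) ^ i * |z (i + 1)| := by ext i; ring
    rw [h1]
    have hee : e * e = 1 := by rcases he with rfl | rfl <;> norm_num
    have h2 : r.off * (-(|z 0| * |z 1|)) ≤ r.off * (z 0 * z 1) := by
      refine mul_le_mul_of_nonneg_left ?_ (hoff r List.mem_cons_self)
      rw [← abs_mul]
      exact neg_abs_le _
    have h3 : |z 0| * |z 0| = z 0 * z 0 := abs_mul_abs_self _
    have e1 : (r.diag - μ) * (e * (-1) ^ 0 * |z 0|) * (e * (-1) ^ 0 * |z 0|) =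
        (r.diag - μ) * z 0 * z 0 := by
      rw [mul_assoc _ (z 0), ← h3]; linear_combination (r.diag - μ) * |z 0| * |z 0| * hee
    have e2 : r.off * (e * (-1) ^ 0 * |z 0| * (e * (-1) ^ 1 * |z 1|) +
        e * (-1) ^ 1 * |z 1| * (e * (-1) ^ 0 * |z 0|)) = 2 * (r.off * (-(|z 0| * |z 1|))) := by
      linear_combination -2 * r.off * |z 0| * |z 1| * hee
    rw [e1, e2]
    linarith

theorem sum_sq_le_sq_sum_abs (k : ℕ) (z : ℕ → ℝ) :
    ∑ i ∈ Finset.range k, z i * z i ≤ (∑ i ∈ Finset.range k, |z i|) ^ 2 := by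
  induction k with
  | zero => simp
  | succ k ih =>
    rw [Finset.sum_range_succ, Finset.sum_range_succ, add_sq, sq_abs]
    have : 0 ≤ ∑ i ∈ Finset.range k, |z i| := Finset.sum_nonneg fun _ _ => abs_nonneg _
    nlinarith [abs_nonneg (z k)]

/-- One inverse iteration, started at `(1, -1, 1, …)`, gives a Rayleigh quotient within
`j (hi - μ)` of `μ`, where `j` is the number of rows. No eigenvector can hide from this right-hand
side: changing the signs of a vector to alternating ones does not increase the form, because the
off-diagonal entries are nonnegative, and the inner product of such a vector with `(1, -1, 1, …)` is
its `ℓ¹` norm. -/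
theorem solveAlt_rayleigh {μ hi : ℝ} {rows : List (LanczosRow ι)}
    (hoff : ∀ r ∈ rows, 0 ≤ r.off) (hμ : ShiftPos μ rows 0) (hhi : ¬ ShiftPos hi rows 0) :
    let y := listSeq (solveAlt μ rows 0 0 1).val
    (∃ i, y i ≠ 0) ∧ shiftForm μ rows y y ≤
      rows.length * (hi - μ) * ∑ i ∈ Finset.range rows.length, y i * y i := by
  intro y
  have hyv : Vanishes rows.length y := by
    have := vanishes_listSeq (solveAlt μ rows 0 0 1).val
    rwa [solveAlt_length] at this
  have hsolve : ∀ z, Vanishes rows.length z →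
      shiftForm μ rows y z = ∑ i ∈ Finset.range rows.length, (-1) ^ i * z i := by
    intro z hz
    have := solveAlt_spec μ rows 0 0 1 ((pivotsPos_iff _ _ _).mpr hμ) z hz
    simpa using this
  have hnz : ∀ z : ℕ → ℝ, Vanishes rows.length z → (∃ i, z i ≠ 0) →
      0 < ∑ i ∈ Finset.range rows.length, z i * z i := by
    rintro z hz ⟨i, hi⟩
    have hlt : i < rows.length := by
      by_contra hge
      exact hi (hz i (by omega))
    exact (mul_self_pos.mpr hi).trans_le (Finset.single_le_sum (f := fun i => z i * z i)
      (fun j _ => mul_self_nonneg (z j)) (Finset.mem_range.mpr hlt))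
  -- A vector at which the form of `T` is at most `hi`.
  simp only [ShiftPos, not_forall] at hhi
  obtain ⟨z, hzv, hz0, hz⟩ := hhi
  rw [not_lt] at hz
  simp only [zero_mul, sub_zero] at hz
  set s := ∑ i ∈ Finset.range rows.length, z i * z i with hs
  have hs0 : 0 < s := hnz z hzv hz0
  have hzμ : shiftForm μ rows z z ≤ (hi - μ) * s := by
    have : shiftForm μ rows z z = shiftForm hi rows z z + (hi - μ) * s := by
      simp only [shiftForm, hs]; ring
    linarith
  set z' : ℕ → ℝ := fun i => 1 * (-1) ^ i * |z i| with hz'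
  have hz'v : Vanishes rows.length z' := fun i hi => by simp [hz', hzv i hi]
  have hz'μ : shiftForm μ rows z' z' ≤ (hi - μ) * s :=
    (shiftForm_alternate_le μ rows hoff z 1 (Or.inl rfl)).trans hzμ
  set β := shiftForm μ rows y z' with hβ
  have hβs : s ≤ β ^ 2 := by
    have : β = ∑ i ∈ Finset.range rows.length, |z i| := by
      rw [hβ, hsolve z' hz'v]
      refine Finset.sum_congr rfl fun i _ => ?_
      rw [hz']
      dsimp only
      rw [one_mul, ← mul_assoc, ← mul_pow]
      simp
    rw [this]
    exact sum_sq_le_sq_sum_abs _ _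
  have hy0 : ∃ i, y i ≠ 0 := by
    by_contra hall
    push Not at hall
    have : y = fun _ => 0 := funext hall
    have h0 : β = 0 := by
      have h1 := shiftForm_add_mul μ 1 rows y z'
      have h2 := shiftForm_add_mul μ (-1) rows y z'
      rw [this] at h1 h2
      simp only [mul_zero, add_zero] at h1 h2
      rw [hβ, this]; linarith
    rw [h0] at hβs
    norm_num at hβs
    linarith
  refine ⟨hy0, ?_⟩
  set γ := shiftForm μ rows y y with hγ
  have hγ0 : 0 < γ := by
    have := hμ y hyv hy0
    simpa using this
  -- Cauchy-Schwarz in the inner product of `T - μ I`.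
  have hcs : β ^ 2 ≤ γ * ((hi - μ) * s) := by
    have hnonneg : 0 ≤ shiftForm μ rows (fun i => z' i + (-(β / γ)) * y i)
        (fun i => z' i + (-(β / γ)) * y i) := by
      by_cases hne : ∃ i, z' i + (-(β / γ)) * y i ≠ 0
      · have := hμ _ (fun i hi => by rw [hz'v i hi, hyv i hi]; simp) hne
        simpa using this.le
      · push Not at hne
        have : (fun i => z' i + (-(β / γ)) * y i) = fun _ => 0 := funext hne
        rw [this, shiftForm_zero]
    rw [shiftForm_add_mul, ← hβ, ← hγ] at hnonneg
    have h1 : shiftForm μ rows z' z' + 2 * -(β / γ) * β + (-(β / γ)) ^ 2 * γ =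
        shiftForm μ rows z' z' - β ^ 2 / γ := by field_simp; ring
    rw [h1] at hnonneg
    have h2 : β ^ 2 / γ ≤ (hi - μ) * s := by linarith
    rw [div_le_iff₀ hγ0] at h2
    linarith
  have h1 : 1 ≤ γ * (hi - μ) := by
    have h2 : 1 * s ≤ γ * (hi - μ) * s := by nlinarith
    exact le_of_mul_le_mul_right h2 hs0
  -- Cauchy-Schwarz for the right-hand side.
  have h2 : γ ^ 2 ≤ rows.length * ∑ i ∈ Finset.range rows.length, y i * y i := by
    rw [hγ, hsolve y hyv]
    have := Finset.sum_mul_sq_le_sq_mul_sq (Finset.range rows.length) (fun i => (-1 : ℝ) ^ i) y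
    refine this.trans (le_of_eq ?_)
    congr 1
    · simp [← pow_mul]
    · exact Finset.sum_congr rfl fun i _ => sq (y i)
  have hd : 0 ≤ hi - μ := by
    by_contra hneg
    push Not at hneg
    nlinarith
  nlinarith [mul_le_mul_of_nonneg_right h2 hd]

end Tridiagonal

/-! ### The vector returned by Lanczos' method -/

section LanczosEV

variable {ι : Type} [Fintype ι] [DecidableEq ι]

theorem combine_val {S : Finset ι} {rows : List (LanczosRow ι)}
    (hs : ∀ r ∈ rows, SuppOn S r.vec) {ys : List ℝ} (hl : ys.length = rows.length) :
    (combine S rows ys).val = rowsComb rows (listSeq ys) ∧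
      SuppOn S (combine S rows ys).val := by
  induction rows generalizing ys with
  | nil =>
    obtain rfl := List.length_eq_zero_iff.mp hl
    exact ⟨rfl, fun _ _ => rfl⟩
  | cons r rs ih =>
    rcases ys with _ | ⟨y, ys⟩
    · simp at hl
    have hr := hs r List.mem_cons_self
    obtain ⟨h1, h2⟩ := ih (fun r' hr' => hs r' (List.mem_cons_of_mem _ hr')) (ys := ys)
      (by simpa using hl)
    have h3 : (combine S (r :: rs) (y :: ys)).val = (combine S rs ys).val + y • r.vec := by
      rw [combine, Counted.bind_val, axpy_val h2 _ hr]
    rw [h3]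
    refine ⟨?_, h2.add (hr.smul _)⟩
    rw [h1, rowsComb, add_comm]
    rfl

/-- The restriction of `g` to the coordinates in `S`. -/
def restrictTo (S : Finset ι) (g : ι → ℝ) : ι → ℝ := fun i => if i ∈ S then g i else 0

theorem suppOn_restrictTo (S : Finset ι) (g : ι → ℝ) : SuppOn S (restrictTo S g) :=
  fun i hi => by simp [restrictTo, hi]

/-- The normalized start vector of Lanczos' method. -/
def startVec (S : Finset ι) (g : ι → ℝ) : ι → ℝ := (normalize S (restrictTo S g)).val

theorem suppOn_startVec (S : Finset ι) (g : ι → ℝ) : SuppOn S (startVec S g) := by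
  rw [startVec, normalize_val (suppOn_restrictTo S g)]
  exact (suppOn_restrictTo S g).smul _

theorem lanczosEV_val (S : Finset ι) (mv : (ι → ℝ) → Counted (ι → ℝ)) (L : ℝ) (q : ℕ)
    (g : ι → ℝ) : (lanczosEV S mv L q g).val =
      let rows := (lanczosRows S mv (min q S.card) 0 0 (startVec S g)).val
      let μ := (bisect rows q (-2 * L) L).val
      (normalize S (combine S rows (solveAlt μ rows 0 0 1).val).val).val := rfl

/-- Lanczos' method returns a unit vector whose Rayleigh quotient is, up to an exponentially small
error, at most that of any vector of the Krylov space. -/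
theorem lanczosEV_spec {A : Matrix ι ι ℝ} (hA : Aᵀ = A) {S : Finset ι}
    (hAS : ∀ x, SuppOn S (A *ᵥ x)) {mv : (ι → ℝ) → Counted (ι → ℝ)}
    (hmv : ∀ x, (mv x).val = A *ᵥ x) {L : ℝ} (hL : 0 < L)
    (hAL : ∀ x, |x ⬝ᵥ (A *ᵥ x)| ≤ L * (x ⬝ᵥ x)) {q : ℕ} (hq : 0 < q) {g : ι → ℝ}
    (hg : ∃ i ∈ S, g i ≠ 0) :
    SuppOn S (lanczosEV S mv L q g).val ∧
    (lanczosEV S mv L q g).val ⬝ᵥ (lanczosEV S mv L q g).val = 1 ∧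
    ∀ p : Polynomial ℝ, p.natDegree < q →
      let x := (lanczosEV S mv L q g).val
      let w := (Polynomial.aeval A p) *ᵥ startVec S g
      (x ⬝ᵥ (A *ᵥ x)) * (w ⬝ᵥ w) ≤ w ⬝ᵥ (A *ᵥ w) + q * (3 * L / 2 ^ q) * (w ⬝ᵥ w) := by
  obtain ⟨i₀, hi₀, hgi⟩ := hg
  have hv1 : startVec S g ⬝ᵥ startVec S g = 1 := by
    refine normalize_unit (suppOn_restrictTo S g) fun h => hgi ?_
    have := congrFun h i₀
    simpa [restrictTo, hi₀] using this
  have hvs := suppOn_startVec S g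
  have hinv := lanczosInv_start (A := A) hv1 hvs
  rw [lanczosEV_val]
  dsimp only
  obtain ⟨hoff, hrep⟩ := lanczosRows_orthonormal hA hAS hmv (min q S.card) _ _ _ _ hinv
  obtain ⟨-, -, -, -, hlen, -⟩ := lanczosRows_krylov hA hAS hmv (min q S.card) _ _ _ _ _ hinv rfl
  have hpoly := fun p hp => aeval_mulVec_mem_rowsSpan (p := p) (q := q) hA hAS hmv hv1 hvs hp
  have hlenq := (lanczosRows_length_le S mv (min q S.card) 0 0 (startVec S g)).trans
    (min_le_left _ _)
  have hcard : 0 < S.card := Finset.card_pos.mpr ⟨i₀, hi₀⟩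
  have hlen := hlen (by omega)
  set rows := (lanczosRows S mv (min q S.card) 0 0 (startVec S g)).val with hrows
  have hform : ∀ μ y, Vanishes rows.length y → shiftForm μ rows y y =
      rowsComb rows y ⬝ᵥ (A *ᵥ rowsComb rows y) - μ * (rowsComb rows y ⬝ᵥ rowsComb rows y) := by
    intro μ y hy
    obtain ⟨-, -, h1, h2⟩ := hrep y hy
    rw [shiftForm, h1, h2]
  have hne : ∀ y, Vanishes rows.length y → (∃ i, y i ≠ 0) →
      0 < rowsComb rows y ⬝ᵥ rowsComb rows y := by
    rintro y hy ⟨i, hi⟩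
    rw [(hrep y hy).2.2.1]
    have hlt : i < rows.length := by
      by_contra hge
      exact hi (hy i (by omega))
    exact (mul_self_pos.mpr hi).trans_le (Finset.single_le_sum (f := fun i => y i * y i)
      (fun j _ => mul_self_nonneg (y j)) (Finset.mem_range.mpr hlt))
  have hlo : ShiftPos (-2 * L) rows 0 := by
    intro y hy hy0
    have h1 := hne y hy hy0
    have h2 := (abs_le.mp (hAL (rowsComb rows y))).1
    rw [hform _ y hy]
    nlinarith
  have hhi : ¬ ShiftPos L rows 0 := by
    intro h
    have h1v : Vanishes rows.length (fun i => if i = 0 then (1 : ℝ) else 0) := fun i hi => by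
      have : i ≠ 0 := by omega
      simp [this]
    have h1 := h _ h1v ⟨0, by simp⟩
    rw [hform _ _ h1v] at h1
    have h2 := (abs_le.mp (hAL (rowsComb rows fun i => if i = 0 then (1 : ℝ) else 0))).2
    linarith
  obtain ⟨hμ, hi', hhi', hdiff⟩ := bisect_spec rows q (-2 * L) L hlo hhi
  set μ := (bisect rows q (-2 * L) L).val with hμdef
  obtain ⟨hy0, hray⟩ := solveAlt_rayleigh (fun r hr => (hoff r hr).1) hμ hhi'
  have hylen := solveAlt_length μ rows 0 0 1
  obtain ⟨hcval, hcs⟩ := combine_val (fun r hr => (hoff r hr).2) hylen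
  have hyv : Vanishes rows.length (listSeq (solveAlt μ rows 0 0 1).val) := by
    have := vanishes_listSeq (solveAlt μ rows 0 0 1).val
    rwa [hylen] at this
  set y := listSeq (solveAlt μ rows 0 0 1).val with hy
  set u := (combine S rows (solveAlt μ rows 0 0 1).val).val with hu
  have hu0 : 0 < u ⬝ᵥ u := by rw [hcval]; exact hne y hyv hy0
  have hune : u ≠ 0 := by rintro h; rw [h] at hu0; simp at hu0
  refine ⟨?_, normalize_unit hcs hune, fun p hp => ?_⟩
  · rw [normalize_val hcs]; exact hcs.smul _
  obtain ⟨z, hzv, hz⟩ := exists_rowsComb (hpoly p hp)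
  set w := (Polynomial.aeval A p) *ᵥ startVec S g with hw
  set x := (normalize S u).val with hx
  have hxR : x ⬝ᵥ (A *ᵥ x) = u ⬝ᵥ (A *ᵥ u) / (u ⬝ᵥ u) := by
    rw [hx, normalize_val hcs, Matrix.mulVec_smul, smul_dotProduct, dotProduct_smul, smul_eq_mul,
      smul_eq_mul, ← mul_assoc, ← mul_inv, Real.mul_self_sqrt hu0.le, div_eq_inv_mul]
  rw [← (hrep y hyv).2.2.1, ← hcval, hform μ y hyv, ← hcval, hdiff] at hray
  have hx1 : x ⬝ᵥ (A *ᵥ x) ≤ μ + rows.length * ((L - -2 * L) / 2 ^ q) := by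
    rw [hxR, div_le_iff₀ hu0]
    linarith
  have hx2 : x ⬝ᵥ (A *ᵥ x) ≤ μ + q * (3 * L / 2 ^ q) := by
    refine hx1.trans ?_
    have : L - -2 * L = 3 * L := by ring
    rw [this]
    gcongr
  have hw1 : μ * (w ⬝ᵥ w) ≤ w ⬝ᵥ (A *ᵥ w) := by
    by_cases hz0 : ∃ i, z i ≠ 0
    · have := hμ z hzv hz0
      rw [hform μ z hzv, ← hz] at this
      linarith
    · push Not at hz0
      have h0 : z = fun _ => 0 := funext hz0
      have h1 := (hrep z hzv).2.2.1
      rw [h0] at hz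
      rw [← h0] at hz
      rw [← hz, h0] at h1
      simp at h1
      rw [h1]; simp
  have hww := dotProduct_self_nonneg' w
  nlinarith [mul_le_mul_of_nonneg_right hx2 hww]

end LanczosEV

/-! ### Chebyshev polynomials for the Krylov space -/

section Chebyshev

open Polynomial

/-- The polynomial `Wₖ` of degree `k` with `sin ((2k+1) φ) = sin φ · Wₖ(sin² φ)`. -/
def sinPoly : ℕ → ℝ[X]
  | 0 => 1
  | 1 => C 3 - C 4 * X
  | k + 2 => (C 2 - C 4 * X) * sinPoly (k + 1) - sinPoly k

theorem sin_mul_eval_sinPoly (φ : ℝ) : ∀ k : ℕ,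
    Real.sin φ * (sinPoly k).eval (Real.sin φ ^ 2) = Real.sin ((2 * k + 1) * φ)
  | 0 => by simp [sinPoly]
  | 1 => by
    have : (2 * ((1 : ℕ) : ℝ) + 1) * φ = 3 * φ := by push_cast; ring
    rw [this, Real.sin_three_mul]
    simp [sinPoly]
    ring
  | k + 2 => by
    have h1 := sin_mul_eval_sinPoly φ (k + 1)
    have h0 := sin_mul_eval_sinPoly φ k
    have e2 : (2 * ((k + 2 : ℕ) : ℝ) + 1) * φ = (2 * ((k + 1 : ℕ) : ℝ) + 1) * φ + 2 * φ := by
      push_cast; ring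
    have e0 : (2 * (k : ℝ) + 1) * φ = (2 * ((k + 1 : ℕ) : ℝ) + 1) * φ - 2 * φ := by
      push_cast; ring
    rw [e0, Real.sin_sub] at h0
    rw [e2, Real.sin_add]
    have hc : Real.cos (2 * φ) = 1 - 2 * Real.sin φ ^ 2 := by
      rw [Real.cos_two_mul, Real.cos_sq']; ring
    simp only [sinPoly, eval_sub, eval_mul, eval_C, eval_X]
    rw [hc] at h0 ⊢
    linear_combination (2 - 4 * Real.sin φ ^ 2) * h1 - h0

theorem eval_zero_sinPoly : ∀ k : ℕ, (sinPoly k).eval 0 = 2 * k + 1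
  | 0 => by simp [sinPoly]
  | 1 => by simp [sinPoly]; norm_num
  | k + 2 => by
    simp only [sinPoly, eval_sub, eval_mul, eval_C, eval_X, eval_zero_sinPoly (k + 1),
      eval_zero_sinPoly k]
    push_cast; ring

theorem natDegree_sinPoly_le : ∀ k : ℕ, (sinPoly k).natDegree ≤ k
  | 0 => by simp [sinPoly]
  | 1 => by
    rw [sinPoly]
    compute_degree
  | k + 2 => by
    rw [sinPoly]
    refine (natDegree_sub_le _ _).trans (max_le ?_ ((natDegree_sinPoly_le k).trans (by omega)))
    refine natDegree_mul_le.trans ?_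
    have h1 : (C (2 : ℝ) - C 4 * X).natDegree ≤ 1 := by compute_degree
    have h2 := natDegree_sinPoly_le (k + 1)
    omega

theorem mul_sq_eval_sinPoly_le (k : ℕ) {y : ℝ} (h0 : 0 ≤ y) (h1 : y ≤ 1) :
    y * (sinPoly k).eval y ^ 2 ≤ 1 := by
  have hy : Real.sin (Real.arcsin √y) = √y :=
    Real.sin_arcsin (by linarith [Real.sqrt_nonneg y]) (Real.sqrt_le_one.mpr h1)
  have h := sin_mul_eval_sinPoly (Real.arcsin √y) k
  rw [hy, Real.sq_sqrt h0] at h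
  have h2 : y * (sinPoly k).eval y ^ 2 = (√y * (sinPoly k).eval y) ^ 2 := by
    rw [mul_pow, Real.sq_sqrt h0]
  rw [h2, h]
  exact Real.sin_sq_le_one _

/-- A power of the normalized polynomial `Wₖ / (2k+1)` takes the value `1` at `0`, and `y P(y)²` is
small on `[0, 1]`: against `P(y)²` for small `y`, and in absolute terms for the other `y`. The
parameter `u` sets the boundary between the two cases. -/
theorem mul_sq_pow_sinPoly_le (k e : ℕ) {y u : ℝ} (h0 : 0 ≤ y) (h1 : y ≤ 1) (hu : 0 < u) :
    y * (((sinPoly k).eval y / (2 * k + 1)) ^ (e + 1)) ^ 2 ≤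
      1 / (2 * k + 1) ^ 2 * (u * (((sinPoly k).eval y / (2 * k + 1)) ^ (e + 1)) ^ 2 +
        (1 / u) ^ e) := by
  have hk : (0 : ℝ) < 2 * k + 1 := by positivity
  set M : ℝ := 1 / (2 * k + 1) ^ 2 with hM
  have hM0 : 0 < M := by positivity
  set W := (sinPoly k).eval y / (2 * k + 1) with hW
  have ht : y * W ^ 2 ≤ M := by
    have := mul_sq_eval_sinPoly_le k h0 h1
    rw [hW, div_pow, ← mul_div_assoc, hM]
    gcongr
  by_cases hy : y ≤ M * u
  · have h2 : y * (W ^ (e + 1)) ^ 2 ≤ M * u * (W ^ (e + 1)) ^ 2 := by gcongr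
    have h3 : 0 ≤ M * (1 / u) ^ e := by positivity
    linarith
  · push Not at hy
    have hy0 : 0 < y := lt_trans (by positivity) hy
    have hW2 : W ^ 2 ≤ 1 / u := by
      rw [le_div_iff₀ hu]
      have h3 : W ^ 2 * (M * u) ≤ W ^ 2 * y := mul_le_mul_of_nonneg_left hy.le (sq_nonneg W)
      have h4 : W ^ 2 * u * M ≤ 1 * M := by linarith
      exact le_of_mul_le_mul_right h4 hM0
    have h2 : y * (W ^ (e + 1)) ^ 2 = (y * W ^ 2) * (W ^ 2) ^ e := by ring
    have h3 : (y * W ^ 2) * (W ^ 2) ^ e ≤ M * (1 / u) ^ e := by gcongr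
    have h4 : 0 ≤ M * (u * (W ^ (e + 1)) ^ 2) := by positivity
    rw [h2]
    linarith

end Chebyshev

/-! ### The error of Lanczos' method -/

section Gap

open Polynomial

variable {ι : Type} [Fintype ι] [DecidableEq ι]

theorem dotProduct_aeval_mulVec {A : Matrix ι ι ℝ} (hA : Aᵀ = A) {u : ι → ℝ} {μ : ℝ}
    (hu : A *ᵥ u = μ • u) (p : ℝ[X]) (v : ι → ℝ) :
    u ⬝ᵥ ((aeval A p) *ᵥ v) = p.eval μ * (u ⬝ᵥ v) := by
  have hpow : ∀ n : ℕ, u ⬝ᵥ ((A ^ n) *ᵥ v) = μ ^ n * (u ⬝ᵥ v) := by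
    intro n
    induction n with
    | zero => simp
    | succ n ih =>
      rw [pow_succ', ← Matrix.mulVec_mulVec, dotProduct_mulVec_symm hA, hu, smul_dotProduct, ih,
        smul_eq_mul]
      ring
  rw [aeval_eq_sum_range, eval_eq_sum_range, Matrix.sum_mulVec, dotProduct_sum, Finset.sum_mul]
  refine Finset.sum_congr rfl fun n _ => ?_
  rw [Matrix.smul_mulVec, dotProduct_smul, hpow, smul_eq_mul, mul_assoc]

/-- The Krylov space of a start vector `v` contains a vector with small Rayleigh quotient. Only the
component of `v` along a bottom eigenvector `z` enters, through the `(e+1)`-st root `u` of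
`1 / (z ⬝ v)²`. -/
theorem exists_poly_rayleigh_le {A : Matrix ι ι ℝ} (hA : Aᵀ = A) {L : ℝ} (hL : 0 < L)
    (hAL : ∀ x, |x ⬝ᵥ (A *ᵥ x)| ≤ L * (x ⬝ᵥ x)) {lam : ℝ} {z : ι → ℝ} (hz1 : z ⬝ᵥ z = 1)
    (hz : A *ᵥ z = lam • z) (hlam : ∀ x, lam * (x ⬝ᵥ x) ≤ x ⬝ᵥ (A *ᵥ x)) {v : ι → ℝ}
    (hv : v ⬝ᵥ v = 1) (k e : ℕ) {u : ℝ} (hu : 0 < u) (huc : 1 ≤ u ^ (e + 1) * (z ⬝ᵥ v) ^ 2) :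
    ∃ p : ℝ[X], p.natDegree ≤ k * (e + 1) ∧
      let w := (aeval A p) *ᵥ v
      0 < w ⬝ᵥ w ∧ w ⬝ᵥ (A *ᵥ w) ≤ (lam + 4 * L / (2 * k + 1) ^ 2 * u) * (w ⬝ᵥ w) := by
  set p : ℝ[X] := (((C (1 / (2 * (k:ℝ) + 1)) * sinPoly k) ^ (e + 1)).comp
    (C (1 / (2 * L)) * (X - C lam))) with hp
  have hk : (0 : ℝ) < 2 * k + 1 := by positivity
  have heval : ∀ x, p.eval x =
      ((sinPoly k).eval ((x - lam) / (2 * L)) / (2 * k + 1)) ^ (e + 1) := by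
    intro x
    simp only [hp, eval_comp, eval_pow, eval_mul, eval_C, eval_sub, eval_X]
    congr 1
    rw [one_div_mul_eq_div, one_div_mul_eq_div]
  have hdeg : p.natDegree ≤ k * (e + 1) := by
    rw [hp]
    refine natDegree_comp_le.trans ?_
    have h1 : ((C (1 / (2 * (k:ℝ) + 1)) * sinPoly k) ^ (e + 1)).natDegree ≤ (e + 1) * k := by
      refine natDegree_pow_le.trans (Nat.mul_le_mul_left _ ?_)
      exact (natDegree_C_mul_le _ _).trans (natDegree_sinPoly_le k)
    have h2 : (C (1 / (2 * L)) * (X - C lam)).natDegree ≤ 1 := by compute_degree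
    calc _ ≤ ((e + 1) * k) * 1 := Nat.mul_le_mul h1 h2
      _ = k * (e + 1) := by ring
  refine ⟨p, hdeg, ?_⟩
  intro w
  obtain ⟨ev, b, -, hb, hb1, hpars⟩ := exists_eigenbasis hA
  have hev : ∀ i, lam ≤ ev i ∧ ev i ≤ L ∧ -L ≤ lam := by
    intro i
    have h1 := hlam (b i)
    have h2 := (abs_le.mp (hAL (b i))).2
    have h3 := (abs_le.mp (hAL z)).1
    rw [hb, dotProduct_smul, hb1, smul_eq_mul] at h1 h2
    rw [hz, dotProduct_smul, hz1, smul_eq_mul] at h3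
    exact ⟨by linarith, by linarith, by linarith⟩
  have hbw : ∀ i, b i ⬝ᵥ w = p.eval (ev i) * (b i ⬝ᵥ v) := fun i =>
    dotProduct_aeval_mulVec hA (hb i) p v
  have hzw : z ⬝ᵥ w = z ⬝ᵥ v := by
    have h1 := dotProduct_aeval_mulVec hA hz p v
    rw [heval, sub_self, zero_div, eval_zero_sinPoly, div_self hk.ne', one_pow, one_mul] at h1
    exact h1
  have hwz : (z ⬝ᵥ v) ^ 2 ≤ w ⬝ᵥ w := by
    have := sum_sq_dotProduct_le (fun _ : Unit => z) (fun _ => 1) (fun _ => le_rfl)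
      (fun i j => by simp [hz1]) w
    simp only [Finset.univ_unique, Finset.sum_singleton] at this
    rwa [dotProduct_comm w z, hzw] at this
  have hc0 : 0 < (z ⬝ᵥ v) ^ 2 := by
    by_contra h
    have h0 : (z ⬝ᵥ v) ^ 2 = 0 := le_antisymm (not_lt.mp h) (sq_nonneg _)
    rw [h0, mul_zero] at huc
    linarith
  have hww : 0 < w ⬝ᵥ w := hc0.trans_le hwz
  refine ⟨hww, ?_⟩
  set M : ℝ := 1 / (2 * k + 1) ^ 2 with hM
  have hM0 : 0 < M := by positivity
  have hwA : w ⬝ᵥ (A *ᵥ w) - lam * (w ⬝ᵥ w) ≤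
      2 * L * M * (u * (w ⬝ᵥ w) + (1 / u) ^ e * (v ⬝ᵥ v)) := by
    rw [hpars w w, hpars w (A *ᵥ w), hpars v v, Finset.mul_sum, Finset.mul_sum, Finset.mul_sum,
      ← Finset.sum_sub_distrib, ← Finset.sum_add_distrib, Finset.mul_sum]
    refine Finset.sum_le_sum fun i _ => ?_
    rw [dotProduct_mulVec_symm hA, hb, smul_dotProduct, hbw, smul_eq_mul]
    obtain ⟨h1, h2, h3⟩ := hev i
    have hy0 : 0 ≤ (ev i - lam) / (2 * L) := div_nonneg (by linarith) (by linarith)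
    have hy1 : (ev i - lam) / (2 * L) ≤ 1 := by rw [div_le_one (by linarith)]; linarith
    have hmain := mul_sq_pow_sinPoly_le k e hy0 hy1 hu
    rw [← heval, ← hM] at hmain
    set P := p.eval (ev i) with hP
    set c := b i ⬝ᵥ v with hc
    have h4 := mul_le_mul_of_nonneg_left hmain (show 0 ≤ 2 * L * c ^ 2 by positivity)
    have h5 : 2 * L * c ^ 2 * ((ev i - lam) / (2 * L) * P ^ 2) = (ev i - lam) * P ^ 2 * c ^ 2 := by
      field_simp
    rw [h5] at h4
    linarith
  have hrec : (1 / u) ^ e ≤ u * (w ⬝ᵥ w) := by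
    rw [one_div, inv_pow, inv_le_iff_one_le_mul₀ (by positivity)]
    calc (1 : ℝ) ≤ u ^ (e + 1) * (z ⬝ᵥ v) ^ 2 := huc
      _ ≤ u ^ (e + 1) * (w ⬝ᵥ w) := by gcongr
      _ = u * (w ⬝ᵥ w) * u ^ e := by ring
  rw [hv, mul_one] at hwA
  have h6 : 2 * L * M * (u * (w ⬝ᵥ w) + (1 / u) ^ e) ≤
      2 * L * M * (u * (w ⬝ᵥ w) + u * (w ⬝ᵥ w)) := by gcongr
  have h7 : 4 * L / (2 * (k : ℝ) + 1) ^ 2 = 4 * L * M := by rw [hM]; ring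
  rw [h7]
  linarith

theorem sq_dotProduct_startVec {S : Finset ι} {z : ι → ℝ} (hz : SuppOn S z) (g : ι → ℝ) :
    (z ⬝ᵥ g) ^ 2 ≤ (z ⬝ᵥ startVec S g) ^ 2 * (g ⬝ᵥ g) := by
  have hzg : z ⬝ᵥ restrictTo S g = z ⬝ᵥ g := by
    refine Finset.sum_congr rfl fun i _ => ?_
    by_cases hi : i ∈ S
    · simp [restrictTo, hi]
    · simp [hz i hi]
  have hgg : restrictTo S g ⬝ᵥ restrictTo S g ≤ g ⬝ᵥ g := by
    refine Finset.sum_le_sum fun i _ => ?_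
    by_cases hi : i ∈ S
    · simp [restrictTo, hi]
    · simp [restrictTo, hi, mul_self_nonneg]
  rcases (dotProduct_self_nonneg' (restrictTo S g)).eq_or_lt with h0 | h0
  · have : restrictTo S g = 0 := dotProduct_self_eq_zero.mp h0.symm
    rw [← hzg, this, dotProduct_zero]
    have := mul_nonneg (sq_nonneg (z ⬝ᵥ startVec S g)) (dotProduct_self_nonneg' g)
    simpa using this
  · rw [startVec, normalize_val (suppOn_restrictTo S g), dotProduct_smul, hzg, smul_eq_mul, mul_pow,
      inv_pow, Real.sq_sqrt h0.le]
    calc (z ⬝ᵥ g) ^ 2 = (restrictTo S g ⬝ᵥ restrictTo S g)⁻¹ * (z ⬝ᵥ g) ^ 2 *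
          (restrictTo S g ⬝ᵥ restrictTo S g) := by field_simp
      _ ≤ _ := by gcongr

/-- The error of `q` steps of Lanczos' method on a matrix with bottom eigenvector `z`, for a start
vector `g`: the bound decays like `1 / k²`, with `k` about `q / (e + 1)`, and depends on `g` only
through `u`, the `(e+1)`-st root of `|g|² / (z ⬝ g)²`. -/
theorem lanczosEV_error {A : Matrix ι ι ℝ} (hA : Aᵀ = A) {S : Finset ι}
    (hAS : ∀ x, SuppOn S (A *ᵥ x)) {mv : (ι → ℝ) → Counted (ι → ℝ)}
    (hmv : ∀ x, (mv x).val = A *ᵥ x) {L : ℝ} (hL : 0 < L)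
    (hAL : ∀ x, |x ⬝ᵥ (A *ᵥ x)| ≤ L * (x ⬝ᵥ x)) {lam : ℝ} {z : ι → ℝ} (hz1 : z ⬝ᵥ z = 1)
    (hzS : SuppOn S z) (hz : A *ᵥ z = lam • z) (hlam : ∀ x, lam * (x ⬝ᵥ x) ≤ x ⬝ᵥ (A *ᵥ x))
    {q k e : ℕ} (hq : k * (e + 1) < q) {g : ι → ℝ} (hg : ∃ i ∈ S, g i ≠ 0) {u : ℝ} (hu : 0 < u)
    (hug : g ⬝ᵥ g ≤ u ^ (e + 1) * (z ⬝ᵥ g) ^ 2) :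
    let x := (lanczosEV S mv L q g).val
    x ⬝ᵥ (A *ᵥ x) ≤ lam + 4 * L / (2 * k + 1) ^ 2 * u + q * (3 * L / 2 ^ q) := by
  intro x
  have hq0 : 0 < q := by omega
  obtain ⟨-, -, hspec⟩ := lanczosEV_spec hA hAS hmv hL hAL hq0 hg
  obtain ⟨i, hi, hgi⟩ := hg
  have hgg : 0 < g ⬝ᵥ g := (mul_self_pos.mpr hgi).trans_le
    (Finset.single_le_sum (f := fun i => g i * g i) (fun j _ => mul_self_nonneg (g j))
      (Finset.mem_univ i))
  have hv : startVec S g ⬝ᵥ startVec S g = 1 := by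
    refine normalize_unit (suppOn_restrictTo S g) fun h => hgi ?_
    have := congrFun h i
    simpa [restrictTo, hi] using this
  have huc : 1 ≤ u ^ (e + 1) * (z ⬝ᵥ startVec S g) ^ 2 := by
    have h1 := sq_dotProduct_startVec hzS g
    have h2 : 1 * (g ⬝ᵥ g) ≤ u ^ (e + 1) * (z ⬝ᵥ startVec S g) ^ 2 * (g ⬝ᵥ g) := by
      rw [one_mul, mul_assoc]
      exact hug.trans (by gcongr)
    exact le_of_mul_le_mul_right h2 hgg
  obtain ⟨p, hp, hw0, hw⟩ := exists_poly_rayleigh_le hA hL hAL hz1 hz hlam hv k e hu huc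
  have h := hspec p (by omega)
  dsimp only at h
  refine le_of_mul_le_mul_right (h.trans ?_) hw0
  linarith

end Gap

/-! ### Measurability of Lanczos' method -/

section Measurability

variable {ι : Type} [Fintype ι] [DecidableEq ι] {α : Type} [MeasurableSpace α]

theorem measurable_forEach {κ : Type} [DecidableEq κ] (s : Finset κ) {g : α → κ → Counted ℝ}
    (hg : ∀ i, Measurable fun a => (g a i).val) :
    Measurable fun a => (forEach s (g a)).val := by
  refine measurable_pi_iff.mpr fun i => ?_
  simp only [forEach]
  by_cases hi : i ∈ s
  · simpa [hi] using hg i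
  · simp [hi]

theorem measurable_dot (S : Finset ι) {u v : α → ι → ℝ} (hu : Measurable u) (hv : Measurable v) :
    Measurable fun a => (dot S (u a) (v a)).val := by
  simp only [dot, sumOver, rMul]
  exact Finset.measurable_sum _ fun i _ =>
    (measurable_pi_iff.mp hu i).mul (measurable_pi_iff.mp hv i)

theorem measurable_axmy (S : Finset ι) {u v : α → ι → ℝ} {c : α → ℝ} (hu : Measurable u)
    (hc : Measurable c) (hv : Measurable v) :
    Measurable fun a => (axmy S (u a) (c a) (v a)).val :=
  measurable_forEach S fun i => (measurable_pi_iff.mp hu i).sub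
    (hc.mul (measurable_pi_iff.mp hv i))

theorem measurable_axpy (S : Finset ι) {u v : α → ι → ℝ} {c : α → ℝ} (hu : Measurable u)
    (hc : Measurable c) (hv : Measurable v) :
    Measurable fun a => (axpy S (u a) (c a) (v a)).val :=
  measurable_forEach S fun i => (measurable_pi_iff.mp hu i).add
    (hc.mul (measurable_pi_iff.mp hv i))

theorem measurable_divBy (S : Finset ι) {u : α → ι → ℝ} {c : α → ℝ} (hu : Measurable u)
    (hc : Measurable c) : Measurable fun a => (divBy S (u a) (c a)).val :=
  measurable_forEach S fun i => (measurable_pi_iff.mp hu i).div hc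

theorem measurable_normalize (S : Finset ι) {u : α → ι → ℝ} (hu : Measurable u) :
    Measurable fun a => (normalize S (u a)).val :=
  measurable_divBy S hu (measurable_dot S hu hu).sqrt

/-- Measurable dependence of a list of Lanczos rows on a parameter: the list is built from
measurable entries by finitely many measurable case distinctions. -/
inductive MeasurableRows : (α → List (LanczosRow ι)) → Prop
  | nil : MeasurableRows fun _ => []
  | cons {vec : α → ι → ℝ} {diag off : α → ℝ} {rs : α → List (LanczosRow ι)} :
      Measurable vec → Measurable diag → Measurable off → MeasurableRows rs →
      MeasurableRows fun a => ⟨vec a, diag a, off a⟩ :: rs a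
  | ite {p : α → Prop} [DecidablePred p] {F G : α → List (LanczosRow ι)} :
      MeasurableSet {a | p a} → MeasurableRows F → MeasurableRows G →
      MeasurableRows fun a => if p a then F a else G a

theorem measurableRows_lanczosRows (S : Finset ι) {mv : α → (ι → ℝ) → Counted (ι → ℝ)}
    (hmv : ∀ v : α → ι → ℝ, Measurable v → Measurable fun a => (mv a (v a)).val) (q : ℕ) :
    ∀ (vPrev : α → ι → ℝ) (bPrev : α → ℝ) (v : α → ι → ℝ), Measurable vPrev → Measurable bPrev →
      Measurable v →
      MeasurableRows fun a => (lanczosRows S (mv a) q (vPrev a) (bPrev a) (v a)).val := by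
  induction q with
  | zero => intro _ _ _ _ _ _; exact MeasurableRows.nil
  | succ q ih =>
    intro vPrev bPrev v h1 h2 h3
    simp only [lanczosRows_succ_val]
    have hw₁ := measurable_axmy S (hmv v h3) h2 h1
    have ha := measurable_dot S hw₁ h3
    have hw₂ := measurable_axmy S hw₁ ha h3
    have hb := (measurable_dot S hw₂ hw₂).sqrt
    have hp := measurableSet_lt (measurable_const (a := (0 : ℝ))) hb
    exact MeasurableRows.ite hp (.cons h3 ha hb (ih _ _ _ h3 hb (measurable_divBy S hw₂ hb)))
      (.cons h3 ha (measurable_const (a := (0 : ℝ))) .nil)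

theorem measurableSet_pivotsPos {rows : α → List (LanczosRow ι)} (hr : MeasurableRows rows)
    {μ : α → ℝ} (hμ : Measurable μ) : ∀ c : α → ℝ, Measurable c →
      MeasurableSet {a | (pivotsPos (μ a) (rows a) (c a)).val = true} := by
  induction hr with
  | nil => intro c _; simp [pivotsPos, Counted.pure_val]
  | cons hv hd ho _ ih =>
    intro c hc
    simp only [pivotsPos_cons]
    exact (measurableSet_lt measurable_const ((hd.sub hμ).sub hc)).inter
      (ih _ ((ho.div ((hd.sub hμ).sub hc)).mul ho))
  | @ite p dp F G hp _ _ ih1 ih2 =>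
    intro c hc
    have : {a | (pivotsPos (μ a) (if p a then F a else G a) (c a)).val = true} =
        ({a | p a} ∩ {a | (pivotsPos (μ a) (F a) (c a)).val = true}) ∪
          ({a | p a}ᶜ ∩ {a | (pivotsPos (μ a) (G a) (c a)).val = true}) := by
      ext a
      by_cases ha : p a <;> simp [ha]
    rw [this]
    exact (hp.inter (ih1 c hc)).union (hp.compl.inter (ih2 c hc))

theorem measurable_bisect {rows : α → List (LanczosRow ι)} (hr : MeasurableRows rows) (B : ℕ) :
    ∀ lo hi : α → ℝ, Measurable lo → Measurable hi →
      Measurable fun a => (bisect (rows a) B (lo a) (hi a)).val := by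
  induction B with
  | zero => intro lo hi h1 _; exact h1
  | succ B ih =>
    intro lo hi h1 h2
    simp only [bisect_succ_val]
    have hmid : Measurable fun a => (lo a + hi a) / 2 := (h1.add h2).div_const 2
    exact Measurable.ite (measurableSet_pivotsPos hr hmid _ measurable_const) (ih _ _ hmid h2)
      (ih _ _ h1 hmid)

/-- Measurability of the solution of the tridiagonal system. It is stated for the first entry, which
carries the induction, and for the combination of the Lanczos vectors, since lists have no
σ-algebra. -/
theorem measurable_combine_solveAlt (S : Finset ι) {rows : α → List (LanczosRow ι)}
    (hr : MeasurableRows rows) {μ : α → ℝ} (hμ : Measurable μ) : ∀ c s g : α → ℝ, Measurable c →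
      Measurable s → Measurable g →
      (Measurable fun a => (solveAlt (μ a) (rows a) (c a) (s a) (g a)).val.headD 0) ∧
      Measurable fun a =>
        (combine S (rows a) (solveAlt (μ a) (rows a) (c a) (s a) (g a)).val).val := by
  induction hr with
  | nil => intro c s g _ _ _; exact ⟨measurable_const, measurable_const⟩
  | cons hv hd ho _ ih =>
    intro c s g hc hs hg
    have hp := (hd.sub hμ).sub hc
    obtain ⟨i1, i2⟩ := ih _ _ _ ((ho.div hp).mul ho) ((ho.div hp).mul (hg.sub hs))
      ((measurable_const (a := (0 : ℝ))).sub hg)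
    have hy := ((hg.sub hs).sub (ho.mul i1)).div hp
    exact ⟨hy, measurable_axpy S i2 hy hv⟩
  | @ite p dp F G hp _ _ ih1 ih2 =>
    intro c s g hc hs hg
    obtain ⟨i1, i2⟩ := ih1 c s g hc hs hg
    obtain ⟨j1, j2⟩ := ih2 c s g hc hs hg
    constructor
    · have : Measurable fun a => if p a then _ else _ := Measurable.ite hp i1 j1
      refine (congrArg Measurable (funext fun a => ?_)).mp this
      by_cases h : p a <;> simp [h]
    · have : Measurable fun a => if p a then _ else _ := Measurable.ite hp i2 j2
      refine (congrArg Measurable (funext fun a => ?_)).mp this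
      by_cases h : p a <;> simp [h]

theorem measurable_lanczosEV (S : Finset ι) {mv : α → (ι → ℝ) → Counted (ι → ℝ)}
    (hmv : ∀ v : α → ι → ℝ, Measurable v → Measurable fun a => (mv a (v a)).val) (L : ℝ) (q : ℕ)
    {g : α → ι → ℝ} (hg : Measurable g) :
    Measurable fun a => (lanczosEV S (mv a) L q (g a)).val := by
  have hv : Measurable fun a => startVec S (g a) := by
    refine measurable_normalize S (measurable_pi_iff.mpr fun i => ?_)
    by_cases hi : i ∈ S
    · simpa [restrictTo, hi] using measurable_pi_iff.mp hg i
    · simp [restrictTo, hi]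
  have hrows := measurableRows_lanczosRows S hmv (min q S.card) (fun _ => 0) (fun _ => 0) _
    measurable_const measurable_const hv
  have hμ := measurable_bisect hrows q (fun _ => -2 * L) (fun _ => L) measurable_const
    measurable_const
  exact measurable_normalize S (measurable_combine_solveAlt S hrows hμ (fun _ => 0) (fun _ => 0)
    (fun _ => 1) measurable_const measurable_const measurable_const).2

end Measurability

/-! ### The solver as a conditional gradient iteration -/

section SolverRun

variable {m n : ℕ} {f : Matrix (Fin m) (Fin n) ℝ → ℝ}

/-- The entries of the upper right block of the gradient of the lifted objective, as computed from
the stored entries `x` of the iterate. -/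
def weights (f : Matrix (Fin m) (Fin n) ℝ → ℝ) (t : ℝ) (x : Fin m × Fin n → ℝ) :
    Fin m × Fin n → ℝ :=
  (forEach (support f) fun p => rMul (t / 2) ((forEach (support f) fun p =>
    rRead (matGrad f (Matrix.of fun i j =>
      (forEach (support f) fun p => rMul t (x p)).val (i, j)) p.1 p.2)).val p)).val

/-- The vector found by an iteration from the stored entries `x` and the random numbers `g`. -/
def stepVec (f : Matrix (Fin m) (Fin n) ℝ → ℝ) (t L : ℝ) (q : ℕ) (x : Fin m × Fin n → ℝ)
    (g : Fin m ⊕ Fin n → ℝ) : Fin m ⊕ Fin n → ℝ :=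
  (lanczosEV (active (support f)) (bipMulVec (support f) (weights f t x)) L q g).val

/-- The stored entries after the rank-one update with `v` in iteration `k`. -/
def stepEntries (f : Matrix (Fin m) (Fin n) ℝ → ℝ) (k : ℕ) (x : Fin m × Fin n → ℝ)
    (v : Fin m ⊕ Fin n → ℝ) : Fin m × Fin n → ℝ := fun p =>
  if p ∈ support f then
    x p + stepSize k * (v (Sum.inl p.1) * v (Sum.inr p.2) - x p) else 0

variable (f) (t L : ℝ) (v₀ : Fin m ⊕ Fin n → ℝ) (q : ℕ → ℕ)

/-- The stored entries at the start of iteration `k`. -/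
def entriesAt (ω : ℕ × (Fin m ⊕ Fin n) → ℝ) (k : ℕ) : Fin m × Fin n → ℝ :=
  (solver f t L v₀ q ω k).val.entries

/-- The vector found by iteration `k`. -/
def vecAt (ω : ℕ × (Fin m ⊕ Fin n) → ℝ) (k : ℕ) : Fin m ⊕ Fin n → ℝ :=
  stepVec f t L (q k) (entriesAt f t L v₀ q ω k) fun i => ω (k, i)

theorem solver_succ_val (ω : ℕ × (Fin m ⊕ Fin n) → ℝ) (k : ℕ) :
    (solver f t L v₀ q ω (k + 1)).val =
      ⟨stepEntries f k (entriesAt f t L v₀ q ω k) (vecAt f t L v₀ q ω k),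
        Function.update (solver f t L v₀ q ω k).val.factors k (vecAt f t L v₀ q ω k)⟩ := rfl

theorem entriesAt_succ (ω : ℕ × (Fin m ⊕ Fin n) → ℝ) (k : ℕ) :
    entriesAt f t L v₀ q ω (k + 1) =
      stepEntries f k (entriesAt f t L v₀ q ω k) (vecAt f t L v₀ q ω k) := rfl

theorem factors_eq_vecAt (ω : ℕ × (Fin m ⊕ Fin n) → ℝ) (K : ℕ) :
    ∀ k < K, (solver f t L v₀ q ω K).val.factors k = vecAt f t L v₀ q ω k := by
  induction K with
  | zero => intro k hk; omega
  | succ K ih =>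
    intro k hk
    rw [solver_succ_val]
    dsimp only
    by_cases h : k = K
    · subst h; simp
    · rw [Function.update_of_ne h]
      exact ih k (by omega)

theorem iterate_congr {ι : Type} {v₀ : ι → ℝ} {v v' : ℕ → ι → ℝ} {K : ℕ}
    (h : ∀ k < K, v k = v' k) : iterate v₀ v K = iterate v₀ v' K := by
  induction K with
  | zero => rfl
  | succ K ih => rw [iterate, iterate, ih fun k hk => h k (by omega), h K (by omega)]

/-- The stored entries are those of the conditional gradient iterate. -/
theorem entriesAt_eq (ω : ℕ × (Fin m ⊕ Fin n) → ℝ) (k : ℕ) (p : Fin m × Fin n)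
    (hp : p ∈ support f) : entriesAt f t L v₀ q ω k p =
      iterate v₀ (vecAt f t L v₀ q ω) k (Sum.inl p.1) (Sum.inr p.2) := by
  induction k with
  | zero =>
    simp [entriesAt, solver, Counted.bind_val, Counted.pure_val, forEach, hp, rMul, iterate,
      Matrix.vecMulVec_apply]
  | succ k ih =>
    rw [entriesAt_succ, stepEntries, if_pos hp, ih, iterate]
    simp [Matrix.vecMulVec_apply]

variable {f t L}

/-- The objective depends only on the entries in its support. -/
theorem eq_of_eq_on_support (hf : Differentiable ℝ f) {Z Z' : Matrix (Fin m) (Fin n) ℝ}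
    (h : ∀ p ∈ support f, Z p.1 p.2 = Z' p.1 p.2) : f Z = f Z' := by
  have hd : ∀ s : ℝ, HasDerivAt (fun s : ℝ => f (Z + s • (Z' - Z))) 0 s := by
    intro s
    refine (hasDerivAt_line hf Z (Z' - Z) s).congr_deriv ?_
    refine Finset.sum_eq_zero fun i _ => Finset.sum_eq_zero fun j _ => ?_
    by_cases hp : (i, j) ∈ support f
    · rw [Matrix.sub_apply, h (i, j) hp]; simp
    · have : matGrad f (Z + s • (Z' - Z)) i j = 0 := by
        by_contra hne
        exact hp (by simp only [support, Finset.mem_filter, Finset.mem_univ, true_and]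
                     exact ⟨_, hne⟩)
      rw [this, mul_zero]
  have := is_const_of_deriv_eq_zero (f := fun s : ℝ => f (Z + s • (Z' - Z)))
    (fun s => (hd s).differentiableAt) (fun s => (hd s).deriv) 0 1
  simpa using this

theorem hasDerivAt_partial (hf : Differentiable ℝ f) (Z : Matrix (Fin m) (Fin n) ℝ) (i : Fin m)
    (j : Fin n) : HasDerivAt (fun s : ℝ => f (Z + s • Matrix.single i j (1 : ℝ)))
      (matGrad f Z i j) 0 := by
  refine (hasDerivAt_line hf Z _ 0).congr_deriv ?_
  rw [← fderiv_eq_frob]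
  simp [matGrad]

theorem matGrad_congr (hf : Differentiable ℝ f) {Z Z' : Matrix (Fin m) (Fin n) ℝ}
    (h : ∀ p ∈ support f, Z p.1 p.2 = Z' p.1 p.2) : matGrad f Z = matGrad f Z' := by
  ext i j
  have h1 := hasDerivAt_partial hf Z i j
  have h2 : (fun s : ℝ => f (Z + s • Matrix.single i j (1 : ℝ))) =
      fun s : ℝ => f (Z' + s • Matrix.single i j (1 : ℝ)) := by
    funext s
    refine eq_of_eq_on_support hf fun p hp => ?_
    rw [Matrix.add_apply, Matrix.add_apply, h p hp]
  rw [h2] at h1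
  exact h1.unique (hasDerivAt_partial hf Z' i j)

theorem matGrad_eq_zero {i : Fin m} {j : Fin n} (h : (i, j) ∉ support f)
    (Z : Matrix (Fin m) (Fin n) ℝ) : matGrad f Z i j = 0 := by
  by_contra hne
  exact h (by simp only [support, Finset.mem_filter, Finset.mem_univ, true_and]; exact ⟨_, hne⟩)

theorem weights_eq_zero (t : ℝ) (x : Fin m × Fin n → ℝ) {p : Fin m × Fin n}
    (hp : p ∉ support f) : weights f t x p = 0 := by
  simp [weights, forEach, hp]

/-- The matrix handed to Lanczos' method. At the entries of an iterate it is the gradient of the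
lifted objective. -/
def weightMatrix (f : Matrix (Fin m) (Fin n) ℝ → ℝ) (t : ℝ) (x : Fin m × Fin n → ℝ) :
    Matrix (Fin m ⊕ Fin n) (Fin m ⊕ Fin n) ℝ :=
  bip (Matrix.of fun i j => weights f t x (i, j))

theorem weightMatrix_eq_symGrad (hf : Differentiable ℝ f) (t : ℝ) {x : Fin m × Fin n → ℝ}
    {X : Matrix (Fin m ⊕ Fin n) (Fin m ⊕ Fin n) ℝ}
    (h : ∀ p ∈ support f, x p = X (Sum.inl p.1) (Sum.inr p.2)) :
    weightMatrix f t x = symGrad (lifted f t) X := by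
  rw [symGrad_lifted hf, weightMatrix]
  congr 1
  ext i j
  rw [Matrix.of_apply, Matrix.smul_apply, smul_eq_mul]
  by_cases hp : (i, j) ∈ support f
  · have : matGrad f (Matrix.of fun i j => (forEach (support f) fun p => rMul t (x p)).val (i, j)) =
        matGrad f (t • X.toBlocks₁₂) := by
      refine matGrad_congr hf fun p hp => ?_
      simp [forEach, hp, rMul, h p hp, Matrix.toBlocks₁₂]
    rw [weights, this]
    simp [forEach, hp, rMul, rRead]
  · rw [weights_eq_zero t x hp, matGrad_eq_zero hp, mul_zero]

theorem bipMulVec_val {Ω : Finset (Fin m × Fin n)} {w : Fin m × Fin n → ℝ}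
    (hw : ∀ p ∉ Ω, w p = 0) (v : Fin m ⊕ Fin n → ℝ) :
    (bipMulVec Ω w v).val = bip (Matrix.of fun i j => w (i, j)) *ᵥ v := by
  have h1 : ∀ i, ∑ p ∈ Ω.filter (fun p => p.1 = i), w p * v (Sum.inr p.2) =
      ∑ j, w (i, j) * v (Sum.inr j) := by
    intro i
    rw [Finset.sum_filter, Finset.sum_subset (Finset.subset_univ Ω)
      (fun p _ hp => by simp [hw p hp]), Fintype.sum_prod_type]
    rw [Finset.sum_eq_single i (fun b _ hb => by simp [hb]) (by simp)]
    simp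
  have h2 : ∀ j, ∑ p ∈ Ω.filter (fun p => p.2 = j), w p * v (Sum.inl p.1) =
      ∑ i, w (i, j) * v (Sum.inl i) := by
    intro j
    rw [Finset.sum_filter, Finset.sum_subset (Finset.subset_univ Ω)
      (fun p _ hp => by simp [hw p hp]), Fintype.sum_prod_type_right]
    rw [Finset.sum_eq_single j (fun b _ hb => by simp [hb]) (by simp)]
    simp
  ext s
  rw [bip, Matrix.fromBlocks_mulVec]
  rcases s with i | j
  · simp only [bipMulVec, forEach, sumOver, rMul, h1, Sum.elim_inl, Matrix.zero_mulVec, zero_add]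
    have h3 : (Matrix.of (fun i j => w (i, j)) *ᵥ (v ∘ Sum.inr)) i =
        ∑ j, w (i, j) * v (Sum.inr j) :=
      rfl
    rw [h3]
    split_ifs with hi
    · rfl
    · rw [← h1, Finset.sum_eq_zero]
      intro p hp
      refine absurd ?_ hi
      rw [Finset.mem_filter] at hp
      simp only [active, Finset.mem_union, Finset.mem_image]
      exact Or.inl ⟨p, hp.1, by rw [hp.2]⟩
  · simp only [bipMulVec, forEach, sumOver, rMul, h2, Sum.elim_inr, Matrix.zero_mulVec, add_zero]
    have h3 : ((Matrix.of (fun i j => w (i, j)))ᵀ *ᵥ (v ∘ Sum.inl)) j =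
        ∑ i, w (i, j) * v (Sum.inl i) := rfl
    rw [h3]
    split_ifs with hi
    · rfl
    · rw [← h2, Finset.sum_eq_zero]
      intro p hp
      refine absurd ?_ hi
      rw [Finset.mem_filter] at hp
      simp only [active, Finset.mem_union, Finset.mem_image]
      exact Or.inr ⟨p, hp.1, by rw [hp.2]⟩

theorem bipMulVec_weights (t : ℝ) (x : Fin m × Fin n → ℝ) (v : Fin m ⊕ Fin n → ℝ) :
    (bipMulVec (support f) (weights f t x) v).val = weightMatrix f t x *ᵥ v :=
  bipMulVec_val (fun _ hp => weights_eq_zero t x hp) v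

theorem suppOn_weightMatrix_mulVec (t : ℝ) (x : Fin m × Fin n → ℝ) (v : Fin m ⊕ Fin n → ℝ) :
    SuppOn (active (support f)) (weightMatrix f t x *ᵥ v) := by
  rw [← bipMulVec_weights]
  intro i hi
  simp [bipMulVec, forEach, hi]

/-! ### Measurability of the solver -/

/-- Partial derivatives are limits of difference quotients, and hence measurable. -/
theorem measurable_matGrad (hf : Differentiable ℝ f) {Z : (Fin m × Fin n → ℝ) →
    Matrix (Fin m) (Fin n) ℝ} (hZ : Continuous Z) (i : Fin m) (j : Fin n) :
    Measurable fun x => matGrad f (Z x) i j := by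
  have hfc := differentiable_continuous hf
  have hlim : ∀ x, Filter.Tendsto (fun k : ℕ => slope
      (fun s : ℝ => f (Z x + s • Matrix.single i j (1 : ℝ))) 0 (1 / ((k : ℝ) + 1)))
      Filter.atTop (nhds (matGrad f (Z x) i j)) := by
    intro x
    refine (hasDerivAt_iff_tendsto_slope.mp (hasDerivAt_partial hf (Z x) i j)).comp ?_
    refine tendsto_nhdsWithin_iff.mpr ⟨tendsto_one_div_add_atTop_nhds_zero_nat, ?_⟩
    exact Filter.Eventually.of_forall fun k => by
      simp only [Set.mem_compl_iff, Set.mem_singleton_iff]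
      positivity
  refine measurable_of_tendsto_metrizable (f := fun (k : ℕ) x => slope
    (fun s : ℝ => f (Z x + s • Matrix.single i j (1 : ℝ))) 0 (1 / ((k : ℝ) + 1)))
    (fun k => ?_) (tendsto_pi_nhds.mpr hlim)
  refine Continuous.measurable ?_
  simp only [slope_def_field]
  exact ((hfc.comp (hZ.add continuous_const)).sub (hfc.comp (hZ.add continuous_const))).div_const _

theorem weights_apply (t : ℝ) (x : Fin m × Fin n → ℝ) (p : Fin m × Fin n) :
    weights f t x p = if p ∈ support f then t / 2 * matGrad f (Matrix.of fun i j =>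
      if (i, j) ∈ support f then t * x (i, j) else 0) p.1 p.2 else 0 := by
  by_cases hp : p ∈ support f <;> simp [weights, forEach, rMul, rRead, hp]

theorem measurable_weights (hf : Differentiable ℝ f) (t : ℝ) : Measurable (weights f t) := by
  refine measurable_pi_iff.mpr fun p => ?_
  simp only [weights_apply]
  split_ifs
  · refine (measurable_matGrad hf (continuous_matrix fun i j => ?_) p.1 p.2).const_mul _
    simp only [Matrix.of_apply]
    split_ifs
    · exact continuous_const.mul (continuous_apply _)
    · exact continuous_const
  · exact measurable_const

theorem measurable_bipMulVec {α : Type} [MeasurableSpace α] (Ω : Finset (Fin m × Fin n))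
    {w : α → Fin m × Fin n → ℝ} {v : α → Fin m ⊕ Fin n → ℝ} (hw : Measurable w)
    (hv : Measurable v) : Measurable fun a => (bipMulVec Ω (w a) (v a)).val := by
  refine measurable_pi_iff.mpr fun s => ?_
  rcases s with i | j
  · simp only [bipMulVec, forEach, sumOver, rMul]
    split_ifs
    · exact Finset.measurable_sum _ fun p _ =>
        (measurable_pi_iff.mp hw p).mul (measurable_pi_iff.mp hv _)
    · exact measurable_const
  · simp only [bipMulVec, forEach, sumOver, rMul]
    split_ifs
    · exact Finset.measurable_sum _ fun p _ =>
        (measurable_pi_iff.mp hw p).mul (measurable_pi_iff.mp hv _)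
    · exact measurable_const

theorem measurable_stepVec (hf : Differentiable ℝ f) (t L : ℝ) (q : ℕ) {α : Type}
    [MeasurableSpace α] {x : α → Fin m × Fin n → ℝ} {g : α → Fin m ⊕ Fin n → ℝ}
    (hx : Measurable x) (hg : Measurable g) :
    Measurable fun a => stepVec f t L q (x a) (g a) := by
  have hw : Measurable fun a => weights f t (x a) := (measurable_weights hf t).comp hx
  unfold stepVec
  exact measurable_lanczosEV (active (support f))
    (mv := fun a => bipMulVec (support f) (weights f t (x a)))
    (fun v hv => measurable_bipMulVec _ hw hv) L q hg

theorem measurable_stepEntries (k : ℕ) {α : Type} [MeasurableSpace α]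
    {x : α → Fin m × Fin n → ℝ} {v : α → Fin m ⊕ Fin n → ℝ} (hx : Measurable x)
    (hv : Measurable v) : Measurable fun a => stepEntries f k (x a) (v a) := by
  refine measurable_pi_iff.mpr fun p => ?_
  simp only [stepEntries]
  have h1 := measurable_pi_iff.mp hx p
  split_ifs
  · exact h1.add ((((measurable_pi_iff.mp hv _).mul (measurable_pi_iff.mp hv _)).sub
      h1).const_mul _)
  · exact measurable_const

theorem measurable_entriesAt (hf : Differentiable ℝ f) (t L : ℝ) (v₀ : Fin m ⊕ Fin n → ℝ)
    (q : ℕ → ℕ) (k : ℕ) : Measurable fun ω => entriesAt f t L v₀ q ω k := by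
  induction k with
  | zero => exact measurable_const
  | succ k ih =>
    simp only [entriesAt_succ]
    have hg : Measurable fun (ω : ℕ × (Fin m ⊕ Fin n) → ℝ) (i : Fin m ⊕ Fin n) => ω (k, i) :=
      measurable_pi_iff.mpr fun i => measurable_pi_apply _
    exact measurable_stepEntries k ih (measurable_stepVec hf t L (q k) ih hg)

/-- The stored entries depend only on the random numbers of the earlier iterations. -/
theorem entriesAt_congr (f : Matrix (Fin m) (Fin n) ℝ → ℝ) (t L : ℝ) (v₀ : Fin m ⊕ Fin n → ℝ)
    (q : ℕ → ℕ) {ω ω' : ℕ × (Fin m ⊕ Fin n) → ℝ} {k : ℕ} (h : ∀ j < k, ∀ i, ω (j, i) = ω' (j, i)) :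
    entriesAt f t L v₀ q ω k = entriesAt f t L v₀ q ω' k := by
  induction k with
  | zero => rfl
  | succ k ih =>
    have h1 := ih fun j hj => h j (by omega)
    have h2 : (fun i => ω (k, i)) = fun i => ω' (k, i) := funext (h k (by omega))
    rw [entriesAt_succ, entriesAt_succ, vecAt, vecAt, h1, h2]

end SolverRun

/-! ### The error of one iteration -/

theorem pow_three_le_four_mul_two_pow (q : ℕ) : q ^ 3 ≤ 4 * 2 ^ q := by
  rcases lt_or_ge q 4 with h | h
  · interval_cases q <;> norm_num
  · induction q, h using Nat.le_induction with
    | base => norm_num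
    | succ q hq ih =>
      have : (q + 1) ^ 3 ≤ 2 * q ^ 3 := by
        obtain ⟨r, rfl⟩ := Nat.exists_eq_add_of_le hq
        ring_nf
        nlinarith [Nat.zero_le (r ^ 3), Nat.zero_le (r ^ 2)]
      rw [pow_succ 2]
      omega

/-- The two error terms of Lanczos' method, with `q` steps spent on a polynomial that is a power
with exponent `8 p`, `p = ⌈ℓ⌉`. -/
theorem lanczos_error_le {L ε' ℓ a : ℝ} (hL : 0 < L) (hε : 0 < ε') (hℓ : 1 ≤ ℓ) (ha : 0 < a)
    {q : ℕ} (hq : a * ℓ * (1 + √(L / ε')) ≤ q) {k : ℕ} (hk : q ≤ (k + 1) * (8 * ⌈ℓ⌉₊)) {u : ℝ}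
    (hu : 1 ≤ u) :
    4 * L / (2 * (k : ℝ) + 1) ^ 2 * u + q * (3 * L / 2 ^ q) ≤ ε' * (1036 / a ^ 2 * u) := by
  set r := √(L / ε') with hr
  have hr0 : 0 < r := Real.sqrt_pos.mpr (by positivity)
  have hr2 : L = ε' * r ^ 2 := by
    rw [hr, Real.sq_sqrt (by positivity)]; field_simp
  have hd : (⌈ℓ⌉₊ : ℝ) ≤ 2 * ℓ := by
    have := (Nat.ceil_lt_add_one (by linarith : 0 ≤ ℓ)).le
    linarith
  have hqr : a * r ≤ q := by
    refine le_trans ?_ hq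
    nlinarith [mul_pos ha hr0, mul_nonneg (mul_pos ha hr0).le (sub_nonneg.mpr hℓ),
      mul_pos ha (zero_lt_one.trans_le hℓ)]
  have hq0 : (0 : ℝ) < q := (mul_pos ha hr0).trans_le hqr
  have h1 : a * r ≤ 16 * (2 * (k : ℝ) + 1) := by
    have hk' : (q : ℝ) ≤ ((k : ℝ) + 1) * (8 * ⌈ℓ⌉₊) := by exact_mod_cast hk
    have h2 : a * ℓ * r ≤ 16 * (2 * (k : ℝ) + 1) * ℓ := by
      calc a * ℓ * r ≤ a * ℓ * (1 + r) := by gcongr; linarith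
        _ ≤ ((k : ℝ) + 1) * (8 * ⌈ℓ⌉₊) := hq.trans hk'
        _ ≤ ((k : ℝ) + 1) * (8 * (2 * ℓ)) := by gcongr
        _ ≤ 16 * (2 * (k : ℝ) + 1) * ℓ := by
          nlinarith [mul_nonneg (Nat.cast_nonneg (α := ℝ) k) (by linarith : 0 ≤ ℓ)]
    refine le_of_mul_le_mul_right ?_ (by linarith : 0 < ℓ)
    linarith
  have e1 : 4 * L / (2 * (k : ℝ) + 1) ^ 2 ≤ 1024 * ε' / a ^ 2 := by
    rw [div_le_div_iff₀ (by positivity) (by positivity), hr2]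
    have := pow_le_pow_left₀ (by positivity) h1 2
    nlinarith [mul_le_mul_of_nonneg_left this hε.le]
  have e2 : q * (3 * L / 2 ^ q) ≤ 12 * ε' / a ^ 2 := by
    have h3 : (q : ℝ) ^ 3 ≤ 4 * 2 ^ q := by exact_mod_cast pow_three_le_four_mul_two_pow q
    rw [← mul_div_assoc, div_le_div_iff₀ (by positivity) (by positivity), hr2]
    have h4 := pow_le_pow_left₀ (by positivity) hqr 2
    have h5 : (q : ℝ) * (a * r) ^ 2 ≤ 4 * 2 ^ q := by
      refine le_trans ?_ h3
      rw [pow_succ' (q : ℝ) 2]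
      gcongr
    nlinarith [mul_le_mul_of_nonneg_left h5 hε.le]
  have e3 : 12 * ε' / a ^ 2 ≤ 12 * ε' / a ^ 2 * u := le_mul_of_one_le_right (by positivity) hu
  calc 4 * L / (2 * (k : ℝ) + 1) ^ 2 * u + q * (3 * L / 2 ^ q)
      ≤ 1024 * ε' / a ^ 2 * u + 12 * ε' / a ^ 2 * u :=
        add_le_add (mul_le_mul_of_nonneg_right e1 (by linarith)) (e2.trans e3)
    _ = ε' * (1036 / a ^ 2 * u) := by ring

section StepError

variable {m n : ℕ} {f : Matrix (Fin m) (Fin n) ℝ → ℝ}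

theorem dotProduct_sq_le {ι : Type} [Fintype ι] (z g : ι → ℝ) :
    (z ⬝ᵥ g) ^ 2 ≤ (z ⬝ᵥ z) * (g ⬝ᵥ g) := by
  have := Finset.sum_mul_sq_le_sq_mul_sq Finset.univ z g
  simpa only [dotProduct, pow_two] using this

/-- A symmetric matrix with zero diagonal blocks and nonnegative quadratic form has the quadratic
form zero: a change of sign in one block of the vector changes the sign of the form. -/
theorem quadForm_bip_eq_zero {G : Matrix (Fin m) (Fin n) ℝ}
    (h : ∀ x, 0 ≤ x ⬝ᵥ (bip G *ᵥ x)) (x : Fin m ⊕ Fin n → ℝ) : x ⬝ᵥ (bip G *ᵥ x) = 0 := by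
  refine le_antisymm ?_ (h x)
  have := h (Sum.elim (x ∘ Sum.inl) (-(x ∘ Sum.inr)))
  rw [dotProduct_bip, Sum.elim_comp_inl, Sum.elim_comp_inr, Matrix.mulVec_neg,
    dotProduct_neg] at this
  rw [dotProduct_bip]
  linarith

theorem stepVec_unit {t L : ℝ} (hL : 0 < L) {x : Fin m × Fin n → ℝ}
    (hA : ∀ y, |y ⬝ᵥ (weightMatrix f t x *ᵥ y)| ≤ L * (y ⬝ᵥ y)) {q : ℕ} (hq : 0 < q)
    {g : Fin m ⊕ Fin n → ℝ} (hg : ∃ i ∈ active (support f), g i ≠ 0) :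
    stepVec f t L q x g ⬝ᵥ stepVec f t L q x g = 1 :=
  (lanczosEV_spec (bip_transpose _) (suppOn_weightMatrix_mulVec t x) (bipMulVec_weights t x) hL hA
    hq hg).2.1

/-- The Rayleigh quotient found by an iteration exceeds the smallest eigenvalue `μ` by at most
`ε' θ (|g|² / (z ⬝ g)²)^{1/(8p)}`, where `z` is a unit eigenvector for `μ`. -/
theorem stepVec_error {t L ε' ℓ a : ℝ} (hL : 0 < L) (hε : 0 < ε') (hℓ : 1 ≤ ℓ) (ha : 0 < a)
    {x : Fin m × Fin n → ℝ}
    (hA : ∀ y, |y ⬝ᵥ (weightMatrix f t x *ᵥ y)| ≤ L * (y ⬝ᵥ y)) {q : ℕ}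
    (hq : a * ℓ * (1 + √(L / ε')) ≤ q) {μ : ℝ} {z : Fin m ⊕ Fin n → ℝ} (hz1 : z ⬝ᵥ z = 1)
    (hz : weightMatrix f t x *ᵥ z = μ • z)
    (hμ : ∀ y, μ * (y ⬝ᵥ y) ≤ y ⬝ᵥ (weightMatrix f t x *ᵥ y)) {g : Fin m ⊕ Fin n → ℝ}
    (hg : ∀ i, g i ≠ 0) (hzg : z ⬝ᵥ g ≠ 0) :
    stepVec f t L q x g ⬝ᵥ (weightMatrix f t x *ᵥ stepVec f t L q x g) ≤
      μ + ε' * (1036 / a ^ 2 * ((g ⬝ᵥ g) / (z ⬝ᵥ g) ^ 2) ^ (1 / (8 * ⌈ℓ⌉₊ : ℝ))) := by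
  have hp : 0 < ⌈ℓ⌉₊ := Nat.ceil_pos.mpr (by linarith)
  have hzg2 : 0 < (z ⬝ᵥ g) ^ 2 := by positivity
  have hR : 1 ≤ (g ⬝ᵥ g) / (z ⬝ᵥ g) ^ 2 := by
    rw [one_le_div hzg2]
    simpa [hz1] using dotProduct_sq_le z g
  set R := (g ⬝ᵥ g) / (z ⬝ᵥ g) ^ 2 with hRdef
  set u := R ^ (1 / (8 * ⌈ℓ⌉₊ : ℝ)) with hu
  have hu1 : 1 ≤ u := Real.one_le_rpow hR (by positivity)
  -- A nonnegative smallest eigenvalue forces the form to vanish. Otherwise `z` is supported on the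
  -- active rows and columns, where Lanczos' method works.
  rcases le_or_gt 0 μ with hμ0 | hμ0
  · have h0 : ∀ y, 0 ≤ y ⬝ᵥ (weightMatrix f t x *ᵥ y) := fun y =>
      (mul_nonneg hμ0 (dotProduct_self_nonneg' y)).trans (hμ y)
    rw [show ∀ y, y ⬝ᵥ (weightMatrix f t x *ᵥ y) = 0 from quadForm_bip_eq_zero h0]
    positivity
  · have hzS : SuppOn (active (support f)) z := by
      intro i hi
      have h1 := suppOn_weightMatrix_mulVec t x z i hi
      rw [hz, Pi.smul_apply, smul_eq_mul] at h1
      exact (mul_eq_zero.mp h1).resolve_left hμ0.ne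
    obtain ⟨i, hi⟩ : ∃ i, z i ≠ 0 := by
      by_contra hne
      push Not at hne
      simp [dotProduct, hne] at hz1
    have hiS : i ∈ active (support f) := by
      by_contra h
      exact hi (hzS i h)
    have hq0 : 0 < q := by
      rcases Nat.eq_zero_or_pos q with rfl | h
      · have : 0 < a * ℓ * (1 + √(L / ε')) := by
          have := Real.sqrt_nonneg (L / ε')
          positivity
        simp at hq
        linarith
      · exact h
    have hd : 8 * ⌈ℓ⌉₊ - 1 + 1 = 8 * ⌈ℓ⌉₊ := by omega
    have hupow : u ^ (8 * ⌈ℓ⌉₊ - 1 + 1) = R := by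
      rw [hd, hu, ← Real.rpow_natCast, ← Real.rpow_mul (by linarith)]
      push_cast
      rw [one_div_mul_cancel (by positivity), Real.rpow_one]
    have h1 := lanczosEV_error (bip_transpose _) (suppOn_weightMatrix_mulVec t x)
      (bipMulVec_weights t x) hL hA hz1 hzS hz hμ (k := (q - 1) / (8 * ⌈ℓ⌉₊))
      (e := 8 * ⌈ℓ⌉₊ - 1) (q := q)
      (by rw [hd]; have := Nat.div_mul_le_self (q - 1) (8 * ⌈ℓ⌉₊); omega)
      ⟨i, hiS, hg i⟩ (u := u) (by linarith)
      (by rw [hupow, hRdef, div_mul_cancel₀ _ hzg2.ne'])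
    have h2 := lanczos_error_le hL hε hℓ ha hq (k := (q - 1) / (8 * ⌈ℓ⌉₊)) (by
      have := Nat.lt_div_mul_add (a := q - 1) (b := 8 * ⌈ℓ⌉₊) (by omega)
      rw [add_one_mul]; omega) hu1
    refine h1.trans ?_
    rw [add_assoc]
    linarith

end StepError

/-! ### Standard normal vectors -/

section Gaussian

theorem gaussianPDF_zero_one_le_one (x : ℝ) : gaussianPDF 0 1 x ≤ 1 := by
  rw [gaussianPDF, ← ENNReal.ofReal_one]
  refine ENNReal.ofReal_le_ofReal ?_
  rw [gaussianPDFReal]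
  have h1 : 1 ≤ √(2 * Real.pi * ((1 : NNReal) : ℝ)) := by
    rw [Real.one_le_sqrt]
    have := Real.pi_gt_three
    norm_num
    linarith
  have h2 : Real.exp (-(x - 0) ^ 2 / (2 * ((1 : NNReal) : ℝ))) ≤ 1 := by
    rw [Real.exp_le_one_iff]
    have := sq_nonneg x
    norm_num
    linarith
  exact mul_le_one₀ (inv_le_one_of_one_le₀ h1) (Real.exp_pos _).le h2

theorem lintegral_abs_rpow_gaussian_lt_top :
    ∫⁻ x, ENNReal.ofReal (|x| ^ (-(1 / 2) : ℝ)) ∂(gaussianReal 0 1) < ⊤ := by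
  have hint : IntervalIntegrable (fun x : ℝ => |x| ^ (-(1 / 2) : ℝ)) volume 0 1 := by
    refine (intervalIntegral.intervalIntegrable_rpow' (r := -(1 / 2)) (by norm_num)).congr ?_
    intro x hx
    rw [Set.uIoc_of_le zero_le_one] at hx
    simp only [abs_of_pos hx.1]
  have hint' : IntervalIntegrable (fun x : ℝ => |x| ^ (-(1 / 2) : ℝ)) volume (-1) 1 := by
    refine IntervalIntegrable.trans (b := 0) ?_ hint
    rw [IntervalIntegrable.iff_comp_neg (by finiteness)]
    simpa using hint.symm
  rw [intervalIntegrable_iff_integrableOn_Icc_of_le (by norm_num)] at hint'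
  have hmeas : Measurable fun x : ℝ => ENNReal.ofReal (|x| ^ (-(1 / 2) : ℝ)) := by fun_prop
  have hle : ∀ x : ℝ, ENNReal.ofReal (|x| ^ (-(1 / 2) : ℝ)) ≤
      1 + (Set.Icc (-1) 1).indicator (fun x => ENNReal.ofReal (|x| ^ (-(1 / 2) : ℝ))) x := by
    intro x
    by_cases hx : x ∈ Set.Icc (-1 : ℝ) 1
    · rw [Set.indicator_of_mem hx]; exact le_add_self
    · rw [Set.indicator_of_notMem hx, add_zero, ← ENNReal.ofReal_one]
      refine ENNReal.ofReal_le_ofReal (Real.rpow_le_one_of_one_le_of_nonpos ?_ (by norm_num))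
      rw [Set.mem_Icc, ← abs_le, not_le] at hx
      exact hx.le
  refine (lintegral_mono hle).trans_lt ?_
  rw [lintegral_add_left measurable_const, lintegral_one, measure_univ]
  refine ENNReal.add_lt_top.mpr ⟨ENNReal.one_lt_top, ?_⟩
  rw [gaussianReal_of_var_ne_zero 0 one_ne_zero, lintegral_withDensity_eq_lintegral_mul _
    (measurable_gaussianPDF 0 1) (hmeas.indicator measurableSet_Icc)]
  have h2 : ∀ x, (gaussianPDF 0 1 * (Set.Icc (-1 : ℝ) 1).indicator
      (fun x => ENNReal.ofReal (|x| ^ (-(1 / 2) : ℝ)))) x ≤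
      (Set.Icc (-1 : ℝ) 1).indicator (fun x => ENNReal.ofReal (|x| ^ (-(1 / 2) : ℝ))) x := fun x =>
    mul_le_of_le_one_left' (gaussianPDF_zero_one_le_one x)
  refine (lintegral_mono h2).trans_lt ?_
  rw [lintegral_indicator measurableSet_Icc]
  exact hint'.lintegral_lt_top

/-- The moment of order `-1/2` of the absolute value of a standard normal variable. -/
def invSqrtMoment : ℝ :=
  (∫⁻ x, ENNReal.ofReal (|x| ^ (-(1 / 2) : ℝ)) ∂(gaussianReal 0 1)).toReal

theorem invSqrtMoment_nonneg : 0 ≤ invSqrtMoment := ENNReal.toReal_nonneg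

theorem lintegral_abs_rpow_gaussian :
    ∫⁻ x, ENNReal.ofReal (|x| ^ (-(1 / 2) : ℝ)) ∂(gaussianReal 0 1) =
      ENNReal.ofReal invSqrtMoment :=
  (ENNReal.ofReal_toReal lintegral_abs_rpow_gaussian_lt_top.ne).symm

theorem lintegral_sq_gaussian :
    ∫⁻ x, ENNReal.ofReal (x ^ 2) ∂(gaussianReal 0 1) = 1 := by
  have h : MemLp (id : ℝ → ℝ) 2 (gaussianReal 0 1) := memLp_id_gaussianReal 2
  have h0 : ∫ x, x ^ 2 ∂(gaussianReal 0 1) = 1 := by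
    have h1 := variance_of_integral_eq_zero (X := (id : ℝ → ℝ)) (μ := gaussianReal 0 1)
      measurable_id.aemeasurable (by simp)
    rw [variance_id_gaussianReal] at h1
    simpa using h1.symm
  have h2 : Integrable (fun x : ℝ => x ^ 2) (gaussianReal 0 1) := h.integrable_sq
  rw [← ofReal_integral_eq_lintegral_ofReal h2
    (Filter.Eventually.of_forall fun x => sq_nonneg x), h0, ENNReal.ofReal_one]

variable {ι : Type} [Fintype ι]

theorem measurable_dotProduct_left (z : ι → ℝ) : Measurable fun g : ι → ℝ => z ⬝ᵥ g := by
  unfold dotProduct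
  fun_prop

/-- The scalar product of a unit vector with a standard normal vector is standard normal. -/
theorem map_dotProduct_gaussian {z : ι → ℝ} (hz : z ⬝ᵥ z = 1) :
    (Measure.pi fun _ : ι => gaussianReal 0 1).map (fun g => z ⬝ᵥ g) = gaussianReal 0 1 := by
  let L : StrongDual ℝ (EuclideanSpace ℝ ι) := innerSL ℝ (WithLp.toLp 2 z)
  have hL : ‖L‖ ^ 2 = 1 := by
    rw [innerSL_apply_norm, EuclideanSpace.real_norm_sq_eq, ← hz]
    simp [dotProduct, pow_two]
  have hfun : (fun g : ι → ℝ => z ⬝ᵥ g) = L ∘ WithLp.toLp 2 := by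
    funext g
    simp [L, EuclideanSpace.inner_eq_star_dotProduct, dotProduct_comm]
  rw [hfun, ← Measure.map_map L.continuous.measurable (by fun_prop), map_pi_eq_stdGaussian,
    IsGaussian.map_eq_gaussianReal, variance_dual_stdGaussian, hL,
    integral_strongDual_stdGaussian, Real.toNNReal_one]

theorem ae_dotProduct_gaussian_ne_zero {z : ι → ℝ} (hz : z ⬝ᵥ z = 1) :
    ∀ᵐ g ∂(Measure.pi fun _ : ι => gaussianReal 0 1), z ⬝ᵥ g ≠ 0 := by
  have := nullSingletonClass_gaussianReal (μ := 0) (v := 1) one_ne_zero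
  have h : ∀ᵐ x ∂(gaussianReal 0 1), x ≠ 0 := by
    rw [ae_iff]
    simp
  rw [← map_dotProduct_gaussian hz] at h
  exact ae_of_ae_map (measurable_dotProduct_left z).aemeasurable h

/-- A moment bound for the quotient `|g|² / (z ⬝ g)²` that controls Lanczos' method. The quotient
has a heavy tail, and the small exponent `1 / 8` separates it into `(|g|²)^{1/8}` and
`|z ⬝ g|^{-1/4}`, whose squares are integrable. -/
theorem lintegral_ratio_le {z : ι → ℝ} (hz : z ⬝ᵥ z = 1) :
    ∫⁻ g, ENNReal.ofReal (((g ⬝ᵥ g) / (z ⬝ᵥ g) ^ 2) ^ (1 / 8 : ℝ))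
      ∂(Measure.pi fun _ : ι => gaussianReal 0 1) ≤
    ENNReal.ofReal (1 + Fintype.card ι + invSqrtMoment) := by
  classical
  have hle : ∀ g : ι → ℝ, ENNReal.ofReal (((g ⬝ᵥ g) / (z ⬝ᵥ g) ^ 2) ^ (1 / 8 : ℝ)) ≤
      1 + ∑ i, ENNReal.ofReal (g i ^ 2) + ENNReal.ofReal (|z ⬝ᵥ g| ^ (-(1 / 2) : ℝ)) := by
    intro g
    have h0 : 0 ≤ g ⬝ᵥ g := dotProduct_self_nonneg' g
    have hs : ∑ i, ENNReal.ofReal (g i ^ 2) = ENNReal.ofReal (g ⬝ᵥ g) := by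
      rw [← ENNReal.ofReal_sum_of_nonneg fun i _ => sq_nonneg (g i)]
      simp [dotProduct, pow_two]
    rw [hs, ← ENNReal.ofReal_one, ← ENNReal.ofReal_add zero_le_one h0,
      ← ENNReal.ofReal_add (by positivity) (by positivity)]
    refine ENNReal.ofReal_le_ofReal ?_
    set c := |z ⬝ᵥ g| with hc
    have hc0 : 0 ≤ c := abs_nonneg _
    have e1 : ((g ⬝ᵥ g) / (z ⬝ᵥ g) ^ 2) ^ (1 / 8 : ℝ) =
        (g ⬝ᵥ g) ^ (1 / 8 : ℝ) * c ^ (-(1 / 4) : ℝ) := by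
      rw [← sq_abs, ← hc, Real.div_rpow h0 (by positivity), div_eq_mul_inv, ← Real.rpow_natCast,
        ← Real.rpow_mul hc0, ← Real.rpow_neg hc0]
      norm_num
    have e2 : ((g ⬝ᵥ g) ^ (1 / 8 : ℝ)) ^ 2 ≤ 1 + g ⬝ᵥ g := by
      rw [← Real.rpow_natCast, ← Real.rpow_mul h0]
      calc (g ⬝ᵥ g) ^ ((1 / 8 : ℝ) * (2 : ℕ)) ≤ (1 + g ⬝ᵥ g) ^ ((1 / 8 : ℝ) * (2 : ℕ)) :=
            Real.rpow_le_rpow h0 (by linarith) (by norm_num)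
        _ ≤ (1 + g ⬝ᵥ g) ^ (1 : ℝ) :=
            Real.rpow_le_rpow_of_exponent_le (by linarith) (by norm_num)
        _ = 1 + g ⬝ᵥ g := Real.rpow_one _
    have e3 : (c ^ (-(1 / 4) : ℝ)) ^ 2 = c ^ (-(1 / 2) : ℝ) := by
      rw [← Real.rpow_natCast, ← Real.rpow_mul hc0]
      norm_num
    rw [e1, ← e3]
    nlinarith [sq_nonneg ((g ⬝ᵥ g) ^ (1 / 8 : ℝ) - c ^ (-(1 / 4) : ℝ)),
      sq_nonneg ((g ⬝ᵥ g) ^ (1 / 8 : ℝ)), sq_nonneg (c ^ (-(1 / 4) : ℝ))]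
  refine (lintegral_mono hle).trans (le_of_eq ?_)
  have hm1 : ∀ i : ι, Measurable fun g : ι → ℝ => ENNReal.ofReal (g i ^ 2) := fun i => by fun_prop
  have hm3 : Measurable fun x : ℝ => ENNReal.ofReal (|x| ^ (-(1 / 2) : ℝ)) := by fun_prop
  have hsq : ∀ i : ι, ∫⁻ g, ENNReal.ofReal (g i ^ 2)
      ∂(Measure.pi fun _ : ι => gaussianReal 0 1) = 1 := by
    intro i
    have h := measurePreserving_eval (fun _ : ι => gaussianReal 0 1) i
    rw [← lintegral_sq_gaussian]
    exact h.lintegral_comp (f := fun x : ℝ => ENNReal.ofReal (x ^ 2)) (by fun_prop)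
  have hm2 : Measurable fun g : ι → ℝ => 1 + ∑ i, ENNReal.ofReal (g i ^ 2) := by fun_prop
  rw [lintegral_add_left hm2,
    lintegral_add_left measurable_const, lintegral_finsetSum _ fun i _ => hm1 i,
    ← lintegral_map (f := fun x : ℝ => ENNReal.ofReal (|x| ^ (-(1 / 2) : ℝ))) hm3
      (measurable_dotProduct_left z), map_dotProduct_gaussian hz, lintegral_abs_rpow_gaussian]
  simp only [hsq, lintegral_one, measure_univ, Finset.sum_const, Finset.card_univ, nsmul_eq_mul,
    mul_one]
  rw [ENNReal.ofReal_add (by positivity) invSqrtMoment_nonneg,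
    ENNReal.ofReal_add zero_le_one (by positivity), ENNReal.ofReal_one, ENNReal.ofReal_natCast]

end Gaussian

/-! ### The success probability -/

section Probability

variable {m n : ℕ}

/-- How much the quadratic form of the symmetric matrix `(0 W; Wᵀ 0)`, with the entries `w` of `W`,
at `v` exceeds its infimum over the unit vectors. As a supremum of continuous functions it is
measurable in `(w, v)`. -/
def gap (w : Fin m × Fin n → ℝ) (v : Fin m ⊕ Fin n → ℝ) : ENNReal :=
  ⨆ y : {y : Fin m ⊕ Fin n → ℝ // y ⬝ᵥ y = 1},
    ENNReal.ofReal (v ⬝ᵥ (bip (Matrix.of fun i j => w (i, j)) *ᵥ v) -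
      y.1 ⬝ᵥ (bip (Matrix.of fun i j => w (i, j)) *ᵥ y.1))

theorem measurable_gap : Measurable fun a : (Fin m × Fin n → ℝ) × (Fin m ⊕ Fin n → ℝ) =>
    gap a.1 a.2 := by
  refine LowerSemicontinuous.measurable (lowerSemicontinuous_iSup fun y =>
    Continuous.lowerSemicontinuous (ENNReal.continuous_ofReal.comp ?_))
  simp only [dotProduct_bip]
  simp only [dotProduct, Matrix.mulVec, Matrix.of_apply, Function.comp_apply]
  fun_prop

theorem gap_le {w : Fin m × Fin n → ℝ} {v : Fin m ⊕ Fin n → ℝ} {μ c : ℝ}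
    (hμ : ∀ y, μ * (y ⬝ᵥ y) ≤ y ⬝ᵥ (bip (Matrix.of fun i j => w (i, j)) *ᵥ y))
    (h : v ⬝ᵥ (bip (Matrix.of fun i j => w (i, j)) *ᵥ v) ≤ μ + c) :
    gap w v ≤ ENNReal.ofReal c := by
  refine iSup_le fun y => ENNReal.ofReal_le_ofReal ?_
  have := hμ y.1
  rw [y.2] at this
  linarith

theorem le_gap {w : Fin m × Fin n → ℝ} {v z : Fin m ⊕ Fin n → ℝ} (hz1 : z ⬝ᵥ z = 1) :
    ENNReal.ofReal (v ⬝ᵥ (bip (Matrix.of fun i j => w (i, j)) *ᵥ v) -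
      z ⬝ᵥ (bip (Matrix.of fun i j => w (i, j)) *ᵥ z)) ≤ gap w v :=
  le_iSup (fun y : {y : Fin m ⊕ Fin n → ℝ // y ⬝ᵥ y = 1} =>
    ENNReal.ofReal (v ⬝ᵥ (bip (Matrix.of fun i j => w (i, j)) *ᵥ v) -
      y.1 ⬝ᵥ (bip (Matrix.of fun i j => w (i, j)) *ᵥ y.1))) ⟨z, hz1⟩

variable {f : Matrix (Fin m) (Fin n) ℝ → ℝ}

/-- The `p`-th power of the error of an iteration relative to `ε'`. -/
def errPow (f : Matrix (Fin m) (Fin n) ℝ → ℝ) (t L : ℝ) (q : ℕ) (ε' : ℝ) (p : ℕ)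
    (x : Fin m × Fin n → ℝ) (g : Fin m ⊕ Fin n → ℝ) : ENNReal :=
  (gap (weights f t x) (stepVec f t L q x g) / ENNReal.ofReal ε') ^ p

theorem measurable_errPow (hf : Differentiable ℝ f) (t L : ℝ) (q : ℕ) (ε' : ℝ) (p : ℕ) {α : Type}
    [MeasurableSpace α] {x : α → Fin m × Fin n → ℝ} {g : α → Fin m ⊕ Fin n → ℝ}
    (hx : Measurable x) (hg : Measurable g) :
    Measurable fun a => errPow f t L q ε' p (x a) (g a) := by
  have h1 : Measurable fun a => (weights f t (x a), stepVec f t L q (x a) (g a)) :=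
    ((measurable_weights hf t).comp hx).prodMk (measurable_stepVec hf t L q hx hg)
  exact ((measurable_gap.comp h1).div_const _).pow_const p

/-- The expected `p`-th power, `p = ⌈ℓ⌉`, of the relative error of one iteration: the exponent
`1 / (8 p)` of the error bound turns into `1 / 8`. -/
theorem lintegral_errPow_le {t L ε' ℓ a : ℝ} (hL : 0 < L) (hε : 0 < ε') (hℓ : 1 ≤ ℓ) (ha : 0 < a)
    [Nonempty (Fin m ⊕ Fin n)] {x : Fin m × Fin n → ℝ}
    (hA : ∀ y, |y ⬝ᵥ (weightMatrix f t x *ᵥ y)| ≤ L * (y ⬝ᵥ y)) {q : ℕ}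
    (hq : a * ℓ * (1 + √(L / ε')) ≤ q) :
    ∫⁻ g, errPow f t L q ε' ⌈ℓ⌉₊ x g ∂(Measure.pi fun _ => gaussianReal 0 1) ≤
      ENNReal.ofReal ((1036 / a ^ 2) ^ ⌈ℓ⌉₊ * (1 + ((m : ℝ) + n) + invSqrtMoment)) := by
  obtain ⟨μ, -, z, hz1, hz, hμ⟩ := exists_bottom_eigenvector (A := weightMatrix f t x)
    (bip_transpose _)
  have hp : 0 < ⌈ℓ⌉₊ := Nat.ceil_pos.mpr (by linarith)
  have hae : ∀ᵐ g ∂(Measure.pi fun _ : Fin m ⊕ Fin n => gaussianReal 0 1),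
      errPow f t L q ε' ⌈ℓ⌉₊ x g ≤ ENNReal.ofReal ((1036 / a ^ 2) ^ ⌈ℓ⌉₊) *
        ENNReal.ofReal (((g ⬝ᵥ g) / (z ⬝ᵥ g) ^ 2) ^ (1 / 8 : ℝ)) := by
    have h1 : ∀ᵐ g ∂(Measure.pi fun _ : Fin m ⊕ Fin n => gaussianReal 0 1), ∀ i, g i ≠ 0 := by
      rw [ae_all_iff]
      intro i
      have := ae_dotProduct_gaussian_ne_zero (z := Pi.single i (1 : ℝ)) (by simp)
      simpa using this
    filter_upwards [h1, ae_dotProduct_gaussian_ne_zero hz1] with g hg hzg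
    have h2 := gap_le hμ (stepVec_error hL hε hℓ ha hA hq hz1 hz hμ hg hzg)
    have hR : 0 ≤ (g ⬝ᵥ g) / (z ⬝ᵥ g) ^ 2 := div_nonneg (dotProduct_self_nonneg' g) (sq_nonneg _)
    calc errPow f t L q ε' ⌈ℓ⌉₊ x g
        ≤ (ENNReal.ofReal (ε' * (1036 / a ^ 2 * ((g ⬝ᵥ g) / (z ⬝ᵥ g) ^ 2) ^
            (1 / (8 * ⌈ℓ⌉₊ : ℝ)))) / ENNReal.ofReal ε') ^ ⌈ℓ⌉₊ := by
          unfold errPow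
          gcongr
      _ = ENNReal.ofReal ((1036 / a ^ 2 * ((g ⬝ᵥ g) / (z ⬝ᵥ g) ^ 2) ^
            (1 / (8 * ⌈ℓ⌉₊ : ℝ))) ^ ⌈ℓ⌉₊) := by
          rw [← ENNReal.ofReal_div_of_pos hε, mul_div_cancel_left₀ _ hε.ne',
            ENNReal.ofReal_pow (by positivity)]
      _ = _ := by
          rw [← ENNReal.ofReal_mul (by positivity), mul_pow, ← Real.rpow_natCast (_ ^ _),
            ← Real.rpow_mul hR]
          congr 3
          field_simp
  refine (lintegral_mono_ae hae).trans ?_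
  rw [lintegral_const_mul' _ _ ENNReal.ofReal_ne_top, ENNReal.ofReal_mul (by positivity)]
  gcongr
  have := lintegral_ratio_le hz1
  simpa using this

/-! ### Independence of the iterations -/

theorem map_randomNumbers (k : ℕ) :
    (randomNumbers m n).map (fun ω (i : Fin m ⊕ Fin n) => ω (k, i)) =
      Measure.pi fun _ => gaussianReal 0 1 := by
  rw [randomNumbers, Measure.map_infinitePi_infinitePi_of_inj
    (f := fun i : Fin m ⊕ Fin n => (k, i)) (fun i j h => (Prod.mk.inj h).2),
    Measure.infinitePi_eq_pi]

instance : IsProbabilityMeasure (randomNumbers m n) := by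
  unfold randomNumbers; infer_instance

theorem ae_randomNumbers_ne_zero : ∀ᵐ ω ∂(randomNumbers m n), ∀ s, ω s ≠ 0 := by
  rw [ae_all_iff]
  intro s
  have := nullSingletonClass_gaussianReal (μ := 0) (v := 1) one_ne_zero
  have h : ∀ᵐ x ∂(gaussianReal 0 1), x ≠ 0 := by
    rw [ae_iff]
    simp
  exact (measurePreserving_eval_infinitePi
    (fun _ => gaussianReal 0 1) s).quasiMeasurePreserving.ae h

/-- The stored entries at the start of iteration `k` are independent of the random numbers of that
iteration. -/
theorem indepFun_entriesAt (hf : Differentiable ℝ f) (t L : ℝ) (v₀ : Fin m ⊕ Fin n → ℝ)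
    (q : ℕ → ℕ) (k : ℕ) :
    IndepFun (fun ω => entriesAt f t L v₀ q ω k) (fun ω (i : Fin m ⊕ Fin n) => ω (k, i))
      (randomNumbers m n) := by
  classical
  have h : iIndepFun (fun (s : ℕ × (Fin m ⊕ Fin n)) (ω : ℕ × (Fin m ⊕ Fin n) → ℝ) => ω s)
      (randomNumbers m n) :=
    iIndepFun_infinitePi (P := fun _ => gaussianReal 0 1) (X := fun _ x => x)
      fun _ => measurable_id
  have hdisj : Disjoint (Finset.range k ×ˢ (Finset.univ : Finset (Fin m ⊕ Fin n)))
      ({k} ×ˢ (Finset.univ : Finset (Fin m ⊕ Fin n))) := by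
    rw [Finset.disjoint_left]
    rintro ⟨j, i⟩ h1 h2
    simp at h1 h2
    omega
  have h1 := h.indepFun_finset _ _ hdisj fun s => measurable_pi_apply s
  let ext : ((Finset.range k ×ˢ (Finset.univ : Finset (Fin m ⊕ Fin n)) :
      Finset (ℕ × (Fin m ⊕ Fin n))) → ℝ) → (ℕ × (Fin m ⊕ Fin n) → ℝ) :=
    fun a s => if hs : s ∈ Finset.range k ×ˢ (Finset.univ : Finset (Fin m ⊕ Fin n)) then a ⟨s, hs⟩
      else 0
  have hext : Measurable ext := by
    refine measurable_pi_iff.mpr fun s => ?_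
    simp only [ext]
    split_ifs
    · exact measurable_pi_apply _
    · exact measurable_const
  have h2 := h1.comp (φ := fun a => entriesAt f t L v₀ q (ext a) k)
    (ψ := fun a i => a ⟨(k, i), by simp⟩)
    ((measurable_entriesAt hf t L v₀ q k).comp hext)
    (measurable_pi_iff.mpr fun i => measurable_pi_apply _)
  refine h2.congr (Filter.Eventually.of_forall fun ω => ?_)
    (Filter.Eventually.of_forall fun ω => rfl)
  refine entriesAt_congr f t L v₀ q fun j hj i => ?_
  simp [ext, hj]

/-- Integration over the random numbers of iteration `k` for a fixed past. -/
theorem lintegral_errPow_entriesAt (hf : Differentiable ℝ f) (t L : ℝ) (v₀ : Fin m ⊕ Fin n → ℝ)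
    (q : ℕ → ℕ) (ε' : ℝ) (p k : ℕ) :
    ∫⁻ ω, errPow f t L (q k) ε' p (entriesAt f t L v₀ q ω k) (fun i => ω (k, i))
      ∂(randomNumbers m n) =
    ∫⁻ ω, ∫⁻ g, errPow f t L (q k) ε' p (entriesAt f t L v₀ q ω k) g
      ∂(Measure.pi fun _ => gaussianReal 0 1) ∂(randomNumbers m n) := by
  have hX := measurable_entriesAt hf t L v₀ q k
  have hG : Measurable fun (ω : ℕ × (Fin m ⊕ Fin n) → ℝ) (i : Fin m ⊕ Fin n) => ω (k, i) :=
    measurable_pi_iff.mpr fun i => measurable_pi_apply _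
  have hφ := measurable_errPow hf t L (q k) ε' p
    (measurable_fst (α := Fin m × Fin n → ℝ) (β := Fin m ⊕ Fin n → ℝ)) measurable_snd
  have h1 := (indepFun_entriesAt hf t L v₀ q k).map_prod_eq_prod_map_map hX.aemeasurable
    hG.aemeasurable
  rw [map_randomNumbers] at h1
  rw [← lintegral_map (f := fun a : (Fin m × Fin n → ℝ) × (Fin m ⊕ Fin n → ℝ) =>
    errPow f t L (q k) ε' p a.1 a.2) hφ (hX.prodMk hG), h1,
    lintegral_prod _ hφ.aemeasurable, lintegral_map hφ.lintegral_prod_right' hX]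

/-- If no random number vanishes, then all vectors found are unit vectors. -/
theorem vecAt_unit (hf : Differentiable ℝ f) {t L : ℝ} (hL : 0 < L)
    (hspec : ∀ X ∈ spectahedron (Fin m ⊕ Fin n),
      ∀ μ ∈ spectrum ℝ (symGrad (lifted f t) X), |μ| ≤ L)
    {v₀ : Fin m ⊕ Fin n → ℝ} (h₀ : v₀ ⬝ᵥ v₀ = 1) {q : ℕ → ℕ} (hq : ∀ k, 0 < q k)
    (hS : (active (support f)).Nonempty) {ω : ℕ × (Fin m ⊕ Fin n) → ℝ} (hω : ∀ s, ω s ≠ 0)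
    (k : ℕ) :
    (∀ y, |y ⬝ᵥ (weightMatrix f t (entriesAt f t L v₀ q ω k) *ᵥ y)| ≤ L * (y ⬝ᵥ y)) ∧
      vecAt f t L v₀ q ω k ⬝ᵥ vecAt f t L v₀ q ω k = 1 := by
  induction k using Nat.strong_induction_on with
  | _ k ih =>
    have hX := iterate_mem_spectahedron h₀ (fun j hj => (ih j hj).2) k le_rfl
    have hA : ∀ y, |y ⬝ᵥ (weightMatrix f t (entriesAt f t L v₀ q ω k) *ᵥ y)| ≤ L * (y ⬝ᵥ y) := by
      intro y
      refine abs_quadForm_le (bip_transpose _) (fun μ hμ => hspec _ hX μ ?_) y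
      rwa [← weightMatrix_eq_symGrad hf t (entriesAt_eq f t L v₀ q ω k)]
    obtain ⟨i, hi⟩ := hS
    exact ⟨hA, stepVec_unit hL hA (hq k) ⟨i, hi, hω _⟩⟩

/-- The relative errors sum to at most `K` as soon as their `p`-th powers do, by Bernoulli's
inequality. -/
theorem sum_le_of_sum_pow_le {K p : ℕ} {η : ℕ → ℝ} (hη : ∀ k, 0 ≤ η k) (hp : 0 < p)
    (h : ∑ k ∈ Finset.range K, η k ^ p ≤ K) : ∑ k ∈ Finset.range K, η k ≤ K := by
  have h1 : ∀ k ∈ Finset.range K, 1 + (p : ℝ) * (η k - 1) ≤ η k ^ p := by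
    intro k _
    have := one_add_mul_le_pow (a := η k - 1) (by linarith [hη k]) p
    simpa using this
  have h2 := (Finset.sum_le_sum h1).trans h
  rw [Finset.sum_add_distrib, ← Finset.mul_sum, Finset.sum_sub_distrib] at h2
  simp only [Finset.sum_const, Finset.card_range, nsmul_eq_mul, mul_one] at h2
  have hp' : (0 : ℝ) < p := by exact_mod_cast hp
  have h3 : (p : ℝ) * (∑ k ∈ Finset.range K, η k - K) ≤ 0 := by linarith
  have := nonpos_of_mul_nonpos_right h3 hp'
  linarith

theorem one_le_dim {v₀ : Fin m ⊕ Fin n → ℝ} (h₀ : v₀ ⬝ᵥ v₀ = 1) : (1 : ℝ) ≤ (m : ℝ) + n := by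
  have := nonempty_of_dotProduct_self_eq_one h₀
  have := Fintype.card_pos (α := Fin m ⊕ Fin n)
  rw [Fintype.card_sum, Fintype.card_fin, Fintype.card_fin] at this
  exact_mod_cast this

/-- The success probability of the solver, for Lanczos' method with the constant
`a = 40 (c + 3)`, where `c` is the moment `invSqrtMoment`. -/
theorem measure_not_isEpsSolution_le {t C L : ℝ} (hc : ConvexOn ℝ Set.univ f)
    (hf : Differentiable ℝ f) (ht : 0 < t) (hC0 : 0 < C) (hL : 0 < L)
    (hC : curvature (lifted f t) ≤ (C : EReal))
    (hspec : ∀ X ∈ spectahedron (Fin m ⊕ Fin n),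
      ∀ μ ∈ spectrum ℝ (symGrad (lifted f t) X), |μ| ≤ L)
    {v₀ : Fin m ⊕ Fin n → ℝ} (h₀ : v₀ ⬝ᵥ v₀ = 1) {ε δ a ℓ : ℝ} (hε : 0 < ε) (hδ : 0 < δ)
    (hδ1 : δ < 1) (ha : a = 40 * (invSqrtMoment + 3))
    (hℓ : ℓ = 1 + Real.log (((m : ℝ) + n) / δ)) {K : ℕ} (hK : K = ⌈a * C / ε⌉₊ + 1) {q : ℕ → ℕ}
    (hq : ∀ k, a * ℓ * (1 + √(L / (stepSize k * C))) ≤ q k) :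
    randomNumbers m n {ω | ¬ IsEpsSolution f t ε
      (solution t v₀ (solver f t L v₀ q ω K).val.factors K)} ≤ ENNReal.ofReal δ := by
  have hc0 := invSqrtMoment_nonneg
  have := nonempty_of_dotProduct_self_eq_one h₀
  have hN := one_le_dim h₀
  have hNδ : 1 ≤ ((m : ℝ) + n) / δ := by
    rw [one_le_div hδ]; linarith
  have hℓ1 : 1 ≤ ℓ := by
    rw [hℓ]; linarith [Real.log_nonneg hNδ]
  have ha0 : 0 < a := by rw [ha]; positivity
  have hsol : ∀ ω, solution t v₀ (solver f t L v₀ q ω K).val.factors K =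
      solution t v₀ (vecAt f t L v₀ q ω) K := fun ω => by
    rw [solution, solution, iterate_congr (factors_eq_vecAt f t L v₀ q ω K)]
  simp only [hsol]
  rcases (active (support f)).eq_empty_or_nonempty with hS | hS
  · -- The objective is constant, and all vectors found are zero.
    have hΩ : support f = ∅ := by
      simpa [active] using hS
    have : {ω | ¬ IsEpsSolution f t ε (solution t v₀ (vecAt f t L v₀ q ω) K)} = ∅ := by
      refine Set.eq_empty_of_forall_notMem fun ω hω => hω ?_
      refine isEpsSolution_of_lifted_le ht h₀ (fun k _ => ?_) fun Y _ => ?_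
      · have : vecAt f t L v₀ q ω k = 0 := by
          rw [vecAt, stepVec, lanczosEV_val, hS]
          funext i
          simp [normalize, Counted.bind_val, divBy, forEach]
        rw [this]; simp
      · rw [lifted, lifted, eq_of_eq_on_support hf (Z' := t • Y.toBlocks₁₂) (by simp [hΩ])]
        linarith
    rw [this, measure_empty]
    exact zero_le
  have hstep : ∀ k, 0 < stepSize k := fun k => (stepSize_mem k).1
  have hq0 : ∀ k, 0 < q k := by
    intro k
    have : 0 < a * ℓ * (1 + √(L / (stepSize k * C))) := by
      have := Real.sqrt_nonneg (L / (stepSize k * C))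
      positivity
    exact_mod_cast this.trans_le (hq k)
  set p := ⌈ℓ⌉₊ with hp
  have hp0 : 0 < p := Nat.ceil_pos.mpr (by linarith)
  have hθ : (1036 / a ^ 2) ^ p * (1 + ((m : ℝ) + n) + invSqrtMoment) ≤ δ := by
    obtain ⟨r, hr⟩ : ∃ r, p = r + 1 := ⟨p - 1, by omega⟩
    have hr1 : Real.log (((m : ℝ) + n) / δ) ≤ r := by
      have := Nat.le_ceil ℓ
      rw [← hp, hr, hℓ] at this
      push_cast at this
      linarith
    set s := invSqrtMoment + 3 with hs
    have h1 : 1036 / a ^ 2 ≤ 1 / s := by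
      rw [ha, div_le_div_iff₀ (by positivity) (by positivity)]
      nlinarith
    have h2 : ((m : ℝ) + n) / δ ≤ s ^ r := by
      calc ((m : ℝ) + n) / δ = Real.exp (Real.log (((m : ℝ) + n) / δ)) :=
            (Real.exp_log (by linarith)).symm
        _ ≤ Real.exp (r * 1) := Real.exp_le_exp.mpr (by linarith)
        _ = Real.exp 1 ^ r := Real.exp_nat_mul 1 r
        _ ≤ s ^ r := by
          refine pow_le_pow_left₀ (Real.exp_pos 1).le ?_ r
          linarith [Real.exp_one_lt_d9]
    have hs0 : 0 < s := by positivity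
    have h3 : (1036 / a ^ 2) ^ p ≤ 1 / (s * s ^ r) := by
      rw [hr, ← pow_succ', ← one_div_pow]
      exact pow_le_pow_left₀ (by positivity) h1 _
    refine (mul_le_mul_of_nonneg_right h3 (by positivity)).trans ?_
    rw [one_div_mul_eq_div, div_le_iff₀ (by positivity)]
    rw [div_le_iff₀ hδ] at h2
    have h4 := mul_le_mul_of_nonneg_left h2 hs0.le
    nlinarith
  have hK1 : (8 * C / ε : ℝ) ≤ K := by
    have h1 := Nat.le_ceil (a * C / ε)
    rw [hK]
    push_cast
    have : 8 * C / ε ≤ a * C / ε := by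
      gcongr
      rw [ha]; linarith
    linarith
  have hKpos : (0 : ℝ) < K := by rw [hK]; positivity
  -- By Markov's inequality, `Φ < K` fails with probability at most `δ`.
  let Φ : (ℕ × (Fin m ⊕ Fin n) → ℝ) → ENNReal := fun ω => ∑ k ∈ Finset.range K,
    errPow f t L (q k) (stepSize k * C) p (entriesAt f t L v₀ q ω k) fun i => ω (k, i)
  have hsub : ∀ ω, (∀ s, ω s ≠ 0) → Φ ω < K →
      IsEpsSolution f t ε (solution t v₀ (vecAt f t L v₀ q ω) K) := by
    intro ω hω hΦ
    have hunit := vecAt_unit hf hL hspec h₀ hq0 hS hω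
    refine isEpsSolution_of_lifted_le ht h₀ (fun k _ => (hunit k).2.le) fun Y hY => ?_
    choose μ hμs z hz1 hz hμ using fun k => exists_bottom_eigenvector
      (A := weightMatrix f t (entriesAt f t L v₀ q ω k)) (bip_transpose _)
    let η : ℕ → ℝ := fun k => max 0 ((vecAt f t L v₀ q ω k ⬝ᵥ
      (weightMatrix f t (entriesAt f t L v₀ q ω k) *ᵥ vecAt f t L v₀ q ω k) - μ k) /
        (stepSize k * C))
    have hη0 : ∀ k, 0 ≤ η k := fun k => le_max_left _ _
    have hηp : ∀ k, ENNReal.ofReal (η k ^ p) ≤ errPow f t L (q k) (stepSize k * C) p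
        (entriesAt f t L v₀ q ω k) fun i => ω (k, i) := by
      intro k
      rw [ENNReal.ofReal_pow (hη0 k), errPow]
      refine pow_le_pow_left' ?_ p
      have h1 := le_gap (w := weights f t (entriesAt f t L v₀ q ω k))
        (v := vecAt f t L v₀ q ω k) (hz1 k)
      have h2 : z k ⬝ᵥ (weightMatrix f t (entriesAt f t L v₀ q ω k) *ᵥ z k) = μ k := by
        rw [hz, dotProduct_smul, hz1, smul_eq_mul, mul_one]
      change ENNReal.ofReal (_ - z k ⬝ᵥ (weightMatrix f t (entriesAt f t L v₀ q ω k) *ᵥ z k)) ≤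
        _ at h1
      rw [h2] at h1
      simp only [η]
      rw [ENNReal.ofReal_max, ENNReal.ofReal_zero, max_eq_right zero_le,
        ENNReal.ofReal_div_of_pos (mul_pos (hstep k) hC0)]
      exact ENNReal.div_le_div_right h1 _
    have hsum : ∑ k ∈ Finset.range K, η k ≤ K := by
      refine sum_le_of_sum_pow_le hη0 hp0 ?_
      have h1 : ENNReal.ofReal (∑ k ∈ Finset.range K, η k ^ p) < ENNReal.ofReal K := by
        rw [ENNReal.ofReal_sum_of_nonneg fun k _ => pow_nonneg (hη0 k) p, ENNReal.ofReal_natCast]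
        exact (Finset.sum_le_sum fun k _ => hηp k).trans_lt hΦ
      exact ((ENNReal.ofReal_lt_ofReal_iff hKpos).mp h1).le
    have hmain := lifted_iterate_le hc hf hC h₀ (fun k (_ : k < K) => (hunit k).2) hη0
      (fun k _ Y hY => by
        rw [← weightMatrix_eq_symGrad hf t (entriesAt_eq f t L v₀ q ω k)]
        have h1 := le_frob_of_quadForm (hμ k) hY
        have h2 : _ / (stepSize k * C) ≤ η k := le_max_right _ _
        rw [div_le_iff₀' (mul_pos (hstep k) hC0)] at h2
        linarith) hY
    rw [Finset.sum_add_distrib] at hmain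
    simp only [Finset.sum_const, Finset.card_range, nsmul_eq_mul, mul_one] at hmain
    rw [div_le_iff₀ hε] at hK1
    by_contra hlt
    push Not at hlt
    have h1 : ε < lifted f t (iterate v₀ (vecAt f t L v₀ q ω) K) - lifted f t Y := by linarith
    have h2 := mul_lt_mul_of_pos_left h1 (by positivity : 0 < (K : ℝ) * (K + 1))
    have h3 : 4 * C * (K + ∑ k ∈ Finset.range K, η k) ≤ 4 * C * (K + K) := by gcongr
    nlinarith [mul_pos hKpos hε, mul_le_mul_of_nonneg_left hK1 hKpos.le]
  have hmk : ∀ k, Measurable fun ω => errPow f t L (q k) (stepSize k * C) p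
      (entriesAt f t L v₀ q ω k) fun i => ω (k, i) := by
    intro k
    have hG : Measurable fun (ω : ℕ × (Fin m ⊕ Fin n) → ℝ) (i : Fin m ⊕ Fin n) => ω (k, i) :=
      measurable_pi_iff.mpr fun i => measurable_pi_apply _
    exact measurable_errPow hf t L (q k) (stepSize k * C) p (measurable_entriesAt hf t L v₀ q k) hG
  have hΦm : Measurable Φ := Finset.measurable_sum _ fun k _ => hmk k
  have hΦi : ∫⁻ ω, Φ ω ∂(randomNumbers m n) ≤ K * ENNReal.ofReal δ := by
    rw [lintegral_finsetSum _ fun k _ => hmk k]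
    refine (Finset.sum_le_card_nsmul _ _ (ENNReal.ofReal δ) fun k _ => ?_).trans (by simp)
    rw [lintegral_errPow_entriesAt hf]
    have hae : ∀ᵐ ω ∂(randomNumbers m n), ∫⁻ g, errPow f t L (q k) (stepSize k * C) p
        (entriesAt f t L v₀ q ω k) g ∂(Measure.pi fun _ => gaussianReal 0 1) ≤
          ENNReal.ofReal δ := by
      filter_upwards [ae_randomNumbers_ne_zero] with ω hω
      exact (lintegral_errPow_le hL (mul_pos (hstep k) hC0) hℓ1 ha0
        (vecAt_unit hf hL hspec h₀ hq0 hS hω k).1 (hq k)).trans (ENNReal.ofReal_le_ofReal hθ)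
    exact (lintegral_mono_ae hae).trans (by simp)
  have hmarkov : randomNumbers m n {ω | (K : ENNReal) ≤ Φ ω} ≤ ENNReal.ofReal δ := by
    have h1 := (mul_meas_ge_le_lintegral hΦm (K : ENNReal)).trans hΦi
    have hK0 : (K : ENNReal) ≠ 0 := by exact_mod_cast (by omega : K ≠ 0)
    exact (ENNReal.mul_le_mul_iff_right hK0 (ENNReal.natCast_ne_top K)).mp h1
  refine (measure_mono_ae ?_).trans hmarkov
  filter_upwards [ae_randomNumbers_ne_zero] with ω hω hbad
  by_contra hlt
  exact hbad (hsub ω hω (not_le.mp hlt))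

end Probability

/-! ### The number of operations -/

section Operations

section LanczosOperations

variable {ι : Type} [Fintype ι] [DecidableEq ι]

theorem dot_ops (S : Finset ι) (u v : ι → ℝ) : (dot S u v).ops = 2 * S.card := by
  simp [dot, sumOver, rMul, mul_comm]

theorem axmy_ops (S : Finset ι) (u : ι → ℝ) (c : ℝ) (v : ι → ℝ) :
    (axmy S u c v).ops = 2 * S.card := by
  simp [axmy, forEach, Counted.bind_ops, rMul, rSub, mul_comm]

theorem axpy_ops (S : Finset ι) (u : ι → ℝ) (c : ℝ) (v : ι → ℝ) :
    (axpy S u c v).ops = 2 * S.card := by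
  simp [axpy, forEach, Counted.bind_ops, rMul, rAdd, mul_comm]

theorem divBy_ops (S : Finset ι) (u : ι → ℝ) (c : ℝ) : (divBy S u c).ops = S.card := by
  simp [divBy, forEach, rDiv]

theorem normalize_ops (S : Finset ι) (u : ι → ℝ) : (normalize S u).ops = 3 * S.card + 1 := by
  simp only [normalize, Counted.bind_ops, dot_ops, divBy_ops, rSqrt]
  ring

theorem lanczosRows_ops_le (S : Finset ι) (mv : (ι → ℝ) → Counted (ι → ℝ)) {M : ℕ}
    (hM : ∀ v, (mv v).ops ≤ M) (q : ℕ) (vPrev : ι → ℝ) (bPrev : ℝ) (v : ι → ℝ) :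
    (lanczosRows S mv q vPrev bPrev v).ops ≤ q * (M + 9 * S.card + 2) := by
  induction q generalizing vPrev bPrev v with
  | zero => simp [lanczosRows, Counted.pure_ops]
  | succ q ih =>
    simp only [lanczosRows, Counted.bind_ops, axmy_ops, dot_ops, rSqrt, rPos]
    have h1 := hM v
    set w₁ := (axmy S (mv v).val bPrev vPrev).val
    set w₂ := (axmy S w₁ (dot S w₁ v).val v).val
    split_ifs
    · simp only [Counted.bind_ops, Counted.pure_ops, divBy_ops]
      have h2 := ih v (√(dot S w₂ w₂).val) (divBy S w₂ (√(dot S w₂ w₂).val)).val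
      rw [add_one_mul]
      omega
    · simp only [Counted.pure_ops]
      rw [add_one_mul]
      omega

theorem pivotsPos_ops_le (μ : ℝ) (rows : List (LanczosRow ι)) (c : ℝ) :
    (pivotsPos μ rows c).ops ≤ 5 * rows.length := by
  induction rows generalizing c with
  | nil => simp [pivotsPos, Counted.pure_ops]
  | cons r rs ih =>
    simp only [pivotsPos, Counted.bind_ops, rSub, rPos, List.length_cons]
    split_ifs
    · simp only [Counted.bind_ops, rDiv, rMul]
      have := ih (r.off / (r.diag - μ - c) * r.off)
      omega
    · simp only [Counted.pure_ops]
      omega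

theorem bisect_ops_le (rows : List (LanczosRow ι)) (B : ℕ) (lo hi : ℝ) :
    (bisect rows B lo hi).ops ≤ B * (2 + 5 * rows.length) := by
  induction B generalizing lo hi with
  | zero => simp [bisect, Counted.pure_ops]
  | succ B ih =>
    simp only [bisect, Counted.bind_ops, rAdd, rDiv]
    have h1 := pivotsPos_ops_le ((lo + hi) / 2) rows 0
    rw [add_one_mul]
    split_ifs
    · have := ih ((lo + hi) / 2) hi
      omega
    · have := ih lo ((lo + hi) / 2)
      omega

theorem solveAlt_ops (μ : ℝ) (rows : List (LanczosRow ι)) (c s g : ℝ) :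
    (solveAlt μ rows c s g).ops = 10 * rows.length := by
  induction rows generalizing c s g with
  | nil => simp [solveAlt, Counted.pure_ops]
  | cons r rs ih =>
    simp only [solveAlt, Counted.bind_ops, Counted.pure_ops, rSub, rDiv, rMul, ih,
      List.length_cons]
    ring

theorem combine_ops_le (S : Finset ι) (rows : List (LanczosRow ι)) (ys : List ℝ) :
    (combine S rows ys).ops ≤ 2 * S.card * rows.length := by
  induction rows generalizing ys with
  | nil => simp [combine, Counted.pure_ops]
  | cons r rs ih =>
    cases ys with
    | nil => simp [combine, Counted.pure_ops]
    | cons y ys =>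
      simp only [combine, Counted.bind_ops, axpy_ops, List.length_cons]
      have := ih ys
      rw [mul_add_one]
      omega

/-- A matrix multiplication and a few vector operations per Lanczos step, and a pass over the at
most `|S|` rows of the tridiagonal matrix per bisection step. -/
theorem lanczosEV_ops_le (S : Finset ι) (mv : (ι → ℝ) → Counted (ι → ℝ)) (L : ℝ) (q : ℕ)
    (g : ι → ℝ) {M : ℕ} (hM : ∀ v, (mv v).ops ≤ M) :
    (lanczosEV S mv L q g).ops ≤ q * (M + 16 * S.card + 4) + 17 * S.card + 3 := by
  simp only [lanczosEV, Counted.bind_ops, normalize_ops, rMul, solveAlt_ops]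
  set rows := (lanczosRows S mv (min q S.card) 0 0
    (normalize S (forEach S fun i => rRead (g i)).val).val).val with hrows
  have hlen : rows.length ≤ min q S.card := lanczosRows_length_le _ _ _ _ _ _
  have h0 : (forEach S fun i => rRead (g i)).ops = S.card := by simp [forEach, rRead]
  have h1 := lanczosRows_ops_le S mv hM (min q S.card) 0 0
    (normalize S (forEach S fun i => rRead (g i)).val).val
  have h2 := bisect_ops_le rows q (-2 * L) L
  have h3 := combine_ops_le S rows (solveAlt (bisect rows q (-2 * L) L).val rows 0 0 1).val
  have hq : min q S.card ≤ q := min_le_left _ _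
  have hs : min q S.card ≤ S.card := min_le_right _ _
  have h1' := h1.trans (Nat.mul_le_mul_right _ hq)
  have h2' := h2.trans (Nat.mul_le_mul_left q
    (by omega : 2 + 5 * rows.length ≤ 2 + 5 * S.card))
  have h3' := h3.trans (Nat.mul_le_mul_left _ (hlen.trans hq))
  rw [h0]
  nlinarith

end LanczosOperations

variable {m n : ℕ}

theorem card_active_le (Ω : Finset (Fin m × Fin n)) : (active Ω).card ≤ 2 * Ω.card := by
  have h1 := Finset.card_union_le (Ω.image fun p => (Sum.inl p.1 : Fin m ⊕ Fin n))
    (Ω.image fun p => Sum.inr p.2)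
  have h2 := Finset.card_image_le (s := Ω) (f := fun p => (Sum.inl p.1 : Fin m ⊕ Fin n))
  have h3 := Finset.card_image_le (s := Ω) (f := fun p => (Sum.inr p.2 : Fin m ⊕ Fin n))
  unfold active
  omega

/-- Every position of `Ω` is used twice, once for its row and once for its column. -/
theorem bipMulVec_ops_le (Ω : Finset (Fin m × Fin n)) (w : Fin m × Fin n → ℝ)
    (v : Fin m ⊕ Fin n → ℝ) : (bipMulVec Ω w v).ops ≤ 4 * Ω.card := by
  have h : (bipMulVec Ω w v).ops = ∑ s ∈ active Ω, Sum.elim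
      (fun i => 2 * (Ω.filter fun p => p.1 = i).card)
      (fun j => 2 * (Ω.filter fun p => p.2 = j).card) s := by
    refine Finset.sum_congr rfl fun s _ => ?_
    rcases s with i | j <;> simp [sumOver, rMul, mul_comm]
  rw [h]
  refine (Finset.sum_le_sum_of_subset (Finset.subset_univ _)).trans ?_
  rw [Fintype.sum_sum_type]
  simp only [Sum.elim_inl, Sum.elim_inr, ← Finset.mul_sum]
  rw [← Finset.card_eq_sum_card_fiberwise (f := fun p : Fin m × Fin n => p.1) (s := Ω)
    (t := Finset.univ) (by simp [Set.MapsTo]),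
    ← Finset.card_eq_sum_card_fiberwise (f := fun p : Fin m × Fin n => p.2) (s := Ω)
    (t := Finset.univ) (by simp [Set.MapsTo])]
  omega

theorem solverStep_ops_le (f : Matrix (Fin m) (Fin n) ℝ → ℝ) (t L : ℝ) (k q : ℕ)
    (g : Fin m ⊕ Fin n → ℝ) (σ : SolverState m n) :
    (solverStep f t L k q g σ).ops ≤ 47 * max 1 (support f).card * (q + 1) := by
  have h1 := lanczosEV_ops_le (active (support f)) (bipMulVec (support f) (weights f t σ.entries))
    L q g (bipMulVec_ops_le (support f) (weights f t σ.entries))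
  have h2 : (solverStep f t L k q g σ).ops = 7 * (support f).card + 3 +
      (lanczosEV (active (support f))
        (bipMulVec (support f) (weights f t σ.entries)) L q g).ops := by
    simp only [solverStep, Counted.bind_ops, Counted.pure_ops, forEach, rMul, rRead, rDiv, rAdd,
      rSub, Finset.sum_const, smul_eq_mul, mul_one, add_zero]
    change _ + (_ + (1 + (_ + ((lanczosEV (active (support f))
      (bipMulVec (support f) (weights f t σ.entries)) L q g).ops + _)))) = _
    ring
  have h3 := card_active_le (support f)
  have h4 : (support f).card ≤ max 1 (support f).card := le_max_right _ _
  have h5 : 1 ≤ max 1 (support f).card := le_max_left _ _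
  rw [h2]
  set M := max 1 (support f).card
  have h6 : q * (4 * (support f).card + 16 * (active (support f)).card + 4) ≤ q * (40 * M) :=
    Nat.mul_le_mul_left q (by omega)
  nlinarith

theorem solver_ops_le (f : Matrix (Fin m) (Fin n) ℝ → ℝ) (t L : ℝ) (v₀ : Fin m ⊕ Fin n → ℝ)
    (q : ℕ → ℕ) (ω : ℕ × (Fin m ⊕ Fin n) → ℝ) (K : ℕ) :
    (solver f t L v₀ q ω K).ops ≤
      max 1 (support f).card * (1 + 47 * ∑ k ∈ Finset.range K, (q k + 1)) := by
  induction K with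
  | zero =>
    simp only [solver, Counted.bind_ops, Counted.pure_ops, forEach, rMul, Finset.sum_const,
      smul_eq_mul, mul_one, add_zero, Finset.range_zero, Finset.sum_empty, mul_zero]
    exact le_max_right _ _
  | succ K ih =>
    have h := solverStep_ops_le f t L K (q K) (fun i => ω (K, i)) (solver f t L v₀ q ω K).val
    have h1 : (solver f t L v₀ q ω (K + 1)).ops = (solver f t L v₀ q ω K).ops +
      (solverStep f t L K (q K) (fun i => ω (K, i)) (solver f t L v₀ q ω K).val).ops := rfl
    rw [h1, Finset.sum_range_succ]
    refine (add_le_add ih h).trans (le_of_eq ?_)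
    ring

/-- The total number of operations, for the numbers of iterations and of Lanczos steps prescribed by
the constant `a`. -/
theorem solver_ops_le_rpow {a : ℝ} (ha : 0 < a) (f : Matrix (Fin m) (Fin n) ℝ → ℝ) (t : ℝ)
    {C L ε ℓ : ℝ} (hC : 0 < C) (hL : 0 < L) (hε : 0 < ε) (hℓ : 1 ≤ ℓ) (v₀ : Fin m ⊕ Fin n → ℝ)
    (ω : ℕ × (Fin m ⊕ Fin n) → ℝ) {K : ℕ} (hK : K = ⌈a * C / ε⌉₊ + 1) :
    ((solver f t L v₀ (fun k => ⌈a * ℓ * (1 + √(L / (stepSize k * C)))⌉₊) ω K).ops : ℝ) ≤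
      48 * (a + 2) ^ (5 / 2 : ℝ) * max 1 ((support f).card : ℝ) * ℓ * (1 + √(L / C)) *
        (1 + C / ε) ^ (3 / 2 : ℝ) := by
  have hK1 : (1 : ℝ) ≤ K := by rw [hK]; push_cast; linarith [Nat.cast_nonneg (α := ℝ) ⌈a * C / ε⌉₊]
  have hKle : (K : ℝ) ≤ (a + 2) * (1 + C / ε) := by
    have h1 := (Nat.ceil_lt_add_one (by positivity : 0 ≤ a * C / ε)).le
    have h2 : 0 < C / ε := by positivity
    rw [mul_div_assoc] at h1
    rw [hK, Nat.cast_add, Nat.cast_one, mul_div_assoc]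
    nlinarith
  have hsK : 1 ≤ √(K : ℝ) := Real.one_le_sqrt.mpr hK1
  set s := √(L / C) with hs
  have hs0 : 0 ≤ s := Real.sqrt_nonneg _
  set Q := (a + 2) * ℓ * (1 + s) * √(K : ℝ) with hQ
  -- `k < K` gives `1 / stepSize k ≤ K`, whence the factor `√K` in the number of Lanczos steps.
  have hq : ∀ k ∈ Finset.range K,
      ((⌈a * ℓ * (1 + √(L / (stepSize k * C)))⌉₊ + 1 : ℕ) : ℝ) ≤ Q := by
    intro k hk
    have hkK : (k : ℝ) + 1 ≤ K := by exact_mod_cast Finset.mem_range.mp hk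
    have h1 : √(L / (stepSize k * C)) ≤ s * √(K : ℝ) := by
      rw [hs, ← Real.sqrt_mul (by positivity)]
      refine Real.sqrt_le_sqrt ?_
      have : L / (stepSize k * C) = L / C * (((k : ℝ) + 2) / 2) := by
        rw [stepSize]; field_simp
      rw [this]
      gcongr
      linarith
    have h0 : 0 ≤ a * ℓ * (1 + √(L / (stepSize k * C))) := by
      have := Real.sqrt_nonneg (L / (stepSize k * C))
      positivity
    have h2 := (Nat.ceil_lt_add_one h0).le
    have h3 : 1 + √(L / (stepSize k * C)) ≤ (1 + s) * √(K : ℝ) := by nlinarith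
    have h4 : a * ℓ * (1 + √(L / (stepSize k * C))) ≤ a * ℓ * ((1 + s) * √(K : ℝ)) := by gcongr
    have h5 : 1 ≤ ℓ * ((1 + s) * √(K : ℝ)) :=
      one_le_mul_of_one_le_of_one_le hℓ (one_le_mul_of_one_le_of_one_le (by linarith) hsK)
    push_cast
    rw [hQ]
    nlinarith
  have hsum : ((∑ k ∈ Finset.range K, (⌈a * ℓ * (1 + √(L / (stepSize k * C)))⌉₊ + 1) : ℕ) : ℝ) ≤
      K * Q := by
    rw [Nat.cast_sum]
    exact (Finset.sum_le_card_nsmul _ _ _ hq).trans (by simp)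
  have hops := solver_ops_le f t L v₀ (fun k => ⌈a * ℓ * (1 + √(L / (stepSize k * C)))⌉₊) ω K
  have hops' : ((solver f t L v₀ (fun k => ⌈a * ℓ * (1 + √(L / (stepSize k * C)))⌉₊) ω K).ops : ℝ)
      ≤ max 1 ((support f).card : ℝ) * (1 + 47 *
        ((∑ k ∈ Finset.range K, (⌈a * ℓ * (1 + √(L / (stepSize k * C)))⌉₊ + 1) : ℕ) : ℝ)) := by
    exact_mod_cast hops
  have hKQ : 1 ≤ K * Q := by
    have : 1 ≤ Q := one_le_mul_of_one_le_of_one_le (one_le_mul_of_one_le_of_one_le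
      (one_le_mul_of_one_le_of_one_le (by linarith) hℓ) (by linarith)) hsK
    exact one_le_mul_of_one_le_of_one_le hK1 this
  have hM : 0 < max 1 ((support f).card : ℝ) := zero_lt_one.trans_le (le_max_left _ _)
  have hpow : (K : ℝ) * √(K : ℝ) ≤ (a + 2) ^ (3 / 2 : ℝ) * (1 + C / ε) ^ (3 / 2 : ℝ) := by
    rw [← Real.mul_rpow (by positivity) (by positivity)]
    refine le_trans (le_of_eq ?_) (Real.rpow_le_rpow (by linarith) hKle (by norm_num))
    rw [show (3 / 2 : ℝ) = 1 + 1 / 2 by norm_num, Real.rpow_add (by linarith), Real.rpow_one,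
      Real.sqrt_eq_rpow]
  have ha52 : (a + 2) ^ (5 / 2 : ℝ) = (a + 2) * (a + 2) ^ (3 / 2 : ℝ) := by
    rw [show (5 / 2 : ℝ) = 1 + 3 / 2 by norm_num, Real.rpow_add (by linarith), Real.rpow_one]
  set M := max 1 ((support f).card : ℝ)
  calc ((solver f t L v₀ (fun k => ⌈a * ℓ * (1 + √(L / (stepSize k * C)))⌉₊) ω K).ops : ℝ)
      ≤ M * (1 + 47 * (K * Q)) := hops'.trans (by gcongr)
    _ ≤ M * (48 * (K * Q)) := by
        refine mul_le_mul_of_nonneg_left ?_ hM.le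
        linarith
    _ = 48 * (a + 2) * M * ℓ * (1 + s) * (K * √(K : ℝ)) := by rw [hQ]; ring
    _ ≤ 48 * (a + 2) * M * ℓ * (1 + s) *
          ((a + 2) ^ (3 / 2 : ℝ) * (1 + C / ε) ^ (3 / 2 : ℝ)) := by gcongr
    _ = _ := by rw [ha52]; ring

end Operations

end NucFW
end

theorem corollary11p5 :
    -- Any run with approximate eigenvectors, one per iteration: `O(1/ε)` iterations suffice.
    (∀ (m n : ℕ) (f : Matrix (Fin m) (Fin n) ℝ → ℝ) (t C : ℝ),
      ConvexOn ℝ Set.univ f → Differentiable ℝ f → 0 < t →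
      NucFW.curvature (NucFW.lifted f t) ≤ (C : EReal) →
      ∀ (v₀ : Fin m ⊕ Fin n → ℝ) (v : ℕ → Fin m ⊕ Fin n → ℝ),
        NucFW.IsHazanRun (NucFW.lifted f t) C v₀ v →
        ∀ ε : ℝ, 0 < ε → ∀ k : ℕ, 1 ≤ k → 8 * C / ε ≤ k →
          NucFW.IsEpsSolution f t ε (NucFW.solution t v₀ v k)) ∧
    -- With Lanczos' method: total number of arithmetic operations, and success probability.
    (∃ a b : ℝ, 0 < a ∧ 0 < b ∧
      ∀ (m n : ℕ) (f : Matrix (Fin m) (Fin n) ℝ → ℝ) (t C L : ℝ),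
        ConvexOn ℝ Set.univ f → Differentiable ℝ f → 0 < t → 0 < C → 0 < L →
        NucFW.curvature (NucFW.lifted f t) ≤ (C : EReal) →
        (∀ X ∈ NucFW.spectahedron (Fin m ⊕ Fin n),
          ∀ μ ∈ spectrum ℝ (NucFW.symGrad (NucFW.lifted f t) X), |μ| ≤ L) →
        ∀ v₀ : Fin m ⊕ Fin n → ℝ, v₀ ⬝ᵥ v₀ = 1 →
        ∀ ε δ : ℝ, 0 < ε → 0 < δ → δ < 1 →
          let ℓ : ℝ := 1 + Real.log (((m : ℝ) + n) / δ)
          let K : ℕ := ⌈a * C / ε⌉₊ + 1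
          let q : ℕ → ℕ := fun k => ⌈a * ℓ * (1 + √(L / (NucFW.stepSize k * C)))⌉₊
          (∀ ω, ((NucFW.solver f t L v₀ q ω K).ops : ℝ) ≤
            b * max 1 ((NucFW.support f).card : ℝ) * ℓ * (1 + √(L / C)) *
              (1 + C / ε) ^ (3 / 2 : ℝ)) ∧
          NucFW.randomNumbers m n {ω | ¬ NucFW.IsEpsSolution f t ε
            (NucFW.solution t v₀ (NucFW.solver f t L v₀ q ω K).val.factors K)} ≤
              ENNReal.ofReal δ) := by
  refine ⟨fun m n f t C hc hf ht hC v₀ v hrun ε hε k hk hkε =>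
    NucFW.isEpsSolution_of_isHazanRun hc hf ht hC hrun hε hk hkε,
    40 * (NucFW.invSqrtMoment + 3), 48 * (40 * (NucFW.invSqrtMoment + 3) + 2) ^ (5 / 2 : ℝ), ?_⟩
  have ha : 0 < 40 * (NucFW.invSqrtMoment + 3) := by
    linarith [NucFW.invSqrtMoment_nonneg]
  refine ⟨ha, by positivity, ?_⟩
  intro m n f t C L hc hf ht hC0 hL hC hspec v₀ h₀ ε δ hε hδ hδ1 ℓ K q
  refine ⟨fun ω => ?_, ?_⟩
  · refine NucFW.solver_ops_le_rpow ha f t hC0 hL hε ?_ v₀ ω rfl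
    have hN := NucFW.one_le_dim h₀
    have h1 : 1 ≤ ((m : ℝ) + n) / δ := by
      rw [one_le_div hδ]
      linarith
    have h2 := Real.log_nonneg h1
    simp only [ℓ]
    linarith
  · exact NucFW.measure_not_isEpsSolution_le hc hf ht hC0 hL hC hspec h₀ hε hδ hδ1 rfl rfl rfl
      fun k => Nat.le_ceil _
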